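/- Let $-\infty<\omega_*<\omega^*<\infty$, $T>0$, let $(e_1,e_2,e_3)$ be the canonical basis of $\mathbb R^3$, $\mathbb S^2$ its unit sphere, $\wedge$ the cross product, $H^1=H^1((\omega_*,\omega^*))$ with $\|f\|_{H^1}^2=\|f\|_{L^2}^2+\|f'\|_{L^2}^2$ ($3\times 3$ matrices carry the operator norm, and $H^1$ functions are identified with their continuous representatives on $[\omega_*,\omega^*]$). Put $$\varepsilon(t)=(-1)^{\lfloor t/T\rfloor},\quad P(t)=\mathrm{diag}(1,\varepsilon(t),\varepsilon(t)),\quad \sigma(t)=\int_0^t\varepsilon(s)\,ds,\quad S=\begin{pmatrix}0&1&0\\-1&0&0\\0&0&0\end{pmatrix}.$$ Let $M_f\in H^1((\omega_*,\omega^*),\mathbb S^2)$ satisfy $\langle M_f(\omega),e_3\rangle\neq0$ for all $\omega\in[\omega_*,\omega^*]$. For $R\in H^1((\omega_*,\omega^*),SO_3(\mathbb R))$ with $R(\omega)M_f(\omega)=-e_3$ for all $\omega$, put $F(t,\omega)=R(\omega)\exp(\sigma(t)\omega S)$ and, for $i=1,2$, $$H_i[t,N]=\int_{\omega_*}^{\omega^*}\Big[\Big\langle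 \tfrac{dN}{d\omega},\big(\tfrac{\partial F}{\partial\omega}(t,\omega)e_i\big)\wedge N(\omega)\Big\rangle+\big\langle e_3,(F(t,\omega)e_i)\wedge N(\omega)\big\rangle\Big]d\omega .$$ Consider the closed-loop Bloch equation $$\partial_t M=(\tilde u_1e_1+\tilde u_2e_2+\omega e_3)\wedge M,\quad M(0)=M_0,\qquad \tilde u_1=u_1+\sum_{k\ge1}\pi\,\delta(t-kT),\quad \tilde u_2=\varepsilon(t)u_2,$$ with the feedback $u_i(t)=-H_i[t,N(t)]$, $N(t,\omega)=F(t,\omega)P(t)M(t,\omega)$. A solution is a map $M$ with values in $H^1((\omega_*,\omega^*),\mathbb R^3)$ that is differentiable in $H^1$ and satisfies the equation with $\tilde u_1=u_1$ on each interval $(kT,(k+1)T)$, is right continuous in $H^1$ at $0$ with $M(0)=M_0$, and has one-sided limits in $H^1$ at each $kT$, $k\ge1$, with $M((kT)^+)=\mathrm{diag}(1,-1,-1)\,M((kT)^-)$, the rotation of angle $\pi$ around $\mathbb Re_1$. Then matrix functions $R$ as above exist. Moreover, for every constant $C$ there is $\delta_2>0$ (depending on $\omega_*,\omega^*,T,M_f,C$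 only) such that, for every $R$ as above with $\|R\|_{H^1}\le C\|M_f\|_{H^1}$ and every $M_0\in H^1((\omega_*,\omega^*),\mathbb S^2)$ with $\|M_0-M_f\|_{H^1}<\delta_2$, the closed-loop system has a solution $M$, this solution is unique (up to its values at the times $kT$, $k\ge1$), and $$M((2kT)^+)\rightharpoonup M_f\ \text{ weakly in } H^1\text{ as }k\to\infty .$$ In particular $\lim_{k\to\infty}\|M((2kT)^+)-M_f\|_{L^\infty(\omega_*,\omega^*)}=0$. -/

import Mathlib

open MeasureTheory Filter Topology
open scoped ENNReal

namespace BlochEnsemble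

noncomputable section

/-! ### The Sobolev space H¹ of a bounded open interval -/

/-- Lebesgue measure on the open interval `(a, b)`. -/
abbrev intervalMeasure (a b : ℝ) : Measure ℝ := volume.restrict (Set.Ioo a b)

/-- `g` is a weak derivative of `f` on `(a, b)`: for every smooth test function `φ` compactly
supported in `(a, b)`, `∫ φ' f = - ∫ φ g`. -/
def HasWeakDeriv {E : Type*} [NormedAddCommGroup E] [NormedSpace ℝ E] (a b : ℝ)
    (f g : ℝ → E) : Prop :=
  ∀ φ : ℝ → ℝ, ContDiff ℝ ((⊤ : ℕ∞) : WithTop ℕ∞) φ → HasCompactSupport φ → tsupport φ ⊆ Set.Ioo a b →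
    ∫ ω, deriv φ ω • f ω ∂(intervalMeasure a b) = - ∫ ω, φ ω • g ω ∂(intervalMeasure a b)

theorem integrable_smul_Lp {E : Type*} [NormedAddCommGroup E] [NormedSpace ℝ E] {a b : ℝ}
    {ψ : ℝ → ℝ} (hψ : Continuous ψ) (hc : HasCompactSupport ψ)
    (f : Lp E 2 (intervalMeasure a b)) :
    Integrable (fun ω => ψ ω • f ω) (intervalMeasure a b) := by
  have hf : Integrable f (intervalMeasure a b) := (Lp.memLp f).integrable (by norm_num)
  obtain ⟨C, hC⟩ := hc.exists_bound_of_continuous hψ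
  exact hf.bdd_smul (φ := ψ) C hψ.aestronglyMeasurable (Eventually.of_forall hC)

/-- The Sobolev space `H¹((a, b), E)` as a subspace of `L² × L²` with the norm
`(‖f‖² + ‖f'‖²)^{1/2}`: the pairs `(f, f')` such that `f'` is the weak derivative of `f`. -/
def H1Submodule (a b : ℝ) (E : Type*) [NormedAddCommGroup E] [NormedSpace ℝ E] :
    Submodule ℝ (WithLp 2 (Lp E 2 (intervalMeasure a b) × Lp E 2 (intervalMeasure a b))) where
  carrier := {p | HasWeakDeriv a b p.fst p.snd}
  zero_mem' := by
    intro φ _ _ _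
    have h0 : ((0 : Lp E 2 (intervalMeasure a b)) : ℝ → E) =ᵐ[intervalMeasure a b] 0 :=
      Lp.coeFn_zero _ _ _
    rw [WithLp.zero_fst, WithLp.zero_snd,
      integral_eq_zero_of_ae (by filter_upwards [h0] with ω h; rw [h]; simp),
      integral_eq_zero_of_ae (by filter_upwards [h0] with ω h; rw [h]; simp), neg_zero]
  add_mem' := by
    intro p q hp hq φ h1 h2 h3
    have hd : Continuous (deriv φ) := h1.continuous_deriv (by simp)
    rw [WithLp.add_fst, WithLp.add_snd,
      integral_congr_ae (g := fun ω => deriv φ ω • p.fst ω + deriv φ ω • q.fst ω)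
        (by filter_upwards [Lp.coeFn_add p.fst q.fst] with ω h; rw [h, Pi.add_apply, smul_add]),
      integral_congr_ae (f := fun ω => φ ω • (p.snd + q.snd) ω)
        (g := fun ω => φ ω • p.snd ω + φ ω • q.snd ω)
        (by filter_upwards [Lp.coeFn_add p.snd q.snd] with ω h; rw [h, Pi.add_apply, smul_add]),
      integral_add (integrable_smul_Lp hd h2.deriv _) (integrable_smul_Lp hd h2.deriv _),
      integral_add (integrable_smul_Lp h1.continuous h2 _)
        (integrable_smul_Lp h1.continuous h2 _),
      hp φ h1 h2 h3, hq φ h1 h2 h3, neg_add]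
  smul_mem' := by
    intro c p hp φ h1 h2 h3
    rw [WithLp.smul_fst, WithLp.smul_snd,
      integral_congr_ae (g := fun ω => c • (deriv φ ω • p.fst ω))
        (by filter_upwards [Lp.coeFn_smul c p.fst] with ω h; simp [h, smul_comm c]),
      integral_congr_ae (f := fun ω => φ ω • (c • p.snd) ω)
        (g := fun ω => c • (φ ω • p.snd ω))
        (by filter_upwards [Lp.coeFn_smul c p.snd] with ω h; simp [h, smul_comm c]),
      integral_smul, integral_smul, hp φ h1 h2 h3, smul_neg]

/-- The normed space `H¹((a, b), E)`. -/
abbrev H1 (a b : ℝ) (E : Type*) [NormedAddCommGroup E] [NormedSpace ℝ E] : Type _ :=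
  ↥(H1Submodule a b E)

/-- The function on `(a, b)`, defined up to almost everywhere equality, underlying an element
of `H¹((a, b), E)`. -/
def profile {a b : ℝ} {E : Type*} [NormedAddCommGroup E] [NormedSpace ℝ E] (f : H1 a b E) :
    ℝ → E :=
  ((f : WithLp 2 (Lp E 2 (intervalMeasure a b) × Lp E 2 (intervalMeasure a b))).fst :)

open Classical in
/-- The weak derivative in `L²((a, b), E)` of a function of class `H¹` (it is unique up to
almost everywhere equality); `0` for functions that are not of class `H¹`. -/
def weakDeriv {E : Type*} [NormedAddCommGroup E] [NormedSpace ℝ E] (a b : ℝ) (f : ℝ → E) :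
    ℝ → E :=
  if h : ∃ g : ℝ → E, MemLp g 2 (intervalMeasure a b) ∧ HasWeakDeriv a b f g then
    Classical.choose h else 0

/-! ### Vectors and matrices -/

/-- `ℝ³` with its Euclidean norm. -/
abbrev E3 : Type := EuclideanSpace ℝ (Fin 3)

/-- `3 × 3` matrices as operators on `ℝ³`, with the operator norm. -/
abbrev M3 : Type := E3 →L[ℝ] E3

/-- The operator on `ℝ³` given by a matrix. -/
def ofMatrix (A : Matrix (Fin 3) (Fin 3) ℝ) : M3 := Matrix.toEuclideanCLM (𝕜 := ℝ) A

/-- The canonical basis; the indices `0, 1, 2` stand for `e₁, e₂, e₃`. -/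
def e (i : Fin 3) : E3 := EuclideanSpace.single i 1

/-- The wedge (cross) product on `ℝ³`. -/
def wedge (x y : E3) : E3 := WithLp.toLp 2 (crossProduct x.ofLp y.ofLp)

/-- Rotation of angle `α` around the axis `ℝ e₁`. -/
def rotE1 (α : ℝ) : M3 :=
  ofMatrix !![1, 0, 0; 0, Real.cos α, -Real.sin α; 0, Real.sin α, Real.cos α]

/-- The matrix `S`, i.e. the operator `x ↦ -e₃ ∧ x`. -/
def S : M3 := ofMatrix !![0, 1, 0; -1, 0, 0; 0, 0, 0]

/-! ### The impulse-train transformation -/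

/-- The sign `ε(t) = (-1)^{⌊t/T⌋}`. -/
def eps (T t : ℝ) : ℝ := (-1 : ℝ) ^ ⌊t / T⌋

/-- `P(t) = diag(1, ε(t), ε(t))`. -/
def P (T t : ℝ) : M3 := ofMatrix (Matrix.diagonal ![1, eps T t, eps T t])

/-- `σ(t) = ∫₀ᵗ ε(s) ds`. -/
def sigma (T t : ℝ) : ℝ := ∫ s in (0 : ℝ)..t, eps T s

/-! ### Target profile and Lyapunov feedback -/

/-- `f` takes its values in the unit sphere. -/
def SphereValued {a b : ℝ} (f : H1 a b E3) : Prop :=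
  ∀ᵐ ω ∂(intervalMeasure a b), ‖profile f ω‖ = 1

/-- `⟨f(ω), e₃⟩ ≠ 0` for all `ω` in the closed interval `[a, b]`, where `f` is evaluated through
its continuous representative on `[a, b]`. -/
def AvoidsEquator {a b : ℝ} (f : H1 a b E3) : Prop :=
  ∀ m : ℝ → E3, ContinuousOn m (Set.Icc a b) → profile f =ᵐ[intervalMeasure a b] m →
    ∀ ω ∈ Set.Icc a b, inner ℝ (m ω) (e 2) ≠ 0

/-- `R ∈ H¹((a, b), SO₃(ℝ))` with `R(ω) M_f(ω) = -e₃`. -/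
def IsFrame {a b : ℝ} (Mf : H1 a b E3) (R : H1 a b M3) : Prop :=
  (∀ᵐ ω ∂(intervalMeasure a b),
      ∃ A ∈ Matrix.specialOrthogonalGroup (Fin 3) ℝ, profile R ω = ofMatrix A) ∧
    ∀ᵐ ω ∂(intervalMeasure a b), profile R ω (profile Mf ω) = - e 2

/-- `F(t, ω) = R(ω) exp(σ(t) ω S)`. -/
def F {a b : ℝ} (T : ℝ) (R : H1 a b M3) (t ω : ℝ) : M3 :=
  profile R ω * NormedSpace.exp ((sigma T t * ω) • S)

/-- `H_i[t, N] = ∫ ⟨N', (∂F/∂ω e_i) ∧ N⟩ + ⟨e₃, (F e_i) ∧ N⟩ dω`. -/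
def H {a b : ℝ} (T : ℝ) (R : H1 a b M3) (i : Fin 3) (t : ℝ) (N : ℝ → E3) : ℝ :=
  ∫ ω, (inner ℝ (weakDeriv a b N ω) (wedge (weakDeriv a b (F T R t) ω (e i)) (N ω)) +
      inner ℝ (e 2) (wedge (F T R t ω (e i)) (N ω))) ∂(intervalMeasure a b)

/-- The transformed state `N = R(ω) exp(σ(t) ω S) P(t) M(ω)` of the state `M` at time `t`. -/
def transformed {a b : ℝ} (T : ℝ) (R : H1 a b M3) (t : ℝ) (M : H1 a b E3) (ω : ℝ) : E3 :=
  F T R t ω (P T t (profile M ω))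

/-- The feedback `u_i = -H_i[t, N]` as a function of time and of the original state `M`. -/
def feedback {a b : ℝ} (T : ℝ) (R : H1 a b M3) (i : Fin 3) (t : ℝ) (M : H1 a b E3) : ℝ :=
  - H T R i t (transformed T R t M)

/-! ### The Bloch equation -/

/-- `M : [0, ∞) → H¹((a, b), ℝ³)` solves `∂M/∂t = (ũ₁ e₁ + ũ₂ e₂ + ω e₃) ∧ M`, `M(0) = M₀`, with
the controls `ũ₁ = v₁ + ∑_{k ≥ 1} π δ(t - kT)` and `ũ₂ = v₂`: `M` is a classical solution between
the times `kT`, and at each `kT`, `k ≥ 1`, it has one-sided limits, the right one being the image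
of the left one by the rotation of angle `π` around `ℝ e₁`. The values of `M` at the times `kT`,
`k ≥ 1`, and at negative times are irrelevant. -/
structure IsImpulsiveBlochSolution {a b : ℝ} (T : ℝ) (v₁ v₂ : ℝ → ℝ) (M₀ : H1 a b E3)
    (M : ℝ → H1 a b E3) : Prop where
  initial : M 0 = M₀
  initial_right : Tendsto M (𝓝[>] 0) (𝓝 M₀)
  flow : ∀ t : ℝ, 0 < t → (∀ k : ℕ, t ≠ k * T) →
    ∃ D : H1 a b E3, HasDerivAt M D t ∧
      ∀ᵐ ω ∂(intervalMeasure a b),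
        profile D ω = wedge (v₁ t • e 0 + v₂ t • e 1 + ω • e 2) (profile (M t) ω)
  jump : ∀ k : ℕ, 1 ≤ k → ∃ Mminus Mplus : H1 a b E3,
    Tendsto M (𝓝[<] (k * T)) (𝓝 Mminus) ∧ Tendsto M (𝓝[>] (k * T)) (𝓝 Mplus) ∧
      ∀ᵐ ω ∂(intervalMeasure a b), profile Mplus ω = rotE1 Real.pi (profile Mminus ω)

/-- `M` solves the closed-loop Bloch system, with the controls
`ũ₁ = u₁ + ∑_{k ≥ 1} π δ(t - kT)` and `ũ₂ = ε(t) u₂`, where `u₁, u₂` are the feedback laws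
evaluated along `M`. -/
def IsClosedLoopSolution {a b : ℝ} (T : ℝ) (R : H1 a b M3) (M₀ : H1 a b E3)
    (M : ℝ → H1 a b E3) : Prop :=
  IsImpulsiveBlochSolution T (fun t => feedback T R 0 t (M t))
    (fun t => eps T t * feedback T R 1 t (M t)) M₀ M

end

end BlochEnsemble

open BlochEnsemble

/-!
The transformation `N(t, ω) = R(ω) exp(σ(t) ω S) P(t) M(t, ω)` absorbs both the impulses and the
drift. The jump of `P(t)` at `kT` is the rotation of angle `π` around `e₁`, and
`P(t) S P(t) = ε(t) S` with `ε = σ'`. Hence `N` has no jumps, and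
`∂N/∂t = u₁ (F e₁) ∧ N + u₂ (F e₂) ∧ N` (`SpinModel.hasDerivAt_toRot`,
`SpinModel.hasDerivAt_ofRot`). These facts are purely algebraic and are proved for a `SpinModel`,
over any Hilbert space; `isClosedLoopSolution_iff` identifies the closed-loop Bloch equation with
the equation of such a model on `H¹((a, b), ℝ³)`.

Since `⟨N, f ∧ N⟩ = 0` and `⟨N', f ∧ N'⟩ = 0` pointwise, the feedback functional `H_i[t, N]` is the
`H¹` inner product `⟨N + e₃, (F e_i) ∧ N⟩` (`inner_sub_south_wedge`, `H_eq`). The closed loop is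
therefore the damped equation `N' = -∑ ⟨N - p, W_i(t) N⟩ W_i(t) N` in a Hilbert space, with
`p = -e₃` and bounded, Lipschitz, periodic operators `W_i(t)`. Along its solutions `‖N - p‖`
decreases, which gives global existence (`exists_global_solution`) and uniqueness
(`IsSolutionOn.unique`); Barbalat's lemma shows that the outputs `⟨N - p, W_i N⟩` tend to `0`
(`tendsto_output_period`).

The convergence is LaSalle's principle for the weak topology (`tendsto_weak_south`). Let `n` be the
weak limit of `N(2kT)` along an ultrafilter. Bounded weak convergence in `H¹` is uniform
convergence, so that `|n| = 1` and `n` is uniformly close to `-e₃`; moreover the outputs, although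
quadratic, pass to the limit (`tendsto_inner_sub_wedgeH`), because the quadratic form `⟨d, f ∧ d⟩`
contains `d'` only once. So the functional `ℓ(v) = ⟨n + e₃, (R v) ∧ n⟩` vanishes on
`exp(s ω S) e_i` for `0 < s < T` and `i = 1, 2`. Differentiating in `s` and using the density of
polynomials in `H¹` (`eq_zero_of_coordPow`), `ℓ` vanishes on all fields `φ₁ e₁ + φ₂ e₂`. As
`⟨n, R e₃⟩` does not vanish, which is where the target has to avoid the equator, `n ∧ e₃` is of the
form `R v + φ n` with such a field `v`, whence `⟨n + e₃, (n ∧ e₃) ∧ n⟩ = 0`. This number equals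
`∫ (1 - ζ²) - ζ |n'|²` with `ζ = ⟨e₃, n⟩ < 0`, so that `n = -e₃` (`eq_south_of_inner_eq_zero`).

A frame `R` is obtained by composing a half-turn, around the direction of `M_f - e₃` or
`M_f + e₃`, with a constant diagonal rotation (`exists_isFrame`).
-/

namespace BlochEnsemble

noncomputable section

set_option linter.unusedSectionVars false

/-! ### Primitives of square-integrable functions -/

section Primitive

variable {E E₁ E₂ : Type*} [NormedAddCommGroup E] [NormedSpace ℝ E] [CompleteSpace E]
  [NormedAddCommGroup E₁] [NormedSpace ℝ E₁] [CompleteSpace E₁]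
  [NormedAddCommGroup E₂] [NormedSpace ℝ E₂] [CompleteSpace E₂] {a b : ℝ}

/-- On `[a, b]`, the function `u` is the primitive, up to a constant, of the square-integrable
function `g`. These are the continuous representatives of the functions of class `H¹`. -/
structure IsAC2 (a b : ℝ) (u g : ℝ → E) : Prop where
  memLp : MemLp g 2 (intervalMeasure a b)
  eq_add : ∀ x ∈ Set.Icc a b, u x = u a + ∫ y in a..x, g y

theorem intervalIntegrable_of_memLp (hab : a ≤ b) {g : ℝ → E}
    (hg : MemLp g 2 (intervalMeasure a b)) : IntervalIntegrable g volume a b :=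
  (intervalIntegrable_iff_integrableOn_Ioo_of_le hab).2 (hg.integrable (by norm_num))

theorem intervalIntegrable_subinterval {g : ℝ → E} (hg : IntervalIntegrable g volume a b)
    {x y : ℝ} (hx : x ∈ Set.Icc a b) (hy : y ∈ Set.Icc a b) :
    IntervalIntegrable g volume x y := by
  have hab : a ≤ b := hx.1.trans hx.2
  refine hg.mono_set ?_
  rw [Set.uIcc_of_le hab]
  exact Set.uIcc_subset_Icc hx hy

theorem absolutelyContinuousOnInterval_of_dist_le {u : ℝ → E} {v : ℝ → E₁}
    (hv : AbsolutelyContinuousOnInterval v a b)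
    (h : ∀ x ∈ Set.uIcc a b, ∀ y ∈ Set.uIcc a b, dist (u x) (u y) ≤ dist (v x) (v y)) :
    AbsolutelyContinuousOnInterval u a b := by
  unfold AbsolutelyContinuousOnInterval at hv ⊢
  apply squeeze_zero' ?_ ?_ hv
  · exact Eventually.of_forall fun _ => Finset.sum_nonneg fun i hi => dist_nonneg
  rw [eventually_inf_principal]
  filter_upwards with I hI
  exact Finset.sum_le_sum fun i hi => h _ (hI.1 i hi).1 _ (hI.1 i hi).2

/-- A function whose increments are dominated by the integral of a fixed function is the
primitive of its almost everywhere derivative. -/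
theorem IsAC2.of_dominated (hab : a ≤ b) {u g : ℝ → E} {k : ℝ → ℝ}
    (hk : IntervalIntegrable k volume a b)
    (hinc : ∀ x ∈ Set.Icc a b, ∀ y ∈ Set.Icc a b, x ≤ y → ‖u y - u x‖ ≤ ∫ z in x..y, k z)
    (hd : ∀ᵐ x, x ∈ Set.Ioo a b → HasDerivAt u (g x) x)
    (hg : MemLp g 2 (intervalMeasure a b)) : IsAC2 a b u g := by
  refine ⟨hg, fun x hx => ?_⟩
  have hgi := intervalIntegrable_of_memLp hab hg
  have hsum : IntervalIntegrable (fun z => k z + ‖g z‖) volume a b := hk.add hgi.norm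
  have key : ∀ x ∈ Set.Icc a b, ∀ y ∈ Set.Icc a b, x ≤ y →
      dist (u x - ∫ z in a..x, g z) (u y - ∫ z in a..y, g z) ≤
        dist (∫ z in a..x, (k z + ‖g z‖)) (∫ z in a..y, (k z + ‖g z‖)) := by
    intro x hx y hy hxy
    have ha : a ∈ Set.Icc a b := ⟨le_rfl, hab⟩
    have e1 := intervalIntegral.integral_interval_sub_left
      (intervalIntegrable_subinterval hgi ha hy) (intervalIntegrable_subinterval hgi ha hx)
    have e2 := intervalIntegral.integral_interval_sub_left
      (intervalIntegrable_subinterval hsum ha hy) (intervalIntegrable_subinterval hsum ha hx)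
    rw [dist_comm, dist_comm (∫ z in a..x, _), dist_eq_norm, dist_eq_norm, e2]
    have e3 : (u y - ∫ z in a..y, g z) - (u x - ∫ z in a..x, g z) =
      (u y - u x) - ∫ z in x..y, g z := by rw [← e1]; abel
    rw [e3, intervalIntegral.integral_add (intervalIntegrable_subinterval hk hx hy)
      (intervalIntegrable_subinterval hgi hx hy).norm]
    calc ‖(u y - u x) - ∫ z in x..y, g z‖ ≤ ‖u y - u x‖ + ‖∫ z in x..y, g z‖ := norm_sub_le _ _
      _ ≤ (∫ z in x..y, k z) + ∫ z in x..y, ‖g z‖ :=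
        add_le_add (hinc x hx y hy hxy) (intervalIntegral.norm_integral_le_integral_norm hxy)
      _ ≤ _ := le_abs_self _
  have hac : AbsolutelyContinuousOnInterval (fun x => u x - ∫ z in a..x, g z) a b := by
    refine absolutelyContinuousOnInterval_of_dist_le
      (hsum.absolutelyContinuousOnInterval_intervalIntegral (c := a) Set.left_mem_uIcc) ?_
    rw [Set.uIcc_of_le hab]
    intro x hx y hy
    rcases le_total x y with h | h
    · exact key x hx y hy h
    · rw [dist_comm, dist_comm (∫ z in a..x, _)]
      exact key y hy x hx h
  obtain ⟨C, hC⟩ : ∃ C, ∀ x ∈ Set.uIcc a b, u x - ∫ z in a..x, g z = C := by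
    refine hac.const_of_ae_hasDerivAt_zero ?_
    filter_upwards [hd, hgi.ae_hasDerivAt_integral,
      Measure.ae_ne volume a, Measure.ae_ne volume b] with x h1 h2 h3 h4 h5
    have h6 := h5
    rw [Set.uIcc_of_le hab] at h6
    have := (h1 ⟨lt_of_le_of_ne h6.1 h3.symm, lt_of_le_of_ne h6.2 h4⟩).sub
      (h2 h5 a Set.left_mem_uIcc)
    rw [sub_self] at this
    exact this
  rw [Set.uIcc_of_le hab] at hC
  have h1 := hC x hx
  have h2 := hC a ⟨le_rfl, hab⟩
  rw [intervalIntegral.integral_same, sub_zero] at h2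
  rw [h2, ← h1]; abel

namespace IsAC2

theorem intervalIntegrable (hab : a ≤ b) {u g : ℝ → E} (h : IsAC2 a b u g) :
    IntervalIntegrable g volume a b := intervalIntegrable_of_memLp hab h.memLp

theorem sub_eq {u g : ℝ → E} (h : IsAC2 a b u g) {x y : ℝ} (hx : x ∈ Set.Icc a b)
    (hy : y ∈ Set.Icc a b) : u y - u x = ∫ z in x..y, g z := by
  have hab : a ≤ b := hx.1.trans hx.2
  have ha : a ∈ Set.Icc a b := ⟨le_rfl, hab⟩
  have hgi := h.intervalIntegrable hab
  rw [h.eq_add x hx, h.eq_add y hy, ← intervalIntegral.integral_interval_sub_left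
      (intervalIntegrable_subinterval hgi ha hy) (intervalIntegrable_subinterval hgi ha hx)]
  abel

theorem norm_sub_le {u g : ℝ → E} (h : IsAC2 a b u g) {x y : ℝ} (hx : x ∈ Set.Icc a b)
    (hy : y ∈ Set.Icc a b) (hxy : x ≤ y) : ‖u y - u x‖ ≤ ∫ z in x..y, ‖g z‖ := by
  rw [h.sub_eq hx hy]
  exact intervalIntegral.norm_integral_le_integral_norm hxy

theorem continuousOn {u g : ℝ → E} (h : IsAC2 a b u g) : ContinuousOn u (Set.Icc a b) := by
  rcases lt_or_ge b a with hba | hab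
  · rw [Set.Icc_eq_empty (not_le.2 hba)]; exact continuousOn_empty u
  have h1 : ContinuousOn (fun x => u a + ∫ y in a..x, g y) (Set.Icc a b) := by
    have := intervalIntegral.continuousOn_primitive_interval'
      (h.intervalIntegrable hab) (Set.left_mem_uIcc)
    rw [Set.uIcc_of_le hab] at this
    exact continuousOn_const.add this
  exact h1.congr h.eq_add

theorem ae_hasDerivAt {u g : ℝ → E} (h : IsAC2 a b u g) :
    ∀ᵐ x, x ∈ Set.Ioo a b → HasDerivAt u (g x) x := by
  rcases lt_or_ge b a with hba | hab
  · rw [Set.Ioo_eq_empty (not_lt.2 hba.le)]; simp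
  filter_upwards [(h.intervalIntegrable hab).ae_hasDerivAt_integral] with x hx hxI
  have h1 := (hx (by rw [Set.uIcc_of_le hab]; exact Set.Ioo_subset_Icc_self hxI) a
    Set.left_mem_uIcc).const_add (u a)
  refine h1.congr_of_eventuallyEq ?_
  filter_upwards [Ioo_mem_nhds hxI.1 hxI.2] with y hy
  exact h.eq_add y (Set.Ioo_subset_Icc_self hy)

theorem exists_bound {u g : ℝ → E} (h : IsAC2 a b u g) :
    ∃ C, 0 ≤ C ∧ ∀ x ∈ Set.Icc a b, ‖u x‖ ≤ C := by
  obtain ⟨C, hC⟩ := isCompact_Icc.exists_bound_of_continuousOn h.continuousOn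
  exact ⟨max C 0, le_max_right _ _, fun x hx => (hC x hx).trans (le_max_left _ _)⟩

theorem aestronglyMeasurable {u g : ℝ → E} (h : IsAC2 a b u g) :
    AEStronglyMeasurable u (intervalMeasure a b) :=
  (h.continuousOn.mono Set.Ioo_subset_Icc_self).aestronglyMeasurable measurableSet_Ioo

theorem memLp_self {u g : ℝ → E} (h : IsAC2 a b u g) : MemLp u 2 (intervalMeasure a b) := by
  obtain ⟨C, -, hC⟩ := h.exists_bound
  refine MemLp.of_bound h.aestronglyMeasurable C ?_
  exact (ae_restrict_mem measurableSet_Ioo).mono fun x hx => hC x (Set.Ioo_subset_Icc_self hx)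

theorem of_integral {g : ℝ → E} (c : E) (hg : MemLp g 2 (intervalMeasure a b)) :
    IsAC2 a b (fun x => c + ∫ y in a..x, g y) g :=
  ⟨hg, fun x _ => by simp⟩

theorem of_hasDerivAt {u g : ℝ → E} (hu : ∀ x, HasDerivAt u (g x) x)
    (hg : Continuous g) : IsAC2 a b u g := by
  refine ⟨?_, fun x _ => ?_⟩
  · obtain ⟨C, hC⟩ := (isCompact_Icc (a := a) (b := b)).exists_bound_of_continuousOn
      hg.continuousOn
    exact MemLp.of_bound hg.aestronglyMeasurable C
      ((ae_restrict_mem measurableSet_Ioo).mono fun x hx => hC x (Set.Ioo_subset_Icc_self hx))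
  · rw [intervalIntegral.integral_eq_sub_of_hasDerivAt (fun y _ => hu y)
      (hg.intervalIntegrable _ _)]
    abel

theorem const (c : E) : IsAC2 a b (fun _ => c) (fun _ => 0) :=
  of_hasDerivAt (fun x => hasDerivAt_const x c) continuous_const

theorem clm {u g : ℝ → E} (hu : IsAC2 a b u g)
    (L : E →L[ℝ] E₁) : IsAC2 a b (fun x => L (u x)) (fun x => L (g x)) := by
  refine ⟨L.comp_memLp' hu.memLp, fun x hx => ?_⟩
  have hab : a ≤ b := hx.1.trans hx.2
  have ha : a ∈ Set.Icc a b := ⟨le_rfl, hab⟩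
  rw [L.intervalIntegral_comp_comm
    (intervalIntegrable_subinterval (hu.intervalIntegrable hab) ha hx), hu.eq_add x hx, map_add]

theorem bilin (hab : a ≤ b)
    (B : E →L[ℝ] E₁ →L[ℝ] E₂) {u g : ℝ → E} {v h : ℝ → E₁} (hu : IsAC2 a b u g)
    (hv : IsAC2 a b v h) :
    IsAC2 a b (fun x => B (u x) (v x)) (fun x => B (g x) (v x) + B (u x) (h x)) := by
  obtain ⟨C, hC0, hC⟩ := hu.exists_bound
  obtain ⟨D, hD0, hD⟩ := hv.exists_bound
  have hgi := hu.intervalIntegrable hab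
  have hhi := hv.intervalIntegrable hab
  refine IsAC2.of_dominated hab (k := fun z => ‖B‖ * D * ‖g z‖ + ‖B‖ * C * ‖h z‖)
    ((hgi.norm.const_mul _).add (hhi.norm.const_mul _)) ?_ ?_ ?_
  · intro x hx y hy hxy
    have e1 : B (u y) (v y) - B (u x) (v x) = B (u y - u x) (v y) + B (u x) (v y - v x) := by
      simp
    rw [e1, intervalIntegral.integral_add
      ((intervalIntegrable_subinterval hgi hx hy).norm.const_mul _)
      ((intervalIntegrable_subinterval hhi hx hy).norm.const_mul _),
      intervalIntegral.integral_const_mul, intervalIntegral.integral_const_mul]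
    have h1 := hu.norm_sub_le hx hy hxy
    have h2 := hv.norm_sub_le hx hy hxy
    calc _ ≤ ‖B (u y - u x) (v y)‖ + ‖B (u x) (v y - v x)‖ := norm_add_le _ _
      _ ≤ ‖B‖ * ‖u y - u x‖ * ‖v y‖ + ‖B‖ * ‖u x‖ * ‖v y - v x‖ :=
        add_le_add (B.le_opNorm₂ _ _) (B.le_opNorm₂ _ _)
      _ ≤ ‖B‖ * (∫ z in x..y, ‖g z‖) * D + ‖B‖ * C * ∫ z in x..y, ‖h z‖ := by
        have h3 := hD y hy
        have h4 := hC x hx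
        gcongr
        exact mul_nonneg B.opNorm_nonneg ((norm_nonneg _).trans h1)
      _ = _ := by ring
  · filter_upwards [hu.ae_hasDerivAt, hv.ae_hasDerivAt] with x h1 h2 hx
    have h3 := (B.hasFDerivAt.comp_hasDerivAt x (h1 hx)).clm_apply (h2 hx)
    exact h3
  · refine MemLp.add ?_ ?_
    · refine hu.memLp.of_le_mul (c := ‖B‖ * D) ?_ ?_
      · exact B.aestronglyMeasurable_comp₂ hu.memLp.1 hv.aestronglyMeasurable
      · refine (ae_restrict_mem measurableSet_Ioo).mono fun x hx => ?_
        refine (B.le_opNorm₂ _ _).trans ?_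
        have := hD x (Set.Ioo_subset_Icc_self hx)
        calc ‖B‖ * ‖g x‖ * ‖v x‖ ≤ ‖B‖ * ‖g x‖ * D := by gcongr
          _ = _ := by ring
    · refine hv.memLp.of_le_mul (c := ‖B‖ * C) ?_ ?_
      · exact B.aestronglyMeasurable_comp₂ hu.aestronglyMeasurable hv.memLp.1
      · refine (ae_restrict_mem measurableSet_Ioo).mono fun x hx => ?_
        refine (B.le_opNorm₂ _ _).trans ?_
        have := hC x (Set.Ioo_subset_Icc_self hx)
        gcongr

theorem inv (hab : a ≤ b) {u g : ℝ → ℝ} (hu : IsAC2 a b u g) {m : ℝ} (hm : 0 < m)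
    (hmu : ∀ x ∈ Set.Icc a b, m ≤ |u x|) :
    IsAC2 a b (fun x => (u x)⁻¹) (fun x => - g x / u x ^ 2) := by
  have hgi := hu.intervalIntegrable hab
  have hne : ∀ x ∈ Set.Icc a b, u x ≠ 0 := fun x hx h0 => by
    have := hmu x hx
    rw [h0, abs_zero] at this
    linarith
  refine IsAC2.of_dominated hab (k := fun z => (m⁻¹ * m⁻¹) * ‖g z‖)
    (hgi.norm.const_mul _) ?_ ?_ ?_
  · intro x hx y hy hxy
    have e1 : (u y)⁻¹ - (u x)⁻¹ = - ((u x)⁻¹ * (u y)⁻¹ * (u y - u x)) := by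
      have := hne x hx
      have := hne y hy
      field_simp
      ring
    rw [e1, norm_neg, norm_mul, norm_mul, intervalIntegral.integral_const_mul, norm_inv, norm_inv]
    have h1 := hu.norm_sub_le hx hy hxy
    have h2 := hmu x hx
    have h3 := hmu y hy
    rw [← Real.norm_eq_abs] at h2 h3
    gcongr
  · filter_upwards [hu.ae_hasDerivAt] with x h1 hx
    exact (h1 hx).fun_inv (hne x (Set.Ioo_subset_Icc_self hx))
  · refine hu.memLp.of_le_mul (c := m⁻¹ * m⁻¹) ?_ ?_
    · have := (hu.memLp.1.neg.aemeasurable.div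
        (hu.aestronglyMeasurable.aemeasurable.pow_const 2)).aestronglyMeasurable
      exact this
    · refine (ae_restrict_mem measurableSet_Ioo).mono fun x hx => ?_
      have h2 := hmu x (Set.Ioo_subset_Icc_self hx)
      rw [← Real.norm_eq_abs] at h2
      rw [norm_div, norm_neg, norm_pow, div_eq_inv_mul, pow_two, mul_inv]
      gcongr

end IsAC2

end Primitive

/-! ### Weak derivatives and primitives -/

section WeakDerivative

variable {E : Type*} [NormedAddCommGroup E] [NormedSpace ℝ E] [CompleteSpace E] {a b : ℝ}

theorem integral_intervalMeasure (hab : a ≤ b) (f : ℝ → E) :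
    ∫ x, f x ∂(intervalMeasure a b) = ∫ x in a..b, f x := by
  rw [intervalIntegral.integral_of_le hab, integral_Ioc_eq_integral_Ioo]

theorem integrable_smul_memLp {ψ : ℝ → ℝ} (hψ : Continuous ψ) {g : ℝ → E}
    (hg : MemLp g 2 (intervalMeasure a b)) :
    Integrable (fun x => ψ x • g x) (intervalMeasure a b) := by
  obtain ⟨C, hC⟩ := (isCompact_Icc (a := a) (b := b)).exists_bound_of_continuousOn hψ.continuousOn
  refine (hg.integrable (by norm_num)).bdd_smul (φ := ψ) C hψ.aestronglyMeasurable ?_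
  exact (ae_restrict_mem measurableSet_Ioo).mono fun x hx => hC x (Set.Ioo_subset_Icc_self hx)

theorem IsAC2.hasWeakDeriv (hab : a ≤ b) {u g : ℝ → E} (h : IsAC2 a b u g) :
    HasWeakDeriv a b u g := by
  intro φ h1 h2 h3
  have hφ : IsAC2 a b φ (deriv φ) := IsAC2.of_hasDerivAt
    (fun x => (h1.differentiable (by simp) x).hasDerivAt) (h1.continuous_deriv (by simp))
  have hp := hφ.bilin hab (ContinuousLinearMap.lsmul ℝ ℝ) h
  have h0 : ∀ x, x ∉ Set.Ioo a b → φ x = 0 := fun x hx =>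
    image_eq_zero_of_notMem_tsupport fun hx' => hx (h3 hx')
  have e1 := hp.eq_add b ⟨hab, le_rfl⟩
  simp only [ContinuousLinearMap.lsmul_apply] at e1
  rw [h0 a (by simp), h0 b (by simp), zero_smul, zero_smul, zero_add,
    ← integral_intervalMeasure hab, integral_add
      (integrable_smul_memLp (h1.continuous_deriv (by simp)) h.memLp_self)
      (integrable_smul_memLp h1.continuous h.memLp)] at e1
  exact eq_neg_of_add_eq_zero_left e1.symm

/-- A function with vanishing integral against all test functions vanishes. -/
theorem ae_eq_zero_of_integral_test_eq_zero {f : ℝ → E}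
    (hf : Integrable f (intervalMeasure a b))
    (h : ∀ φ : ℝ → ℝ, ContDiff ℝ ((⊤ : ℕ∞) : WithTop ℕ∞) φ → HasCompactSupport φ →
      tsupport φ ⊆ Set.Ioo a b → ∫ x, φ x • f x ∂(intervalMeasure a b) = 0) :
    f =ᵐ[intervalMeasure a b] 0 := by
  have := isOpen_Ioo.ae_eq_zero_of_integral_contDiff_smul_eq_zero (μ := volume)
    (U := Set.Ioo a b) (f := f) (IntegrableOn.locallyIntegrableOn hf) (fun φ h1 h2 h3 => by
      rw [← h φ h1 h2 h3]
      refine (setIntegral_eq_integral_of_forall_compl_eq_zero fun x hx => ?_).symm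
      rw [image_eq_zero_of_notMem_tsupport fun hx' => hx (h3 hx'), zero_smul])
  exact (ae_restrict_iff' measurableSet_Ioo).2 this

theorem HasWeakDeriv.unique {f g₁ g₂ : ℝ → E} (h₁ : HasWeakDeriv a b f g₁)
    (h₂ : HasWeakDeriv a b f g₂) (m₁ : MemLp g₁ 2 (intervalMeasure a b))
    (m₂ : MemLp g₂ 2 (intervalMeasure a b)) : g₁ =ᵐ[intervalMeasure a b] g₂ := by
  have := ae_eq_zero_of_integral_test_eq_zero (f := fun x => g₁ x - g₂ x)
    ((m₁.sub m₂).integrable (by norm_num)) (fun φ h1 h2 h3 => by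
      have e := (h₁ φ h1 h2 h3).symm.trans (h₂ φ h1 h2 h3)
      simp_rw [smul_sub]
      rw [integral_sub (integrable_smul_memLp h1.continuous m₁)
        (integrable_smul_memLp h1.continuous m₂), sub_eq_zero]
      exact neg_injective e)
  filter_upwards [this] with x hx
  exact sub_eq_zero.1 hx

/-- A test function of vanishing integral is the derivative of a test function. -/
theorem exists_test_primitive (hab : a < b) {φ : ℝ → ℝ}
    (h1 : ContDiff ℝ ((⊤ : ℕ∞) : WithTop ℕ∞) φ) (h2 : HasCompactSupport φ)
    (h3 : tsupport φ ⊆ Set.Ioo a b) (h0 : ∫ x in a..b, φ x = 0) :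
    ∃ Φ : ℝ → ℝ, ContDiff ℝ ((⊤ : ℕ∞) : WithTop ℕ∞) Φ ∧ HasCompactSupport Φ ∧
      tsupport Φ ⊆ Set.Ioo a b ∧ deriv Φ = φ := by
  set K := insert ((a + b) / 2) (tsupport φ) with hK
  have hKc : IsCompact K := h2.isCompact.insert _
  have hKne : K.Nonempty := ⟨_, Set.mem_insert _ _⟩
  have hKs : K ⊆ Set.Ioo a b := by
    rw [hK, Set.insert_subset_iff]
    exact ⟨⟨by linarith, by linarith⟩, h3⟩
  obtain ⟨c, hc⟩ := hKc.exists_isLeast hKne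
  obtain ⟨d, hd⟩ := hKc.exists_isGreatest hKne
  have hci := hKs hc.1
  have hdi := hKs hd.1
  have hl : ∀ x, x < c → φ x = 0 := fun x hx =>
    image_eq_zero_of_notMem_tsupport fun hx' => not_le.2 hx (hc.2 (Set.mem_insert_of_mem _ hx'))
  have hr : ∀ x, d < x → φ x = 0 := fun x hx =>
    image_eq_zero_of_notMem_tsupport fun hx' => not_le.2 hx (hd.2 (Set.mem_insert_of_mem _ hx'))
  have hder : ∀ x, HasDerivAt (fun x => ∫ y in a..x, φ y) (φ x) x := fun x =>
    intervalIntegral.integral_hasDerivAt_right (h1.continuous.intervalIntegrable _ _)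
      h1.continuous.aestronglyMeasurable.stronglyMeasurableAtFilter h1.continuous.continuousAt
  have hderiv : deriv (fun x => ∫ y in a..x, φ y) = φ := funext fun x => (hder x).deriv
  have hsupp : Function.support (fun x => ∫ y in a..x, φ y) ⊆ Set.Icc c d := by
    intro x hx
    by_contra hx'
    refine hx ?_
    rw [Set.mem_Icc, not_and_or, not_le, not_le] at hx'
    rcases hx' with hx' | hx'
    · refine (intervalIntegral.integral_congr (g := fun _ => 0) fun y hy => hl y ?_).trans (by simp)
      exact lt_of_le_of_lt hy.2 (max_lt hci.1 hx')
    · have e : ∫ y in b..x, φ y = 0 := by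
        refine (intervalIntegral.integral_congr (g := fun _ => 0) fun y hy => hr y ?_).trans
          (by simp)
        exact lt_of_lt_of_le (lt_min hdi.2 hx') hy.1
      have := intervalIntegral.integral_add_adjacent_intervals
        (h1.continuous.intervalIntegrable (μ := volume) a b)
        (h1.continuous.intervalIntegrable (μ := volume) b x)
      rw [e, h0, add_zero] at this
      exact this.symm
  have hts : tsupport (fun x => ∫ y in a..x, φ y) ⊆ Set.Icc c d :=
    closure_minimal hsupp isClosed_Icc
  refine ⟨_, ?_, ?_, hts.trans fun x hx => ⟨hci.1.trans_le hx.1, hx.2.trans_lt hdi.2⟩, hderiv⟩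
  · rw [contDiff_infty_iff_deriv]
    exact ⟨fun x => (hder x).differentiableAt, by rw [hderiv]; exact h1⟩
  · exact isCompact_Icc.of_isClosed_subset (isClosed_tsupport _) hts

/-- The du Bois-Reymond lemma. -/
theorem ae_eq_const_of_hasWeakDeriv_zero (hab : a < b) {f : ℝ → E}
    (hf : MemLp f 2 (intervalMeasure a b)) (h : HasWeakDeriv a b f (fun _ => 0)) :
    ∃ c : E, f =ᵐ[intervalMeasure a b] fun _ => c := by
  let β : ContDiffBump ((a + b) / 2) := ⟨(b - a) / 8, (b - a) / 4, by linarith, by linarith⟩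
  set ψ := β.normed volume with hψ
  have p1 : ContDiff ℝ ((⊤ : ℕ∞) : WithTop ℕ∞) ψ := β.contDiff_normed
  have p2 : HasCompactSupport ψ := β.hasCompactSupport_normed
  have p3 : tsupport ψ ⊆ Set.Ioo a b := by
    rw [hψ, β.tsupport_normed_eq, Real.closedBall_eq_Icc]
    intro x hx
    have e : β.rOut = (b - a) / 4 := rfl
    rw [e] at hx
    exact ⟨by linarith [hx.1], by linarith [hx.2]⟩
  have p4 : ∫ x in a..b, ψ x = 1 := by
    rw [← integral_intervalMeasure hab.le, ← β.integral_normed (μ := volume)]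
    refine setIntegral_eq_integral_of_forall_compl_eq_zero fun x hx => ?_
    exact image_eq_zero_of_notMem_tsupport fun hx' => hx (p3 hx')
  set c := ∫ x, ψ x • f x ∂(intervalMeasure a b) with hc
  refine ⟨c, ?_⟩
  have hconst : MemLp (fun _ : ℝ => c) 2 (intervalMeasure a b) := memLp_const c
  have := ae_eq_zero_of_integral_test_eq_zero (f := fun x => f x - c)
    ((hf.sub hconst).integrable (by norm_num)) (fun φ h1 h2 h3 => by
      set I := ∫ x in a..b, φ x with hI
      obtain ⟨Φ, q1, q2, q3, q4⟩ := exists_test_primitive hab (φ := fun x => φ x - I * ψ x)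
        (h1.sub (contDiff_const.mul p1)) (h2.sub p2.mul_left)
        ((tsupport_sub _ _).trans (Set.union_subset h3 ((tsupport_mul_subset_right).trans p3)))
        (by
          rw [intervalIntegral.integral_sub (h1.continuous.intervalIntegrable _ _)
            ((show Continuous fun x => I * ψ x from continuous_const.mul p1.continuous).intervalIntegrable
              _ _), intervalIntegral.integral_const_mul, p4]
          simp [hI])
      have e := h Φ q1 q2 q3
      simp_rw [q4, sub_smul, mul_smul, smul_zero, integral_zero, neg_zero] at e
      rw [integral_sub (integrable_smul_memLp h1.continuous hf)
        (show Integrable (fun x => I • ψ x • f x) _ from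
          (integrable_smul_memLp p1.continuous hf).smul I), integral_smul, ← hc] at e
      simp_rw [smul_sub]
      rw [integral_sub (integrable_smul_memLp h1.continuous hf)
        (integrable_smul_memLp h1.continuous hconst), integral_smul_const,
        integral_intervalMeasure hab.le φ, ← hI]
      exact e)
  filter_upwards [this] with x hx
  exact sub_eq_zero.1 hx

/-- A function of class `H¹` has a representative that is the primitive of its weak derivative. -/
theorem HasWeakDeriv.exists_isAC2 (hab : a < b) {f g : ℝ → E}
    (hf : MemLp f 2 (intervalMeasure a b)) (hg : MemLp g 2 (intervalMeasure a b))
    (h : HasWeakDeriv a b f g) :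
    ∃ u : ℝ → E, f =ᵐ[intervalMeasure a b] u ∧ IsAC2 a b u g := by
  have hU := IsAC2.of_integral (a := a) (b := b) 0 hg
  have hw := hU.hasWeakDeriv hab.le
  obtain ⟨c, hc⟩ := ae_eq_const_of_hasWeakDeriv_zero hab (hf.sub hU.memLp_self) (by
    intro φ h1 h2 h3
    have e := (h φ h1 h2 h3).trans (hw φ h1 h2 h3).symm
    simp_rw [Pi.sub_apply, smul_sub]
    rw [integral_sub (integrable_smul_memLp (h1.continuous_deriv (by simp)) hf)
      (integrable_smul_memLp (h1.continuous_deriv (by simp)) hU.memLp_self), e]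
    simp)
  refine ⟨fun x => c + ∫ y in a..x, g y, ?_, IsAC2.of_integral c hg⟩
  filter_upwards [hc] with x hx
  rw [← hx]
  simp

/-- Continuous functions on `[a, b]` that agree almost everywhere agree. -/
theorem eqOn_of_ae_eq {X : Type*} [TopologicalSpace X] [T2Space X] (hab : a < b) {u v : ℝ → X}
    (hu : ContinuousOn u (Set.Icc a b)) (hv : ContinuousOn v (Set.Icc a b))
    (h : u =ᵐ[intervalMeasure a b] v) : ∀ x ∈ Set.Icc a b, u x = v x := by
  have h1 : Set.EqOn u v (Set.Ioo a b) :=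
    Measure.eqOn_open_of_ae_eq (μ := volume) h isOpen_Ioo (hu.mono Set.Ioo_subset_Icc_self)
      (hv.mono Set.Ioo_subset_Icc_self)
  have h2 : closure (Set.Ioo a b) = Set.Icc a b := closure_Ioo hab.ne
  exact h1.of_subset_closure hu hv Set.Ioo_subset_Icc_self h2.ge

theorem weakDeriv_ae_eq {f g : ℝ → E} (hg : MemLp g 2 (intervalMeasure a b))
    (h : HasWeakDeriv a b f g) : weakDeriv a b f =ᵐ[intervalMeasure a b] g := by
  have hex : ∃ g : ℝ → E, MemLp g 2 (intervalMeasure a b) ∧ HasWeakDeriv a b f g := ⟨g, hg, h⟩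
  unfold weakDeriv
  rw [dif_pos hex]
  exact (Classical.choose_spec hex).2.unique h (Classical.choose_spec hex).1 hg

theorem HasWeakDeriv.congr_left {f f' g : ℝ → E} (h : HasWeakDeriv a b f g)
    (hf : f' =ᵐ[intervalMeasure a b] f) : HasWeakDeriv a b f' g := by
  intro φ h1 h2 h3
  rw [← h φ h1 h2 h3]
  exact integral_congr_ae (by filter_upwards [hf] with x hx; rw [hx])

end WeakDerivative

/-! ### Continuous representatives and Sobolev inequalities -/

section Sobolev

variable {E : Type*} [NormedAddCommGroup E] [NormedSpace ℝ E] [CompleteSpace E] {a b : ℝ}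

/-- The Cauchy–Schwarz inequality on a subinterval. -/
theorem integral_norm_le_sqrt_mul {g : ℝ → E} (hg : MemLp g 2 (intervalMeasure a b)) {x y : ℝ}
    (hx : x ∈ Set.Icc a b) (hy : y ∈ Set.Icc a b) (hxy : x ≤ y) :
    ∫ z in x..y, ‖g z‖ ≤ √(y - x) * (eLpNorm g 2 (intervalMeasure a b)).toReal := by
  rw [intervalIntegral.integral_of_le hxy, integral_Ioc_eq_integral_Ioo]
  have hle : volume.restrict (Set.Ioo x y) ≤ intervalMeasure a b :=
    Measure.restrict_mono (Set.Ioo_subset_Ioo hx.1 hy.2) le_rfl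
  have hm : AEStronglyMeasurable g (volume.restrict (Set.Ioo x y)) := hg.1.mono_measure hle
  rw [integral_norm_eq_lintegral_enorm hm, ← eLpNorm_one_eq_lintegral_enorm]
  have h1 := eLpNorm_le_eLpNorm_mul_rpow_measure_univ (p := 1) (q := 2) (by norm_num) hm
  have h2 : eLpNorm g 2 (volume.restrict (Set.Ioo x y)) ≤ eLpNorm g 2 (intervalMeasure a b) :=
    eLpNorm_mono_measure g hle
  have h3 : eLpNorm g 1 (volume.restrict (Set.Ioo x y)) ≤
      eLpNorm g 2 (intervalMeasure a b) * ENNReal.ofReal √(y - x) := by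
    refine h1.trans ?_
    rw [Measure.restrict_apply_univ, Real.volume_Ioo, Real.sqrt_eq_rpow,
      ← ENNReal.ofReal_rpow_of_nonneg (sub_nonneg.2 hxy) (by norm_num)]
    have e : (1 / (1 : ℝ≥0∞).toReal - 1 / (2 : ℝ≥0∞).toReal) = (1 / 2 : ℝ) := by norm_num
    rw [e]
    gcongr
  have h4 := ENNReal.toReal_mono (ENNReal.mul_ne_top hg.2.ne ENNReal.ofReal_ne_top) h3
  rwa [ENNReal.toReal_mul, ENNReal.toReal_ofReal (Real.sqrt_nonneg _), mul_comm] at h4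

/-- The weak derivative of a function of class `H¹`. -/
def der (f : H1 a b E) : ℝ → E :=
  ((f : WithLp 2 (Lp E 2 (intervalMeasure a b) × Lp E 2 (intervalMeasure a b))).snd :)

theorem memLp_profile (f : H1 a b E) : MemLp (profile f) 2 (intervalMeasure a b) := Lp.memLp _

theorem memLp_der (f : H1 a b E) : MemLp (der f) 2 (intervalMeasure a b) := Lp.memLp _

theorem hasWeakDeriv_profile (f : H1 a b E) : HasWeakDeriv a b (profile f) (der f) := f.2

open Classical in
/-- The continuous representative on `[a, b]` of a function of class `H¹`. -/
def rep (f : H1 a b E) : ℝ → E :=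
  if h : ∃ u : ℝ → E, profile f =ᵐ[intervalMeasure a b] u ∧ IsAC2 a b u (der f) then
    Classical.choose h else 0

variable [hab : Fact (a < b)]

theorem rep_spec (f : H1 a b E) :
    profile f =ᵐ[intervalMeasure a b] rep f ∧ IsAC2 a b (rep f) (der f) := by
  have h := (hasWeakDeriv_profile f).exists_isAC2 hab.out (memLp_profile f) (memLp_der f)
  unfold rep
  rw [dif_pos h]
  exact Classical.choose_spec h

theorem profile_ae_eq (f : H1 a b E) : profile f =ᵐ[intervalMeasure a b] rep f := (rep_spec f).1

theorem isAC2_rep (f : H1 a b E) : IsAC2 a b (rep f) (der f) := (rep_spec f).2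

theorem continuousOn_rep (f : H1 a b E) : ContinuousOn (rep f) (Set.Icc a b) :=
  (isAC2_rep f).continuousOn

theorem rep_eq_of_ae_eq {f : H1 a b E} {u : ℝ → E} (hu : ContinuousOn u (Set.Icc a b))
    (h : profile f =ᵐ[intervalMeasure a b] u) : ∀ x ∈ Set.Icc a b, rep f x = u x :=
  eqOn_of_ae_eq hab.out (continuousOn_rep f) hu ((profile_ae_eq f).symm.trans h)

theorem ae_of_forall_Icc {p : ℝ → Prop} (h : ∀ x ∈ Set.Icc a b, p x) :
    ∀ᵐ x ∂(intervalMeasure a b), p x :=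
  (ae_restrict_mem measurableSet_Ioo).mono fun x hx => h x (Set.Ioo_subset_Icc_self hx)

theorem H1_ext_profile {f g : H1 a b E} (h : profile f =ᵐ[intervalMeasure a b] profile g) :
    f = g := by
  have h1 : der f =ᵐ[intervalMeasure a b] der g :=
    (hasWeakDeriv_profile f).unique ((hasWeakDeriv_profile g).congr_left h)
      (memLp_der f) (memLp_der g)
  apply Subtype.ext
  apply (WithLp.equiv 2 _).injective
  exact Prod.ext (Lp.ext h) (Lp.ext h1)

theorem H1_ext {f g : H1 a b E} (h : ∀ x ∈ Set.Icc a b, rep f x = rep g x) : f = g :=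
  have h1 : rep f =ᵐ[intervalMeasure a b] rep g := ae_of_forall_Icc h
  H1_ext_profile ((profile_ae_eq f).trans (h1.trans (profile_ae_eq g).symm))

namespace IsAC2

/-- The element of `H¹` represented by a primitive of a square-integrable function. -/
def toH1 {u g : ℝ → E} (h : IsAC2 a b u g) : H1 a b E :=
  ⟨WithLp.toLp 2 (h.memLp_self.toLp u, h.memLp.toLp g), by
    intro φ h1 h2 h3
    have e := h.hasWeakDeriv hab.out.le φ h1 h2 h3
    change ∫ ω, deriv φ ω • (h.memLp_self.toLp u) ω ∂(intervalMeasure a b) =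
      - ∫ ω, φ ω • (h.memLp.toLp g) ω ∂(intervalMeasure a b)
    rw [integral_congr_ae (g := fun ω => deriv φ ω • u ω)
        (by filter_upwards [h.memLp_self.coeFn_toLp] with x hx; rw [hx]),
      integral_congr_ae (f := fun ω => φ ω • (h.memLp.toLp g) ω) (g := fun ω => φ ω • g ω)
        (by filter_upwards [h.memLp.coeFn_toLp] with x hx; rw [hx])]
    exact e⟩

theorem profile_toH1 {u g : ℝ → E} (h : IsAC2 a b u g) :
    profile h.toH1 =ᵐ[intervalMeasure a b] u := h.memLp_self.coeFn_toLp

theorem der_toH1 {u g : ℝ → E} (h : IsAC2 a b u g) :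
    der h.toH1 =ᵐ[intervalMeasure a b] g := h.memLp.coeFn_toLp

theorem rep_toH1 {u g : ℝ → E} (h : IsAC2 a b u g) : ∀ x ∈ Set.Icc a b, rep h.toH1 x = u x :=
  rep_eq_of_ae_eq h.continuousOn h.profile_toH1

end IsAC2

theorem profile_add (f g : H1 a b E) :
    profile (f + g) =ᵐ[intervalMeasure a b] fun x => profile f x + profile g x :=
  Lp.coeFn_add _ _

theorem profile_smul (c : ℝ) (f : H1 a b E) :
    profile (c • f) =ᵐ[intervalMeasure a b] fun x => c • profile f x :=
  Lp.coeFn_smul _ _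

theorem der_sub (f g : H1 a b E) :
    der (f - g) =ᵐ[intervalMeasure a b] fun x => der f x - der g x :=
  Lp.coeFn_sub _ _

theorem rep_add (f g : H1 a b E) : ∀ x ∈ Set.Icc a b, rep (f + g) x = rep f x + rep g x := by
  refine rep_eq_of_ae_eq ((continuousOn_rep f).add (continuousOn_rep g)) ?_
  filter_upwards [profile_add f g, profile_ae_eq f, profile_ae_eq g] with x h1 h2 h3
  rw [h1, h2, h3]

theorem rep_smul (c : ℝ) (f : H1 a b E) :
    ∀ x ∈ Set.Icc a b, rep (c • f) x = c • rep f x := by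
  refine rep_eq_of_ae_eq ((continuousOn_rep f).const_smul c) ?_
  filter_upwards [profile_smul c f, profile_ae_eq f] with x h1 h2
  rw [h1, h2]

theorem norm_sq_eq (f : H1 a b E) : ‖f‖ ^ 2 =
    (eLpNorm (profile f) 2 (intervalMeasure a b)).toReal ^ 2 +
      (eLpNorm (der f) 2 (intervalMeasure a b)).toReal ^ 2 := by
  have h := WithLp.prod_norm_sq_eq_of_L2
    (f : WithLp 2 (Lp E 2 (intervalMeasure a b) × Lp E 2 (intervalMeasure a b)))
  rw [Lp.norm_def, Lp.norm_def] at h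
  exact h

theorem eLpNorm_profile_le (f : H1 a b E) :
    (eLpNorm (profile f) 2 (intervalMeasure a b)).toReal ≤ ‖f‖ := by
  refine abs_le_of_sq_le_sq' ?_ (norm_nonneg _) |>.2
  rw [norm_sq_eq]
  nlinarith [sq_nonneg (eLpNorm (der f) 2 (intervalMeasure a b)).toReal]

theorem eLpNorm_der_le (f : H1 a b E) :
    (eLpNorm (der f) 2 (intervalMeasure a b)).toReal ≤ ‖f‖ := by
  refine abs_le_of_sq_le_sq' ?_ (norm_nonneg _) |>.2
  rw [norm_sq_eq]
  nlinarith [sq_nonneg (eLpNorm (profile f) 2 (intervalMeasure a b)).toReal]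

theorem norm_le_add (f : H1 a b E) : ‖f‖ ≤
    (eLpNorm (profile f) 2 (intervalMeasure a b)).toReal +
      (eLpNorm (der f) 2 (intervalMeasure a b)).toReal := by
  refine abs_le_of_sq_le_sq' ?_ (by positivity) |>.2
  rw [norm_sq_eq]
  nlinarith [mul_nonneg (ENNReal.toReal_nonneg (a := eLpNorm (profile f) 2 (intervalMeasure a b)))
    (ENNReal.toReal_nonneg (a := eLpNorm (der f) 2 (intervalMeasure a b)))]

/-- The functions in a bounded subset of `H¹` are Hölder continuous of exponent `1/2`. -/
theorem norm_rep_sub_le (f : H1 a b E) {x y : ℝ} (hx : x ∈ Set.Icc a b) (hy : y ∈ Set.Icc a b) :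
    ‖rep f x - rep f y‖ ≤ √|x - y| * ‖f‖ := by
  wlog hxy : x ≤ y generalizing x y
  · rw [norm_sub_rev, abs_sub_comm]
    exact this hy hx (le_of_not_ge hxy)
  rw [norm_sub_rev, abs_sub_comm, abs_of_nonneg (sub_nonneg.2 hxy)]
  calc _ ≤ ∫ z in x..y, ‖der f z‖ := (isAC2_rep f).norm_sub_le hx hy hxy
    _ ≤ _ := integral_norm_le_sqrt_mul (memLp_der f) hx hy hxy
    _ ≤ _ := by gcongr; exact eLpNorm_der_le f

/-- A constant in the Sobolev embedding `H¹((a, b)) ⊆ L^∞`. -/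
def sobolevConst (a b : ℝ) : ℝ := √(b - a) + √(b - a) / (b - a)

theorem sobolevConst_pos : 0 < sobolevConst a b := by
  have := sub_pos.2 hab.out
  unfold sobolevConst
  positivity

theorem norm_rep_le (f : H1 a b E) {x : ℝ} (hx : x ∈ Set.Icc a b) :
    ‖rep f x‖ ≤ sobolevConst a b * ‖f‖ := by
  have hpos := sub_pos.2 hab.out
  have hle := hab.out.le
  have hi : IntervalIntegrable (fun y => ‖rep f y‖) volume a b :=
    (intervalIntegrable_of_memLp hle (isAC2_rep f).memLp_self).norm
  have h1 : ∫ y in a..b, (‖rep f x‖ - √(b - a) * ‖f‖) ≤ ∫ y in a..b, ‖rep f y‖ := by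
    refine intervalIntegral.integral_mono_on hle (by simp) hi fun y hy => ?_
    have h2 := norm_rep_sub_le f hx hy
    have h3 : √|x - y| ≤ √(b - a) :=
      Real.sqrt_le_sqrt (abs_sub_le_iff.2 ⟨by linarith [hx.2, hy.1], by linarith [hx.1, hy.2]⟩)
    have h4 := norm_le_norm_sub_add (rep f x) (rep f y)
    nlinarith [norm_nonneg f]
  have h5 := integral_norm_le_sqrt_mul (isAC2_rep f).memLp_self
    (Set.left_mem_Icc.2 hle) (Set.right_mem_Icc.2 hle) hle
  rw [eLpNorm_congr_ae (profile_ae_eq f).symm] at h5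
  have h6 := eLpNorm_profile_le f
  rw [intervalIntegral.integral_const, smul_eq_mul] at h1
  have h7 : (b - a) * (‖rep f x‖ - √(b - a) * ‖f‖) ≤ √(b - a) * ‖f‖ :=
    h1.trans (h5.trans (by gcongr))
  have h8 : ‖rep f x‖ - √(b - a) * ‖f‖ ≤ √(b - a) * ‖f‖ / (b - a) := by
    rw [le_div_iff₀ hpos]; linarith
  unfold sobolevConst
  calc ‖rep f x‖ ≤ √(b - a) * ‖f‖ + √(b - a) * ‖f‖ / (b - a) := by linarith
    _ = _ := by ring

/-- Evaluation at a point of `[a, b]`. -/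
def evalL (x : Set.Icc a b) : H1 a b E →L[ℝ] E :=
  LinearMap.mkContinuous
    { toFun := fun f => rep f x
      map_add' := fun f g => rep_add f g x x.2
      map_smul' := fun c f => rep_smul c f x x.2 }
    (sobolevConst a b) fun f => norm_rep_le f x.2

@[simp]
theorem rep_sub (f g : H1 a b E) {x : ℝ} (hx : x ∈ Set.Icc a b) :
    rep (f - g) x = rep f x - rep g x := map_sub (evalL ⟨x, hx⟩) f g

theorem rep_sum {ι : Type*} (s : Finset ι) (f : ι → H1 a b E) {x : ℝ} (hx : x ∈ Set.Icc a b) :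
    rep (∑ i ∈ s, f i) x = ∑ i ∈ s, rep (f i) x := map_sum (evalL ⟨x, hx⟩) f s

theorem rep_neg (f : H1 a b E) {x : ℝ} (hx : x ∈ Set.Icc a b) :
    rep (-f) x = - rep f x := map_neg (evalL ⟨x, hx⟩) f

instance completeSpace_H1 : CompleteSpace (H1 a b E) := by
  have hcl : IsClosed (H1Submodule a b E : Set (WithLp 2 (Lp E 2 (intervalMeasure a b) ×
      Lp E 2 (intervalMeasure a b)))) := by
    have htest : ∀ ψ : ℝ → ℝ, Continuous ψ → HasCompactSupport ψ →
        Continuous fun f : Lp E 2 (intervalMeasure a b) =>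
          ∫ x, ψ x • f x ∂(intervalMeasure a b) := by
      intro ψ hψ hc
      obtain ⟨C, hC⟩ := hc.exists_bound_of_continuous hψ
      have hadd : ∀ f g : Lp E 2 (intervalMeasure a b),
          ∫ x, ψ x • (f + g) x ∂(intervalMeasure a b) =
            ∫ x, ψ x • f x ∂(intervalMeasure a b) + ∫ x, ψ x • g x ∂(intervalMeasure a b) := by
        intro f g
        rw [← integral_add (integrable_smul_Lp hψ hc f) (integrable_smul_Lp hψ hc g)]
        refine integral_congr_ae ?_
        filter_upwards [Lp.coeFn_add f g] with x hx
        rw [hx, Pi.add_apply, smul_add]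
      have hsmul : ∀ (c : ℝ) (f : Lp E 2 (intervalMeasure a b)),
          ∫ x, ψ x • (c • f) x ∂(intervalMeasure a b) =
            c • ∫ x, ψ x • f x ∂(intervalMeasure a b) := by
        intro c f
        rw [← integral_smul]
        refine integral_congr_ae ?_
        filter_upwards [Lp.coeFn_smul c f] with x hx
        rw [hx, Pi.smul_apply, smul_comm]
      refine (LinearMap.mkContinuous (σ := RingHom.id ℝ)
        { toFun := fun f : Lp E 2 (intervalMeasure a b) =>
            ∫ x, ψ x • f x ∂(intervalMeasure a b)
          map_add' := hadd
          map_smul' := hsmul } (C * √(b - a)) fun f => ?_).continuous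
      have hle := hab.out.le
      have hfm := Lp.memLp f
      have h1 := integral_norm_le_sqrt_mul hfm
        (Set.left_mem_Icc.2 hle) (Set.right_mem_Icc.2 hle) hle
      have hC0 : 0 ≤ C := (norm_nonneg _).trans (hC 0)
      calc ‖∫ x, ψ x • f x ∂(intervalMeasure a b)‖
          ≤ ∫ x, ‖ψ x • f x‖ ∂(intervalMeasure a b) := norm_integral_le_integral_norm _
        _ ≤ ∫ x, C * ‖f x‖ ∂(intervalMeasure a b) := by
          refine integral_mono (integrable_smul_Lp hψ hc f).norm
            ((hfm.integrable (by norm_num)).norm.const_mul C) fun x => ?_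
          rw [norm_smul]
          exact mul_le_mul_of_nonneg_right (hC x) (norm_nonneg _)
        _ = C * ∫ x in a..b, ‖f x‖ := by
          rw [integral_const_mul, integral_intervalMeasure hle]
        _ ≤ C * (√(b - a) * ‖f‖) := by
          rw [Lp.norm_def]
          gcongr
        _ = _ := by ring
    have hset : (H1Submodule a b E : Set (WithLp 2 (Lp E 2 (intervalMeasure a b) ×
      Lp E 2 (intervalMeasure a b)))) = ⋂ φ : ℝ → ℝ, ⋂ (_ : ContDiff ℝ ((⊤ : ℕ∞) : WithTop ℕ∞) φ),
        ⋂ (_ : HasCompactSupport φ), ⋂ (_ : tsupport φ ⊆ Set.Ioo a b),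
        {p | ∫ x, deriv φ x • p.fst x ∂(intervalMeasure a b) =
          - ∫ x, φ x • p.snd x ∂(intervalMeasure a b)} := by
      ext p
      simp only [Set.mem_iInter]
      exact Iff.rfl
    rw [hset]
    refine isClosed_iInter fun φ => isClosed_iInter fun h1 => isClosed_iInter fun h2 =>
      isClosed_iInter fun h3 => isClosed_eq ?_ ?_
    · exact (htest _ (h1.continuous_deriv (by simp)) h2.deriv).comp
        (WithLp.continuous_fst 2 _ _)
    · exact ((htest _ h1.continuous h2).comp (WithLp.continuous_snd 2 _ _)).neg
  exact hcl.completeSpace_coe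

end Sobolev

section Inner

variable {E : Type*} [NormedAddCommGroup E] [InnerProductSpace ℝ E] [CompleteSpace E] {a b : ℝ}
  [hab : Fact (a < b)]

theorem inner_H1_eq (f g : H1 a b E) : inner ℝ f g =
    ∫ x, (inner ℝ (rep f x) (rep g x) + inner ℝ (der f x) (der g x)) ∂(intervalMeasure a b) := by
  have h := WithLp.prod_inner_apply (𝕜 := ℝ)
    (f : WithLp 2 (Lp E 2 (intervalMeasure a b) × Lp E 2 (intervalMeasure a b)))
    (g : WithLp 2 (Lp E 2 (intervalMeasure a b) × Lp E 2 (intervalMeasure a b)))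
  rw [L2.inner_def, L2.inner_def, ← integral_add (L2.integrable_inner _ _)
    (L2.integrable_inner _ _)] at h
  refine h.trans (integral_congr_ae ?_)
  filter_upwards [profile_ae_eq f, profile_ae_eq g] with x h1 h2
  rw [← h1, ← h2]
  rfl

end Inner

/-! ### Algebraic operations on `H¹` -/

section Operations

variable {E E₁ E₂ : Type*} [NormedAddCommGroup E] [NormedSpace ℝ E] [CompleteSpace E]
  [NormedAddCommGroup E₁] [NormedSpace ℝ E₁] [CompleteSpace E₁]
  [NormedAddCommGroup E₂] [NormedSpace ℝ E₂] [CompleteSpace E₂] {a b : ℝ} [hab : Fact (a < b)]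

theorem toReal_eLpNorm_le_mul {f : ℝ → E} {g : ℝ → E₁} (hg : MemLp g 2 (intervalMeasure a b))
    {c : ℝ} (hc : 0 ≤ c) (h : ∀ᵐ x ∂(intervalMeasure a b), ‖f x‖ ≤ c * ‖g x‖) :
    (eLpNorm f 2 (intervalMeasure a b)).toReal ≤
      c * (eLpNorm g 2 (intervalMeasure a b)).toReal := by
  have h1 := eLpNorm_le_mul_eLpNorm_of_ae_le_mul h 2
  have h2 := ENNReal.toReal_mono (ENNReal.mul_ne_top ENNReal.ofReal_ne_top hg.2.ne) h1
  rwa [ENNReal.toReal_mul, ENNReal.toReal_ofReal hc] at h2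

/-- The product of two functions of class `H¹`, with respect to a continuous bilinear map on the
target spaces. -/
def bilin (B : E →L[ℝ] E₁ →L[ℝ] E₂) : H1 a b E →L[ℝ] H1 a b E₁ →L[ℝ] H1 a b E₂ :=
  LinearMap.mkContinuous₂
    (LinearMap.mk₂ ℝ (fun f g => ((isAC2_rep f).bilin hab.out.le B (isAC2_rep g)).toH1)
      (fun f f' g => H1_ext fun x hx => by
        rw [rep_add _ _ x hx, IsAC2.rep_toH1 _ x hx, IsAC2.rep_toH1 _ x hx, IsAC2.rep_toH1 _ x hx,
          rep_add _ _ x hx, map_add, add_apply])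
      (fun c f g => H1_ext fun x hx => by
        rw [rep_smul _ _ x hx, IsAC2.rep_toH1 _ x hx, IsAC2.rep_toH1 _ x hx,
          rep_smul _ _ x hx, map_smul, smul_apply])
      (fun f g g' => H1_ext fun x hx => by
        rw [rep_add _ _ x hx, IsAC2.rep_toH1 _ x hx, IsAC2.rep_toH1 _ x hx, IsAC2.rep_toH1 _ x hx,
          rep_add _ _ x hx, map_add])
      (fun c f g => H1_ext fun x hx => by
        rw [rep_smul _ _ x hx, IsAC2.rep_toH1 _ x hx, IsAC2.rep_toH1 _ x hx,
          rep_smul _ _ x hx, map_smul]))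
    (3 * sobolevConst a b * ‖B‖) (by
      intro f g
      set k := sobolevConst a b with hk
      have hk0 : 0 < k := sobolevConst_pos
      set h := (isAC2_rep f).bilin hab.out.le B (isAC2_rep g) with hh
      change ‖h.toH1‖ ≤ _
      have hB : 0 ≤ ‖B‖ := B.opNorm_nonneg
      have b1 : ∀ᵐ x ∂(intervalMeasure a b),
          ‖profile h.toH1 x‖ ≤ (‖B‖ * (k * ‖f‖)) * ‖profile g x‖ := by
        filter_upwards [h.profile_toH1, profile_ae_eq g, ae_restrict_mem measurableSet_Ioo]
          with x h1 h2 hx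
        have := norm_rep_le f (Set.Ioo_subset_Icc_self hx)
        rw [h1, h2]
        refine (B.le_opNorm₂ _ _).trans ?_
        gcongr
      have b2 : eLpNorm (der h.toH1) 2 (intervalMeasure a b) ≤
          eLpNorm (fun x => B (der f x) (rep g x)) 2 (intervalMeasure a b) +
          eLpNorm (fun x => B (rep f x) (der g x)) 2 (intervalMeasure a b) := by
        rw [eLpNorm_congr_ae h.der_toH1]
        exact eLpNorm_add_le
          (B.aestronglyMeasurable_comp₂ (memLp_der f).1 (isAC2_rep g).aestronglyMeasurable)
          (B.aestronglyMeasurable_comp₂ (isAC2_rep f).aestronglyMeasurable (memLp_der g).1)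
          (by norm_num)
      have b3 : ∀ᵐ x ∂(intervalMeasure a b),
          ‖B (der f x) (rep g x)‖ ≤ (‖B‖ * (k * ‖g‖)) * ‖der f x‖ := by
        filter_upwards [ae_restrict_mem measurableSet_Ioo] with x hx
        have := norm_rep_le g (Set.Ioo_subset_Icc_self hx)
        refine (B.le_opNorm₂ _ _).trans ?_
        calc ‖B‖ * ‖der f x‖ * ‖rep g x‖ ≤ ‖B‖ * ‖der f x‖ * (k * ‖g‖) := by gcongr
          _ = _ := by ring
      have b4 : ∀ᵐ x ∂(intervalMeasure a b),
          ‖B (rep f x) (der g x)‖ ≤ (‖B‖ * (k * ‖f‖)) * ‖der g x‖ := by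
        filter_upwards [ae_restrict_mem measurableSet_Ioo] with x hx
        have := norm_rep_le f (Set.Ioo_subset_Icc_self hx)
        refine (B.le_opNorm₂ _ _).trans ?_
        gcongr
      have c1 := toReal_eLpNorm_le_mul (memLp_profile g) (by positivity) b1
      have c3 := toReal_eLpNorm_le_mul (memLp_der f) (by positivity) b3
      have c4 := toReal_eLpNorm_le_mul (memLp_der g) (by positivity) b4
      have f3 : eLpNorm (fun x => B (der f x) (rep g x)) 2 (intervalMeasure a b) ≠ ∞ :=
        ((memLp_der f).of_le_mul (B.aestronglyMeasurable_comp₂ (memLp_der f).1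
          (isAC2_rep g).aestronglyMeasurable) b3).2.ne
      have f4 : eLpNorm (fun x => B (rep f x) (der g x)) 2 (intervalMeasure a b) ≠ ∞ :=
        ((memLp_der g).of_le_mul (B.aestronglyMeasurable_comp₂
          (isAC2_rep f).aestronglyMeasurable (memLp_der g).1) b4).2.ne
      have c2 := ENNReal.toReal_mono (ENNReal.add_ne_top.2 ⟨f3, f4⟩) b2
      rw [ENNReal.toReal_add f3 f4] at c2
      have d1 := eLpNorm_profile_le g
      have d2 := eLpNorm_der_le g
      have d3 := eLpNorm_der_le f
      calc ‖h.toH1‖ ≤ _ := norm_le_add _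
        _ ≤ (‖B‖ * (k * ‖f‖)) * ‖g‖ + ((‖B‖ * (k * ‖g‖)) * ‖f‖ + (‖B‖ * (k * ‖f‖)) * ‖g‖) := by
          refine add_le_add (c1.trans (by gcongr)) (c2.trans (add_le_add (c3.trans (by gcongr))
            (c4.trans (by gcongr))))
        _ = _ := by ring)

theorem rep_bilin (B : E →L[ℝ] E₁ →L[ℝ] E₂) (f : H1 a b E) (g : H1 a b E₁) {x : ℝ}
    (hx : x ∈ Set.Icc a b) : rep (bilin B f g) x = B (rep f x) (rep g x) :=
  ((isAC2_rep f).bilin hab.out.le B (isAC2_rep g)).rep_toH1 x hx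

theorem der_bilin (B : E →L[ℝ] E₁ →L[ℝ] E₂) (f : H1 a b E) (g : H1 a b E₁) :
    der (bilin B f g) =ᵐ[intervalMeasure a b]
      fun x => B (der f x) (rep g x) + B (rep f x) (der g x) :=
  ((isAC2_rep f).bilin hab.out.le B (isAC2_rep g)).der_toH1

theorem norm_bilin_le (B : E →L[ℝ] E₁ →L[ℝ] E₂) (f : H1 a b E) (g : H1 a b E₁) :
    ‖bilin B f g‖ ≤ 3 * sobolevConst a b * ‖B‖ * ‖f‖ * ‖g‖ := by
  have hB : 0 ≤ 3 * sobolevConst a b * ‖B‖ :=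
    mul_nonneg (mul_nonneg (by norm_num) sobolevConst_pos.le) B.opNorm_nonneg
  refine ((bilin B).le_opNorm₂ f g).trans ?_
  gcongr
  exact LinearMap.mkContinuous₂_norm_le _ hB _

/-- Composition of a function of class `H¹` with a continuous linear map. -/
def compL (L : E →L[ℝ] E₁) : H1 a b E →L[ℝ] H1 a b E₁ :=
  LinearMap.mkContinuous
    { toFun := fun f => ((isAC2_rep f).clm L).toH1
      map_add' := fun f g => H1_ext fun x hx => by
        rw [rep_add _ _ x hx, IsAC2.rep_toH1 _ x hx, IsAC2.rep_toH1 _ x hx, IsAC2.rep_toH1 _ x hx,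
          rep_add _ _ x hx, map_add]
      map_smul' := fun c f => H1_ext fun x hx => by
        rw [RingHom.id_apply, rep_smul _ _ x hx, IsAC2.rep_toH1 _ x hx, IsAC2.rep_toH1 _ x hx,
          rep_smul _ _ x hx, map_smul] }
    (2 * ‖L‖) (by
      intro f
      change ‖((isAC2_rep f).clm L).toH1‖ ≤ _
      set h := (isAC2_rep f).clm L
      have c1 := toReal_eLpNorm_le_mul (f := profile h.toH1) (memLp_profile f) L.opNorm_nonneg (by
        filter_upwards [h.profile_toH1, profile_ae_eq f] with x h1 h2
        rw [h1, h2]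
        exact L.le_opNorm _)
      have c2 := toReal_eLpNorm_le_mul (f := der h.toH1) (memLp_der f) L.opNorm_nonneg (by
        filter_upwards [h.der_toH1] with x h1
        rw [h1]
        exact L.le_opNorm _)
      have d1 := eLpNorm_profile_le f
      have d2 := eLpNorm_der_le f
      have hL : 0 ≤ ‖L‖ := L.opNorm_nonneg
      calc ‖h.toH1‖ ≤ _ := norm_le_add _
        _ ≤ ‖L‖ * ‖f‖ + ‖L‖ * ‖f‖ :=
          add_le_add (c1.trans (by gcongr)) (c2.trans (by gcongr))
        _ = _ := by ring)

theorem rep_compL (L : E →L[ℝ] E₁) (f : H1 a b E) {x : ℝ} (hx : x ∈ Set.Icc a b) :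
    rep (compL L f) x = L (rep f x) :=
  ((isAC2_rep f).clm L).rep_toH1 x hx

theorem der_compL (L : E →L[ℝ] E₁) (f : H1 a b E) :
    der (compL L f) =ᵐ[intervalMeasure a b] fun x => L (der f x) :=
  ((isAC2_rep f).clm L).der_toH1

/-- A constant function as an element of `H¹`. -/
def constH (c : E) : H1 a b E := (IsAC2.const c).toH1

theorem rep_constH (c : E) {x : ℝ} (hx : x ∈ Set.Icc a b) : rep (constH c : H1 a b E) x = c :=
  IsAC2.rep_toH1 _ x hx

theorem der_constH (c : E) : der (constH c : H1 a b E) =ᵐ[intervalMeasure a b] fun _ => 0 :=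
  IsAC2.der_toH1 _

/-- Powers of the coordinate, as elements of `H¹`. -/
def coordPow (n : ℕ) : H1 a b ℝ :=
  (IsAC2.of_hasDerivAt (a := a) (b := b) (u := fun x => x ^ n)
    (fun x => hasDerivAt_pow n x) (by fun_prop)).toH1

theorem rep_coordPow (n : ℕ) {x : ℝ} (hx : x ∈ Set.Icc a b) :
    rep (coordPow n : H1 a b ℝ) x = x ^ n :=
  IsAC2.rep_toH1 _ x hx

/-- The multiplicative inverse of a real function of class `H¹` that does not vanish. -/
theorem exists_inv (f : H1 a b ℝ) (hf : ∀ x ∈ Set.Icc a b, rep f x ≠ 0) :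
    ∃ g : H1 a b ℝ, ∀ x ∈ Set.Icc a b, rep g x = (rep f x)⁻¹ := by
  obtain ⟨x₀, hx₀, hmin⟩ := isCompact_Icc.exists_isMinOn
    (Set.nonempty_Icc.2 hab.out.le) (continuousOn_rep f).abs
  have h := (isAC2_rep f).inv hab.out.le (abs_pos.2 (hf x₀ hx₀)) (fun x hx => hmin hx)
  exact ⟨h.toH1, h.rep_toH1⟩

theorem der_ae_eq_of_rep_eq {f : H1 a b E} {u g : ℝ → E} (h : IsAC2 a b u g)
    (hu : ∀ x ∈ Set.Icc a b, rep f x = u x) : der f =ᵐ[intervalMeasure a b] g := by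
  have : f = h.toH1 := H1_ext fun x hx => by rw [hu x hx, h.rep_toH1 x hx]
  rw [this]
  exact h.der_toH1

/-- Polynomial functions, as elements of `H¹`. -/
def polyH (Q : Polynomial ℝ) : H1 a b ℝ := ∑ n ∈ Q.support, Q.coeff n • coordPow n

theorem rep_polyH (Q : Polynomial ℝ) {x : ℝ} (hx : x ∈ Set.Icc a b) :
    rep (polyH Q : H1 a b ℝ) x = Q.eval x := by
  rw [polyH, rep_sum _ _ hx, Polynomial.eval_eq_sum, Polynomial.sum]
  exact Finset.sum_congr rfl fun n _ => by
    rw [rep_smul _ _ x hx, rep_coordPow n hx, smul_eq_mul]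

theorem exists_polynomial_derivative_eq (q : Polynomial ℝ) :
    ∃ Q : Polynomial ℝ, Polynomial.derivative Q = q := by
  induction q using Polynomial.induction_on' with
  | add p q hp hq =>
    obtain ⟨P, rfl⟩ := hp
    obtain ⟨Q, rfl⟩ := hq
    exact ⟨P + Q, Polynomial.derivative_add⟩
  | monomial n c =>
    refine ⟨Polynomial.monomial (n + 1) (c / (n + 1)), ?_⟩
    rw [Polynomial.derivative_monomial]
    congr 1
    have : (n : ℝ) + 1 ≠ 0 := by positivity
    push_cast
    field_simp

theorem exists_poly_eLpNorm_sub_le {g : ℝ → ℝ} (hg : MemLp g 2 (intervalMeasure a b)) {ε : ℝ}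
    (hε : 0 < ε) : ∃ q : Polynomial ℝ,
      (eLpNorm (fun x => g x - q.eval x) 2 (intervalMeasure a b)).toReal ≤ ε := by
  set K := (eLpNorm (fun _ : ℝ => (1 : ℝ)) 2 (intervalMeasure a b)).toReal with hK
  have h1m : MemLp (fun _ : ℝ => (1 : ℝ)) 2 (intervalMeasure a b) := memLp_const 1
  have hK0 : 0 ≤ K := ENNReal.toReal_nonneg
  obtain ⟨φ, hφ, h1, h2⟩ : ∃ φ : ℝ → ℝ, Continuous φ ∧
      eLpNorm (g - φ) 2 (intervalMeasure a b) ≤ ENNReal.ofReal (ε / 2) ∧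
      MemLp φ 2 (intervalMeasure a b) := by
    obtain ⟨φ, h1, h2⟩ := hg.exists_boundedContinuous_eLpNorm_sub_le (by norm_num)
      (ε := ENNReal.ofReal (ε / 2)) (by simpa using hε)
    exact ⟨φ, φ.continuous, h1, h2⟩
  obtain ⟨q, hq⟩ := exists_polynomial_near_of_continuousOn a b φ hφ.continuousOn
    (ε / 2 / (K + 1)) (by positivity)
  refine ⟨q, ?_⟩
  have hqc : AEStronglyMeasurable (fun x => q.eval x) (intervalMeasure a b) :=
    q.continuous.aestronglyMeasurable
  have e1 : (fun x => g x - q.eval x) = (g - φ) + fun x => φ x - q.eval x := by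
    ext x; simp
  have h3 := toReal_eLpNorm_le_mul (a := a) (b := b) (f := fun x => φ x - q.eval x) h1m
    (c := ε / 2 / (K + 1)) (by positivity) (ae_of_forall_Icc fun x hx => by
      rw [norm_one, mul_one, Real.norm_eq_abs, abs_sub_comm]
      exact (hq x hx).le)
  have h4 : (eLpNorm (g - φ) 2 (intervalMeasure a b)).toReal ≤ ε / 2 :=
    ENNReal.toReal_le_of_le_ofReal (by positivity) h1
  have h5 : ε / 2 / (K + 1) * K ≤ ε / 2 := by
    rw [div_mul_eq_mul_div, div_le_iff₀ (by positivity)]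
    nlinarith
  have hqm : MemLp (fun x => φ x - q.eval x) 2 (intervalMeasure a b) :=
    h1m.of_le_mul (c := ε / 2 / (K + 1)) (h2.1.sub hqc) (ae_of_forall_Icc fun x hx => by
      rw [norm_one, mul_one, Real.norm_eq_abs, abs_sub_comm]
      exact (hq x hx).le)
  have h6 := ENNReal.toReal_mono (ENNReal.add_ne_top.2 ⟨(hg.sub h2).2.ne, hqm.2.ne⟩)
    (eLpNorm_add_le (hg.sub h2).1 hqm.1 (by norm_num : (1 : ℝ≥0∞) ≤ 2))
  rw [ENNReal.toReal_add (hg.sub h2).2.ne hqm.2.ne] at h6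
  rw [e1]
  linarith

/-- Polynomials are dense in `H¹`: integrate a polynomial that approximates the derivative in
`L²`. -/
theorem eq_zero_of_coordPow (ℓ : H1 a b ℝ →L[ℝ] ℝ) (h : ∀ n : ℕ, ℓ (coordPow n) = 0) : ℓ = 0 := by
  have hpoly : ∀ Q : Polynomial ℝ, ℓ (polyH Q) = 0 := fun Q => by
    rw [polyH, map_sum]
    exact Finset.sum_eq_zero fun n _ => by rw [map_smul, h, smul_zero]
  have hle := hab.out.le
  have ha : a ∈ Set.Icc a b := Set.left_mem_Icc.2 hle
  set K := (eLpNorm (fun _ : ℝ => (1 : ℝ)) 2 (intervalMeasure a b)).toReal with hK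
  have h1m : MemLp (fun _ : ℝ => (1 : ℝ)) 2 (intervalMeasure a b) := memLp_const 1
  have hK0 : 0 ≤ K := ENNReal.toReal_nonneg
  ext f
  change ℓ f = 0
  set M := ‖ℓ‖ * (√(b - a) * K + 1) with hM
  have hM0 : 0 ≤ M := by positivity
  have key : ∀ ε > 0, |ℓ f| ≤ M * ε := by
    intro ε hε
    obtain ⟨q, hq⟩ := exists_poly_eLpNorm_sub_le (memLp_der f) hε
    obtain ⟨Q, hQ⟩ := exists_polynomial_derivative_eq q
    set Q' := Q + Polynomial.C (rep f a - Q.eval a) with hQ'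
    have hQd : Polynomial.derivative Q' = q := by simp [hQ', hQ]
    set g := f - polyH Q' with hg
    have hdp : der (polyH Q' : H1 a b ℝ) =ᵐ[intervalMeasure a b] fun x => q.eval x := by
      refine der_ae_eq_of_rep_eq (u := fun x => Q'.eval x)
        (IsAC2.of_hasDerivAt (fun x => ?_) q.continuous) (fun x hx => rep_polyH Q' hx)
      rw [← hQd]
      exact Q'.hasDerivAt x
    have hgd : (eLpNorm (der g) 2 (intervalMeasure a b)).toReal ≤ ε := by
      refine le_trans (le_of_eq ?_) hq
      congr 1
      refine eLpNorm_congr_ae ?_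
      filter_upwards [der_sub f (polyH Q'), hdp] with x h1 h2
      rw [hg, h1, h2]
    have hga : rep g a = 0 := by
      rw [hg, rep_sub _ _ ha, rep_polyH _ ha, hQ']
      simp
    have hgx : ∀ x ∈ Set.Icc a b, ‖rep g x‖ ≤ √(b - a) * ε := by
      intro x hx
      have h1 := (isAC2_rep g).norm_sub_le ha hx hx.1
      rw [hga, sub_zero] at h1
      refine h1.trans ((integral_norm_le_sqrt_mul (memLp_der g) ha hx hx.1).trans ?_)
      have : √(x - a) ≤ √(b - a) := Real.sqrt_le_sqrt (by linarith [hx.2])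
      gcongr
    have hgp := toReal_eLpNorm_le_mul (f := profile g) h1m (c := √(b - a) * ε) (by positivity) (by
      have h2 := ae_of_forall_Icc (a := a) (b := b) hgx
      filter_upwards [profile_ae_eq g, h2] with x h1 h2
      rw [h1, norm_one, mul_one]
      exact h2)
    have hgn := norm_le_add g
    have e : ℓ f = ℓ g := by rw [hg, map_sub, hpoly, sub_zero]
    rw [e, ← Real.norm_eq_abs]
    calc ‖ℓ g‖ ≤ ‖ℓ‖ * ‖g‖ := ℓ.le_opNorm g
      _ ≤ ‖ℓ‖ * (√(b - a) * ε * K + ε) := by gcongr; linarith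
      _ = M * ε := by rw [hM]; ring
  refine abs_eq_zero.1 (le_antisymm (le_of_forall_pos_le_add fun ε hε => ?_) (abs_nonneg _))
  have := key (ε / (M + 1)) (by positivity)
  refine this.trans ?_
  rw [zero_add, mul_div_assoc', div_le_iff₀ (by positivity)]
  nlinarith

end Operations

/-! ### A damped flow in a Hilbert space -/

section Flow

variable {V ι : Type*} [NormedAddCommGroup V] [InnerProductSpace ℝ V] [CompleteSpace V] [Fintype ι]

/-- The output `⟨N - p, W_i(t) N⟩`. -/
def output (p : V) (W : ι → ℝ → V →L[ℝ] V) (i : ι) (t : ℝ) (N : V) : ℝ :=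
  inner ℝ (N - p) (W i t N)

/-- The vector field `-∑ ⟨N - p, W_i(t) N⟩ W_i(t) N`, along which the distance to `p` decreases. -/
def dampedField (p : V) (W : ι → ℝ → V →L[ℝ] V) (t : ℝ) (N : V) : V :=
  - ∑ i, output p W i t N • W i t N

/-- `N` is a solution on `[0, τ]` of the differential equation `N' = f(t, N)`. -/
structure IsSolutionOn (f : ℝ → V → V) (τ : ℝ) (N : ℝ → V) : Prop where
  continuousOn : ContinuousOn N (Set.Icc 0 τ)
  hasDerivAt : ∀ t ∈ Set.Ioo 0 τ, HasDerivAt N (f t (N t)) t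

theorem IsSolutionOn.mono {f : ℝ → V → V} {τ τ' : ℝ} {N : ℝ → V} (h : IsSolutionOn f τ N)
    (hτ : τ' ≤ τ) : IsSolutionOn f τ' N :=
  ⟨h.continuousOn.mono (Set.Icc_subset_Icc_right hτ),
    fun t ht => h.hasDerivAt t ⟨ht.1, ht.2.trans_le hτ⟩⟩

variable {p : V} {W : ι → ℝ → V →L[ℝ] V}

theorem inner_dampedField (t : ℝ) (N : V) :
    inner ℝ (N - p) (dampedField p W t N) = - ∑ i, output p W i t N ^ 2 := by
  rw [dampedField, inner_neg_right, inner_sum]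
  congr 1
  exact Finset.sum_congr rfl fun i _ => by rw [inner_smul_right, pow_two]; rfl

theorem hasDerivAt_dist_sq {N : ℝ → V} {t : ℝ} {c : ℝ}
    (h : HasDerivAt N (c • dampedField p W t (N t)) t) :
    HasDerivAt (fun t => ‖N t - p‖ ^ 2) (- (2 * c * ∑ i, output p W i t (N t) ^ 2)) t := by
  have h1 := (h.sub_const p).norm_sq
  rw [inner_smul_right, inner_dampedField] at h1
  convert h1 using 1
  ring

theorem norm_sub_le_of_damped {N : ℝ → V} {τ : ℝ} {c : V → ℝ} (hc : ∀ v, 0 ≤ c v)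
    (h : IsSolutionOn (fun t v => c v • dampedField p W t v) τ N) {s t : ℝ} (hs : 0 ≤ s)
    (hst : s ≤ t) (ht : t ≤ τ) : ‖N t - p‖ ≤ ‖N s - p‖ := by
  have hanti : AntitoneOn (fun t => ‖N t - p‖ ^ 2) (Set.Icc 0 τ) := by
    refine antitoneOn_of_deriv_nonpos (convex_Icc _ _)
      ((h.continuousOn.sub continuousOn_const).norm.pow 2) ?_ ?_
    · rw [interior_Icc]
      exact fun x hx => (hasDerivAt_dist_sq (h.hasDerivAt x hx)).differentiableAt.differentiableWithinAt
    · rw [interior_Icc]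
      intro x hx
      rw [(hasDerivAt_dist_sq (h.hasDerivAt x hx)).deriv]
      have := hc (N x)
      have : 0 ≤ ∑ i, output p W i x (N x) ^ 2 := Finset.sum_nonneg fun i _ => sq_nonneg _
      rw [neg_nonpos]
      positivity
  exact abs_le_of_sq_le_sq' (hanti ⟨hs, hst.trans ht⟩ ⟨hs.trans hst, ht⟩ hst)
    (norm_nonneg _) |>.2

theorem IsSolutionOn.one_smul {N : ℝ → V} {τ : ℝ} (h : IsSolutionOn (dampedField p W) τ N) :
    IsSolutionOn (fun t v => (1 : ℝ) • dampedField p W t v) τ N := by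
  simpa only [_root_.one_smul] using h

theorem IsSolutionOn.norm_sub_le {N : ℝ → V} {τ : ℝ} (h : IsSolutionOn (dampedField p W) τ N)
    {s t : ℝ} (hs : 0 ≤ s) (hst : s ≤ t) (ht : t ≤ τ) : ‖N t - p‖ ≤ ‖N s - p‖ :=
  norm_sub_le_of_damped (c := fun _ => 1) (fun _ => zero_le_one) h.one_smul hs hst ht

variable {K : ℝ}

theorem norm_apply_le (hW : ∀ i t, ‖W i t‖ ≤ K) {r : ℝ} {N : V} (hN : ‖N - p‖ ≤ r) (i : ι)
    (t : ℝ) : ‖W i t N‖ ≤ K * (r + ‖p‖) := by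
  have h1 : ‖N‖ ≤ r + ‖p‖ := (norm_le_norm_sub_add N p).trans (by gcongr)
  have hK : 0 ≤ K := (W i t).opNorm_nonneg.trans (hW i t)
  exact ((W i t).le_opNorm N).trans (mul_le_mul (hW i t) h1 (norm_nonneg _) hK)

theorem abs_output_le (hW : ∀ i t, ‖W i t‖ ≤ K) {r : ℝ} {N : V} (hN : ‖N - p‖ ≤ r) (i : ι)
    (t : ℝ) : |output p W i t N| ≤ r * (K * (r + ‖p‖)) := by
  have hr : 0 ≤ r := (norm_nonneg _).trans hN
  exact (abs_real_inner_le_norm _ _).trans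
    (mul_le_mul hN (norm_apply_le hW hN i t) (norm_nonneg _) hr)

theorem abs_output_sub_le (hW : ∀ i t, ‖W i t‖ ≤ K) {r : ℝ} {N N' : V} (hN : ‖N - p‖ ≤ r)
    (hN' : ‖N' - p‖ ≤ r) (i : ι) (t t' : ℝ) : |output p W i t N - output p W i t' N'| ≤
      (K * (r + ‖p‖) + r * K) * ‖N - N'‖ + r * (r + ‖p‖) * ‖W i t - W i t'‖ := by
  have hr : 0 ≤ r := (norm_nonneg _).trans hN
  have hK : 0 ≤ K := (W i t).opNorm_nonneg.trans (hW i t)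
  have e : output p W i t N - output p W i t' N' = inner ℝ (N - N') (W i t N) +
      inner ℝ (N' - p) (W i t (N - N')) + inner ℝ (N' - p) ((W i t - W i t') N') := by
    unfold output
    rw [map_sub, inner_sub_right, sub_apply, inner_sub_right,
      show N - p = (N - N') + (N' - p) by abel, inner_add_left]
    ring
  have h1 : ‖N'‖ ≤ r + ‖p‖ := (norm_le_norm_sub_add N' p).trans (by gcongr)
  have b1 : |inner ℝ (N - N') (W i t N)| ≤ ‖N - N'‖ * (K * (r + ‖p‖)) :=
    (abs_real_inner_le_norm _ _).trans
      (mul_le_mul_of_nonneg_left (norm_apply_le hW hN i t) (norm_nonneg _))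
  have b2 : |inner ℝ (N' - p) (W i t (N - N'))| ≤ r * (K * ‖N - N'‖) :=
    (abs_real_inner_le_norm _ _).trans (mul_le_mul hN' (((W i t).le_opNorm _).trans
      (mul_le_mul_of_nonneg_right (hW i t) (norm_nonneg _))) (norm_nonneg _) hr)
  have b3 : |inner ℝ (N' - p) ((W i t - W i t') N')| ≤ r * (‖W i t - W i t'‖ * (r + ‖p‖)) :=
    (abs_real_inner_le_norm _ _).trans (mul_le_mul hN' (((W i t - W i t').le_opNorm _).trans
      (mul_le_mul_of_nonneg_left h1 (ContinuousLinearMap.opNorm_nonneg _))) (norm_nonneg _) hr)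
  rw [e]
  calc _ ≤ |inner ℝ (N - N') (W i t N)| + |inner ℝ (N' - p) (W i t (N - N'))| +
        |inner ℝ (N' - p) ((W i t - W i t') N')| := abs_add_three _ _ _
    _ ≤ ‖N - N'‖ * (K * (r + ‖p‖)) + r * (K * ‖N - N'‖) +
        r * (‖W i t - W i t'‖ * (r + ‖p‖)) := add_le_add (add_le_add b1 b2) b3
    _ = _ := by ring

theorem exists_norm_dampedField_le (hW : ∀ i t, ‖W i t‖ ≤ K) (r : ℝ) :
    ∃ B, 0 ≤ B ∧ ∀ t (N : V), ‖N - p‖ ≤ r → ‖dampedField p W t N‖ ≤ B := by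
  refine ⟨max 0 (∑ _i : ι, (r * (K * (r + ‖p‖))) * (K * (r + ‖p‖))), le_max_left _ _,
    fun t N hN => le_trans ?_ (le_max_right _ _)⟩
  rw [dampedField, norm_neg]
  refine (norm_sum_le _ _).trans (Finset.sum_le_sum fun i _ => ?_)
  rw [norm_smul, Real.norm_eq_abs]
  exact mul_le_mul (abs_output_le hW hN i t) (norm_apply_le hW hN i t) (norm_nonneg _)
    ((abs_nonneg _).trans (abs_output_le hW hN i t))

theorem exists_dampedField_lipschitz (hW : ∀ i t, ‖W i t‖ ≤ K) (r : ℝ) :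
    ∃ L, 0 ≤ L ∧ ∀ t (N N' : V), ‖N - p‖ ≤ r → ‖N' - p‖ ≤ r →
      ‖dampedField p W t N - dampedField p W t N'‖ ≤ L * ‖N - N'‖ := by
  refine ⟨max 0 (∑ _i : ι, ((r * (K * (r + ‖p‖))) * K +
    (K * (r + ‖p‖) + r * K) * (K * (r + ‖p‖)))), le_max_left _ _, fun t N N' hN hN' => ?_⟩
  refine le_trans ?_ (mul_le_mul_of_nonneg_right (le_max_right _ _) (norm_nonneg _))
  have e : dampedField p W t N - dampedField p W t N' =
      - ∑ i, (output p W i t N • W i t (N - N') +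
        (output p W i t N - output p W i t N') • W i t N') := by
    rw [dampedField, dampedField, neg_sub_neg, ← Finset.sum_sub_distrib,
      ← Finset.sum_neg_distrib]
    refine Finset.sum_congr rfl fun i _ => ?_
    rw [map_sub, smul_sub, sub_smul]
    abel
  rw [e, norm_neg, Finset.sum_mul]
  refine (norm_sum_le _ _).trans (Finset.sum_le_sum fun i _ => ?_)
  have h1 := abs_output_le hW hN i t
  have h2 := abs_output_sub_le hW hN hN' i t t
  rw [sub_self, norm_zero, mul_zero, add_zero] at h2
  have h3 : ‖W i t (N - N')‖ ≤ K * ‖N - N'‖ :=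
    ((W i t).le_opNorm _).trans (mul_le_mul_of_nonneg_right (hW i t) (norm_nonneg _))
  have h4 := norm_apply_le hW hN' i t
  refine (norm_add_le _ _).trans ?_
  rw [norm_smul, norm_smul, Real.norm_eq_abs, Real.norm_eq_abs, add_mul]
  refine add_le_add ?_ ?_
  · rw [mul_assoc]
    exact mul_le_mul h1 h3 (norm_nonneg _) ((abs_nonneg _).trans h1)
  · calc _ ≤ ((K * (r + ‖p‖) + r * K) * ‖N - N'‖) * (K * (r + ‖p‖)) :=
          mul_le_mul h2 h4 (norm_nonneg _) ((abs_nonneg _).trans h2)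
      _ = _ := by ring

/-- Solutions of the damped equation are determined by their initial value. -/
theorem IsSolutionOn.unique (hW : ∀ i t, ‖W i t‖ ≤ K) {N N' : ℝ → V} {τ : ℝ}
    (h : IsSolutionOn (dampedField p W) τ N) (h' : IsSolutionOn (dampedField p W) τ N')
    (h0 : N 0 = N' 0) : ∀ t ∈ Set.Icc 0 τ, N t = N' t := by
  obtain ⟨L, hL0, hL⟩ := exists_dampedField_lipschitz (p := p) hW ‖N 0 - p‖
  have hd : ∀ t ∈ Set.Ioo 0 τ, HasDerivAt (fun t => ‖N t - N' t‖ ^ 2 * Real.exp (-(2 * L) * t))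
      (2 * inner ℝ (N t - N' t) (dampedField p W t (N t) - dampedField p W t (N' t)) *
        Real.exp (-(2 * L) * t) + ‖N t - N' t‖ ^ 2 * (Real.exp (-(2 * L) * t) * -(2 * L))) t := by
    intro t ht
    have h2 : HasDerivAt (fun t : ℝ => -(2 * L) * t) (-(2 * L)) t := by
      simpa using (hasDerivAt_id t).const_mul (-(2 * L))
    exact (((h.hasDerivAt t ht).sub (h'.hasDerivAt t ht)).norm_sq).mul h2.exp
  have hanti : AntitoneOn (fun t => ‖N t - N' t‖ ^ 2 * Real.exp (-(2 * L) * t))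
      (Set.Icc 0 τ) := by
    refine antitoneOn_of_deriv_nonpos (convex_Icc _ _)
      (((h.continuousOn.sub h'.continuousOn).norm.pow 2).mul (by fun_prop)) ?_ ?_
    · rw [interior_Icc]
      exact fun x hx => (hd x hx).differentiableAt.differentiableWithinAt
    · rw [interior_Icc]
      intro x hx
      rw [(hd x hx).deriv]
      have b1 := h.norm_sub_le le_rfl hx.1.le hx.2.le
      have b2 := h'.norm_sub_le le_rfl hx.1.le hx.2.le
      rw [← h0] at b2
      have b3 := hL x _ _ b1 b2
      have b4 := real_inner_le_norm (N x - N' x)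
        (dampedField p W x (N x) - dampedField p W x (N' x))
      have b5 : inner ℝ (N x - N' x) (dampedField p W x (N x) - dampedField p W x (N' x)) ≤
          L * ‖N x - N' x‖ ^ 2 := by
        refine b4.trans ?_
        nlinarith [norm_nonneg (N x - N' x)]
      have b6 := Real.exp_pos (-(2 * L) * x)
      nlinarith
  intro t ht
  have h1 := hanti ⟨le_rfl, ht.1.trans ht.2⟩ ht ht.1
  simp only [h0, sub_self, norm_zero, ne_eq, OfNat.ofNat_ne_zero, not_false_eq_true, zero_pow,
    zero_mul] at h1
  have h2 : ‖N t - N' t‖ ^ 2 ≤ 0 := by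
    by_contra hc
    have := mul_pos (not_le.1 hc) (Real.exp_pos (-(2 * L) * t))
    linarith
  have h3 : ‖N t - N' t‖ = 0 := by
    have := sq_nonneg ‖N t - N' t‖
    exact pow_eq_zero_iff (two_ne_zero) |>.1 (le_antisymm h2 this)
  exact sub_eq_zero.1 (norm_eq_zero.1 h3)

/-- The damped equation can be solved on every bounded interval: multiply the field by a cut-off,
which makes it bounded, and observe that the distance to `p` still decreases, so that the
solution stays where the cut-off equals `1`. -/
theorem exists_isSolutionOn (hW : ∀ i t, ‖W i t‖ ≤ K) (hWc : ∀ i, Continuous (W i)) (N₀ : V)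
    {τ : ℝ} (hτ : 0 ≤ τ) : ∃ N : ℝ → V, N 0 = N₀ ∧ IsSolutionOn (dampedField p W) τ N := by
  set ρ := ‖N₀ - p‖ with hρ
  set c : V → ℝ := fun v => max 0 (min 1 (ρ + 1 - ‖v - p‖)) with hc
  have c0 : ∀ v, 0 ≤ c v := fun v => le_max_left _ _
  have c1 : ∀ v, c v ≤ 1 := fun v => max_le zero_le_one (min_le_left _ _)
  have cl : ∀ v w, |c v - c w| ≤ ‖v - w‖ := fun v w => by
    have h1 : |c v - c w| ≤ |min 1 (ρ + 1 - ‖v - p‖) - min 1 (ρ + 1 - ‖w - p‖)| := by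
      have := abs_max_sub_max_le_max 0 (min 1 (ρ + 1 - ‖v - p‖)) 0 (min 1 (ρ + 1 - ‖w - p‖))
      simpa using this
    have h2 : |min 1 (ρ + 1 - ‖v - p‖) - min 1 (ρ + 1 - ‖w - p‖)| ≤
        |(ρ + 1 - ‖v - p‖) - (ρ + 1 - ‖w - p‖)| := by
      have := abs_min_sub_min_le_max 1 (ρ + 1 - ‖v - p‖) 1 (ρ + 1 - ‖w - p‖)
      simpa using this
    have h3 : |(ρ + 1 - ‖v - p‖) - (ρ + 1 - ‖w - p‖)| ≤ ‖v - w‖ := by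
      have := abs_norm_sub_norm_le (w - p) (v - p)
      rw [sub_sub_sub_cancel_right, norm_sub_rev w v] at this
      rw [show (ρ + 1 - ‖v - p‖) - (ρ + 1 - ‖w - p‖) = ‖w - p‖ - ‖v - p‖ by ring]
      exact this
    exact h1.trans (h2.trans h3)
  have cz : ∀ v, ρ + 1 ≤ ‖v - p‖ → c v = 0 := fun v hv =>
    max_eq_left ((min_le_right _ _).trans (by linarith))
  have cone : ∀ v, ‖v - p‖ ≤ ρ → c v = 1 := fun v hv => by
    simp only [hc]
    rw [min_eq_left (by linarith), max_eq_right zero_le_one]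
  obtain ⟨B, hB0, hB⟩ := exists_norm_dampedField_le (p := p) hW (ρ + 1)
  have hfB : ∀ t v, ‖c v • dampedField p W t v‖ ≤ B := fun t v => by
    rcases le_total (ρ + 1) ‖v - p‖ with h | h
    · rw [cz v h, zero_smul, norm_zero]; exact hB0
    · rw [norm_smul, Real.norm_eq_abs, abs_of_nonneg (c0 v)]
      calc _ ≤ 1 * B := mul_le_mul (c1 v) (hB t v h) (norm_nonneg _) zero_le_one
        _ = B := one_mul B
  obtain ⟨B', hB'0, hB'⟩ := exists_norm_dampedField_le (p := p) hW (B * τ + ρ)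
  obtain ⟨L, hL0, hL⟩ := exists_dampedField_lipschitz (p := p) hW (B * τ + ρ)
  have hball : ∀ v ∈ Metric.closedBall N₀ (B * τ), ‖v - p‖ ≤ B * τ + ρ := fun v hv => by
    rw [mem_closedBall_iff_norm] at hv
    calc ‖v - p‖ = ‖(v - N₀) + (N₀ - p)‖ := by congr 1; abel
      _ ≤ _ := (norm_add_le _ _).trans (by linarith)
  have hpl : IsPicardLindelof (fun t v => c v • dampedField p W t v) (tmin := 0) (tmax := τ)
      ⟨0, le_rfl, hτ⟩ N₀ ⟨B * τ, by positivity⟩ 0 ⟨B, hB0⟩ ⟨L + B', by positivity⟩ := by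
    refine ⟨?_, ?_, fun t _ v _ => hfB t v, ?_⟩
    · intro t _
      refine LipschitzOnWith.of_dist_le_mul fun v hv w hw => ?_
      rw [dist_eq_norm, dist_eq_norm]
      change _ ≤ (L + B') * ‖v - w‖
      have e : c v • dampedField p W t v - c w • dampedField p W t w =
        c v • (dampedField p W t v - dampedField p W t w) + (c v - c w) • dampedField p W t w := by
        rw [smul_sub, sub_smul]; abel
      rw [e]
      refine (norm_add_le _ _).trans ?_
      rw [norm_smul, norm_smul, Real.norm_eq_abs, Real.norm_eq_abs, abs_of_nonneg (c0 v), add_mul]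
      refine add_le_add ?_ ?_
      · calc _ ≤ 1 * (L * ‖v - w‖) :=
            mul_le_mul (c1 v) (hL t v w (hball v hv) (hball w hw)) (norm_nonneg _) zero_le_one
          _ = _ := one_mul _
      · rw [mul_comm B']
        exact mul_le_mul (cl v w) (hB' t w (hball w hw)) (norm_nonneg _) (norm_nonneg _)
    · intro v _
      refine Continuous.continuousOn ?_
      unfold dampedField output
      have : ∀ i, Continuous fun t => W i t v := fun i => (hWc i).clm_apply continuous_const
      fun_prop
    · change B * max (τ - 0) (0 - 0) ≤ B * τ - 0
      rw [sub_zero, sub_zero, sub_zero, max_eq_left hτ]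
  obtain ⟨N, hN0, hN⟩ := hpl.exists_eq_forall_mem_Icc_hasDerivWithinAt₀
  have hsol : IsSolutionOn (fun t v => c v • dampedField p W t v) τ N :=
    ⟨fun t ht => (hN t ht).continuousWithinAt, fun t ht =>
      (hN t (Set.Ioo_subset_Icc_self ht)).hasDerivAt (Icc_mem_nhds ht.1 ht.2)⟩
  refine ⟨N, hN0, hsol.continuousOn, fun t ht => ?_⟩
  have h1 := norm_sub_le_of_damped c0 hsol le_rfl ht.1.le ht.2.le
  have h2 := hsol.hasDerivAt t ht
  have hN0' : N 0 = N₀ := hN0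
  rw [hN0'] at h1
  rwa [cone _ h1, one_smul] at h2

theorem exists_global_solution (hW : ∀ i t, ‖W i t‖ ≤ K) (hWc : ∀ i, Continuous (W i)) (N₀ : V) :
    ∃ N : ℝ → V, N 0 = N₀ ∧ ∀ τ, IsSolutionOn (dampedField p W) τ N := by
  choose α h0 hα using fun n : ℕ =>
    exists_isSolutionOn (p := p) hW hWc N₀ (τ := n) (Nat.cast_nonneg n)
  have hag : ∀ (n : ℕ) (t : ℝ), t ∈ Set.Icc 0 (n : ℝ) → α (⌊t⌋₊ + 1) t = α n t := by
    intro n t ht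
    have h1 : t ≤ ((⌊t⌋₊ + 1 : ℕ) : ℝ) := by
      push_cast
      exact (Nat.lt_floor_add_one t).le
    exact ((hα _).mono h1).unique hW ((hα n).mono ht.2) ((h0 _).trans (h0 n).symm) t ⟨ht.1, le_rfl⟩
  refine ⟨fun t => α (⌊t⌋₊ + 1) t, h0 _, fun τ => ?_⟩
  obtain ⟨n, hn⟩ := exists_nat_ge τ
  refine IsSolutionOn.mono ⟨(hα n).continuousOn.congr (hag n), fun t ht => ?_⟩ hn
  rw [hag n t (Set.Ioo_subset_Icc_self ht)]
  refine ((hα n).hasDerivAt t ht).congr_of_eventuallyEq ?_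
  filter_upwards [Ioo_mem_nhds ht.1 ht.2] with s hs
  exact hag n s (Set.Ioo_subset_Icc_self hs)

/-- Barbalat's lemma: if a nonincreasing function bounded below has a Lipschitz derivative, then
this derivative tends to `0`. -/
theorem tendsto_zero_of_lipschitz_deriv {v g : ℝ → ℝ} {L : ℝ} (hL : 0 < L)
    (hv : ∀ t, 0 < t → 0 ≤ v t) (hd : ∀ t, 0 < t → HasDerivAt v (- g t) t)
    (hg : ∀ t, 0 < t → 0 ≤ g t) (hgl : ∀ s t, 0 < s → 0 < t → |g s - g t| ≤ L * |s - t|) :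
    Tendsto g atTop (𝓝 0) := by
  have hslope : ∀ s t, 0 < s → s < t → ∃ ξ ∈ Set.Ioo s t, v s - v t = g ξ * (t - s) := by
    intro s t hs hst
    obtain ⟨ξ, hξ, he⟩ := exists_hasDerivAt_eq_slope v (fun t => - g t) hst
      (fun x hx => (hd x (hs.trans_le hx.1)).continuousAt.continuousWithinAt)
      (fun x hx => hd x (hs.trans hx.1))
    refine ⟨ξ, hξ, ?_⟩
    have : t - s ≠ 0 := (sub_pos.2 hst).ne'
    field_simp at he
    linarith
  have hanti : ∀ s t, 0 < s → s ≤ t → v t ≤ v s := by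
    intro s t hs hst
    rcases hst.eq_or_lt with rfl | hlt
    · exact le_rfl
    obtain ⟨ξ, hξ, he⟩ := hslope s t hs hlt
    have := mul_nonneg (hg ξ (hs.trans hξ.1)) (sub_nonneg.2 hst)
    linarith
  set ℓ := sInf (v '' Set.Ioi 0) with hℓ
  have hbdd : BddBelow (v '' Set.Ioi 0) := ⟨0, by rintro _ ⟨t, ht, rfl⟩; exact hv t ht⟩
  have hℓle : ∀ t, 0 < t → ℓ ≤ v t := fun t ht => csInf_le hbdd ⟨t, ht, rfl⟩
  rw [Metric.tendsto_atTop]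
  intro ε hε
  obtain ⟨_, ⟨t₀, ht₀, rfl⟩, hlt⟩ := exists_lt_of_csInf_lt (s := v '' Set.Ioi 0)
    ⟨_, ⟨1, Set.mem_Ioi.2 one_pos, rfl⟩⟩ (show ℓ < ℓ + ε / 2 * (ε / (2 * L)) by
      have : 0 < ε / 2 * (ε / (2 * L)) := by positivity
      linarith)
  have ht₀' : 0 < t₀ := ht₀
  refine ⟨t₀, fun t ht => ?_⟩
  have ht0 : 0 < t := ht₀'.trans_le ht
  rw [Real.dist_eq, sub_zero, abs_of_nonneg (hg t ht0)]
  by_contra hc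
  rw [not_lt] at hc
  have hη : 0 < ε / (2 * L) := by positivity
  obtain ⟨ξ, hξ, he⟩ := hslope t (t + ε / (2 * L)) ht0 (by linarith)
  have h1 := hgl t ξ ht0 (ht0.trans hξ.1)
  rw [abs_sub_comm t ξ, abs_of_pos (sub_pos.2 hξ.1)] at h1
  have h2 : L * (ξ - t) ≤ ε / 2 := by
    have : ξ - t ≤ ε / (2 * L) := by linarith [hξ.2]
    calc L * (ξ - t) ≤ L * (ε / (2 * L)) := by gcongr
      _ = ε / 2 := by field_simp
  have h3 : ε / 2 ≤ g ξ := by linarith [(abs_le.1 h1).2]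
  have h4 := hℓle (t + ε / (2 * L)) (by linarith)
  have h5 := hanti t₀ t ht₀' ht
  rw [add_sub_cancel_left] at he
  have h6 : ε / 2 * (ε / (2 * L)) ≤ g ξ * (ε / (2 * L)) := by gcongr
  linarith

theorem hasDerivAt_of_global {N : ℝ → V} (hN : ∀ τ, IsSolutionOn (dampedField p W) τ N) {t : ℝ}
    (ht : 0 < t) : HasDerivAt N (dampedField p W t (N t)) t :=
  (hN (t + 1)).hasDerivAt t ⟨ht, by linarith⟩

theorem norm_sub_le_of_global {N : ℝ → V} (hN : ∀ τ, IsSolutionOn (dampedField p W) τ N) {s t : ℝ}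
    (hs : 0 ≤ s) (hst : s ≤ t) : ‖N t - p‖ ≤ ‖N s - p‖ :=
  (hN t).norm_sub_le hs hst le_rfl

/-- Along a solution, the outputs tend to `0`, because the squared distance to `p` has derivative
`-2 ∑ ⟨N - p, W_i N⟩²`. -/
theorem tendsto_output_zero (hW : ∀ i t, ‖W i t‖ ≤ K) (hWl : ∀ i s t, ‖W i s - W i t‖ ≤ K * |s - t|)
    {N : ℝ → V} (hN : ∀ τ, IsSolutionOn (dampedField p W) τ N) (i : ι) :
    Tendsto (fun t => output p W i t (N t)) atTop (𝓝 0) := by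
  have hK : 0 ≤ K := (W i 0).opNorm_nonneg.trans (hW i 0)
  set r := ‖N 0 - p‖ with hr
  have hr0 : 0 ≤ r := norm_nonneg _
  have hNr : ∀ t, 0 < t → ‖N t - p‖ ≤ r := fun t ht => norm_sub_le_of_global hN le_rfl ht.le
  obtain ⟨B, hB0, hB⟩ := exists_norm_dampedField_le (p := p) hW r
  have hNl : ∀ s t, 0 < s → 0 < t → ‖N s - N t‖ ≤ B * |s - t| := fun s t hs ht =>
    (convex_Ioi (0 : ℝ)).norm_image_sub_le_of_norm_hasDerivWithin_le
      (fun x hx => (hasDerivAt_of_global hN hx).hasDerivWithinAt)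
      (fun x hx => hB x _ (hNr x hx)) ht hs
  set c := r * (K * (r + ‖p‖)) with hc
  have hc0 : 0 ≤ c := by positivity
  set Λ := (K * (r + ‖p‖) + r * K) * B + r * (r + ‖p‖) * K with hΛ
  have hΛ0 : 0 ≤ Λ := by positivity
  have hsq : ∀ j s t, 0 < s → 0 < t →
      |output p W j s (N s) ^ 2 - output p W j t (N t) ^ 2| ≤ 2 * c * Λ * |s - t| := by
    intro j s t hs ht
    have h1 : |output p W j s (N s) - output p W j t (N t)| ≤ Λ * |s - t| := by
      refine (abs_output_sub_le hW (hNr s hs) (hNr t ht) j s t).trans ?_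
      have h2 := hNl s t hs ht
      have h3 := hWl j s t
      calc _ ≤ (K * (r + ‖p‖) + r * K) * (B * |s - t|) + r * (r + ‖p‖) * (K * |s - t|) := by
            gcongr
        _ = _ := by rw [hΛ]; ring
    have h2 : |output p W j s (N s) + output p W j t (N t)| ≤ 2 * c :=
      (abs_add_le _ _).trans (by
        have := abs_output_le hW (hNr s hs) j s
        have := abs_output_le hW (hNr t ht) j t
        linarith)
    rw [sq_sub_sq, abs_mul, mul_assoc]
    exact mul_le_mul h2 h1 (abs_nonneg _) (by positivity)
  have key : Tendsto (fun t => 2 * 1 * ∑ j, output p W j t (N t) ^ 2) atTop (𝓝 0) := by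
    refine tendsto_zero_of_lipschitz_deriv (v := fun t => ‖N t - p‖ ^ 2)
      (L := 2 * (∑ _j : ι, 2 * c * Λ) + 1) ?_ (fun t _ => sq_nonneg _) (fun t ht => ?_)
      (fun t _ => mul_nonneg (by norm_num) (Finset.sum_nonneg fun j _ => sq_nonneg _)) ?_
    · have : 0 ≤ ∑ _j : ι, 2 * c * Λ := Finset.sum_nonneg fun _ _ => by positivity
      linarith
    · refine hasDerivAt_dist_sq ?_
      rw [one_smul]
      exact hasDerivAt_of_global hN ht
    · intro s t hs ht
      rw [← mul_sub, ← Finset.sum_sub_distrib, abs_mul]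
      have h1 : |∑ j, (output p W j s (N s) ^ 2 - output p W j t (N t) ^ 2)| ≤
          (∑ _j : ι, 2 * c * Λ) * |s - t| := by
        rw [Finset.sum_mul]
        exact (Finset.abs_sum_le_sum_abs _ _).trans
          (Finset.sum_le_sum fun j _ => hsq j s t hs ht)
      have h2 : |(2 * 1 : ℝ)| = 2 := by norm_num
      rw [h2]
      nlinarith [abs_nonneg (s - t)]
  have h2 : Tendsto (fun t => output p W i t (N t) ^ 2) atTop (𝓝 0) := by
    refine squeeze_zero (fun t => sq_nonneg _) (fun t => ?_) key
    have h1 := Finset.single_le_sum (f := fun j => output p W j t (N t) ^ 2)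
      (fun j _ => sq_nonneg _) (Finset.mem_univ i)
    have h0 : 0 ≤ output p W i t (N t) ^ 2 := sq_nonneg _
    linarith
  have h3 := (Real.continuous_sqrt.tendsto 0).comp h2
  rw [Real.sqrt_zero] at h3
  rw [tendsto_zero_iff_abs_tendsto_zero]
  refine h3.congr fun t => ?_
  exact Real.sqrt_sq_eq_abs _

/-- Along a solution of a periodic damped equation, the states at the multiples of the period
asymptotically make all outputs vanish over a whole period. -/
theorem tendsto_output_period (hW : ∀ i t, ‖W i t‖ ≤ K)
    (hWl : ∀ i s t, ‖W i s - W i t‖ ≤ K * |s - t|) {N : ℝ → V}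
    (hN : ∀ τ, IsSolutionOn (dampedField p W) τ N) {τ : ℝ} (hτ : 0 < τ)
    (hper : ∀ i (k : ℕ) s, W i (k * τ + s) = W i s) (i : ι) {s : ℝ} (hs : 0 ≤ s) :
    Tendsto (fun k : ℕ => output p W i s (N (k * τ))) atTop (𝓝 0) := by
  have hK : 0 ≤ K := (W i 0).opNorm_nonneg.trans (hW i 0)
  set r := ‖N 0 - p‖ with hr
  have hr0 : 0 ≤ r := norm_nonneg _
  have hNr : ∀ t, 0 ≤ t → ‖N t - p‖ ≤ r := fun t ht => norm_sub_le_of_global hN le_rfl ht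
  have hfield : Tendsto (fun t => ‖dampedField p W t (N t)‖) atTop (𝓝 0) := by
    have h1 : Tendsto (fun t => ∑ j, |output p W j t (N t)| * (K * (r + ‖p‖))) atTop (𝓝 0) := by
      have : Tendsto (fun t => ∑ j, |output p W j t (N t)| * (K * (r + ‖p‖))) atTop
          (𝓝 (∑ _j : ι, |(0 : ℝ)| * (K * (r + ‖p‖)))) :=
        tendsto_finsetSum _ fun j _ => ((tendsto_output_zero hW hWl hN j).abs).mul_const _
      simpa using this
    refine squeeze_zero' (Eventually.of_forall fun t => norm_nonneg _) ?_ h1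
    filter_upwards [eventually_ge_atTop 0] with t ht
    rw [dampedField, norm_neg]
    refine (norm_sum_le _ _).trans (Finset.sum_le_sum fun j _ => ?_)
    rw [norm_smul, Real.norm_eq_abs]
    exact mul_le_mul_of_nonneg_left (norm_apply_le hW (hNr t ht) j t) (abs_nonneg _)
  have hshift : Tendsto (fun t => ‖N t - N (t + s)‖) atTop (𝓝 0) := by
    rw [Metric.tendsto_atTop] at hfield ⊢
    intro ε hε
    obtain ⟨t₀, ht₀⟩ := hfield (ε / (s + 1)) (by positivity)
    refine ⟨max t₀ 1, fun t ht => ?_⟩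
    have h1 : max t₀ 1 ≤ t := ht
    have h2 := (convex_Ici (max t₀ 1)).norm_image_sub_le_of_norm_hasDerivWithin_le
      (f := N) (C := ε / (s + 1)) (fun x hx => (hasDerivAt_of_global hN
        (zero_lt_one.trans_le ((le_max_right _ _).trans hx))).hasDerivWithinAt)
      (fun x hx => by
        have := ht₀ x ((le_max_left _ _).trans hx)
        rw [Real.dist_eq, sub_zero, abs_norm] at this
        exact this.le) (Set.mem_Ici.2 (by linarith : max t₀ 1 ≤ t + s)) (Set.mem_Ici.2 h1)
    rw [Real.dist_eq, sub_zero, abs_norm]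
    refine h2.trans_lt ?_
    rw [sub_add_cancel_left, norm_neg, Real.norm_eq_abs, abs_of_nonneg hs, div_mul_eq_mul_div,
      div_lt_iff₀ (by positivity)]
    nlinarith
  have hk : Tendsto (fun k : ℕ => (k : ℝ) * τ) atTop atTop :=
    tendsto_natCast_atTop_atTop.atTop_mul_const hτ
  have h1 := (tendsto_output_zero hW hWl hN i).comp (tendsto_atTop_add_const_right _ s hk)
  have h2 := hshift.comp hk
  have h3 : Tendsto (fun k : ℕ => output p W i s (N (k * τ)) -
      output p W i (k * τ + s) (N (k * τ + s))) atTop (𝓝 0) := by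
    have h4 := h2.const_mul (K * (r + ‖p‖) + r * K)
    rw [mul_zero] at h4
    refine squeeze_zero_norm (fun k => ?_) h4
    have hkτ : 0 ≤ (k : ℝ) * τ := by positivity
    have h5 := abs_output_sub_le hW (hNr _ hkτ) (hNr (k * τ + s) (by positivity)) i s (k * τ + s)
    rw [hper i k s, sub_self, norm_zero, mul_zero, add_zero] at h5
    exact h5
  have h6 := h3.add h1
  rw [add_zero] at h6
  refine h6.congr fun k => ?_
  simp

end Flow

/-! ### Rotations of `ℝ³` and the cross product -/

section Rotations

/-- A bilinear map on finite-dimensional spaces, as a continuous bilinear map. -/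
def toBilin {E E₁ E₂ : Type*} [NormedAddCommGroup E] [NormedSpace ℝ E] [FiniteDimensional ℝ E]
    [NormedAddCommGroup E₁] [NormedSpace ℝ E₁] [FiniteDimensional ℝ E₁]
    [NormedAddCommGroup E₂] [NormedSpace ℝ E₂] (f : E →ₗ[ℝ] E₁ →ₗ[ℝ] E₂) :
    E →L[ℝ] E₁ →L[ℝ] E₂ :=
  LinearMap.toContinuousLinearMap
    ((LinearMap.toContinuousLinearMap : (E₁ →ₗ[ℝ] E₂) ≃ₗ[ℝ] _).toLinearMap ∘ₗ f)

theorem E3_ext {x y : E3} (h0 : x 0 = y 0) (h1 : x 1 = y 1) (h2 : x 2 = y 2) : x = y := by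
  ext i
  fin_cases i
  · exact h0
  · exact h1
  · exact h2

theorem wedge_apply_zero (x y : E3) : wedge x y 0 = x 1 * y 2 - x 2 * y 1 := by
  simp [wedge, cross_apply]

theorem wedge_apply_one (x y : E3) : wedge x y 1 = x 2 * y 0 - x 0 * y 2 := by
  simp [wedge, cross_apply]

theorem wedge_apply_two (x y : E3) : wedge x y 2 = x 0 * y 1 - x 1 * y 0 := by
  simp [wedge, cross_apply]

theorem inner_E3 (x y : E3) : inner ℝ x y = x 0 * y 0 + x 1 * y 1 + x 2 * y 2 := by
  simp [PiLp.inner_apply, Fin.sum_univ_three]; ring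

theorem ofMatrix_apply (A : Matrix (Fin 3) (Fin 3) ℝ) (x : E3) (i : Fin 3) :
    ofMatrix A x i = A i 0 * x 0 + A i 1 * x 1 + A i 2 * x 2 := by
  simp [ofMatrix, Matrix.mulVec, dotProduct, Fin.sum_univ_three]

/-- The cross product as a continuous bilinear map. -/
def wedgeL : E3 →L[ℝ] E3 →L[ℝ] E3 :=
  toBilin (LinearMap.mk₂ ℝ wedge
    (fun x x' y => by simp [wedge]) (fun c x y => by simp [wedge])
    (fun x y y' => by simp [wedge]) (fun c x y => by simp [wedge]))

theorem wedgeL_apply (x y : E3) : wedgeL x y = wedge x y := rfl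

/-- The inner product of `ℝ³` as a continuous bilinear map. -/
def innerL : E3 →L[ℝ] E3 →L[ℝ] ℝ :=
  toBilin (LinearMap.mk₂ ℝ (fun x y : E3 => inner ℝ x y)
    (fun x x' y => inner_add_left x x' y) (fun c x y => real_inner_smul_left x y c)
    (fun x y y' => inner_add_right x y y') (fun c x y => real_inner_smul_right x y c))

theorem innerL_apply (x y : E3) : innerL x y = inner ℝ x y := rfl

/-- The rank-one operator `v ↦ ⟨x, v⟩ y`, as a function of `(x, y)`. -/
def rankOneL : E3 →L[ℝ] E3 →L[ℝ] M3 :=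
  toBilin (LinearMap.mk₂ ℝ (fun x y : E3 => (innerL x).smulRight y)
    (fun x x' y => by ext; simp [add_mul]) (fun c x y => by ext; simp [mul_assoc])
    (fun x y y' => by ext; simp) (fun c x y => by ext; simp; ring))

/-- Evaluation of an operator of `ℝ³` at a vector. -/
def applyL : M3 →L[ℝ] E3 →L[ℝ] E3 := ContinuousLinearMap.id ℝ M3

theorem wedge_self (u : E3) : wedge u u = 0 := by
  simp [wedge]

theorem inner_wedge_self_right (u w : E3) : inner ℝ w (wedge u w) = 0 := by
  rw [inner_E3, wedge_apply_zero, wedge_apply_one, wedge_apply_two]; ring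

theorem wedge_wedge (u v w : E3) :
    wedge (wedge u v) w = (inner ℝ u w : ℝ) • v - (inner ℝ v w : ℝ) • u := by
  apply E3_ext <;>
  simp only [wedge_apply_zero, wedge_apply_one, wedge_apply_two, inner_E3, PiLp.sub_apply,
    PiLp.smul_apply, smul_eq_mul] <;> ring

theorem e_zero : (e 0 : E3) 0 = 1 ∧ (e 0 : E3) 1 = 0 ∧ (e 0 : E3) 2 = 0 := by simp [e]

theorem e_one : (e 1 : E3) 0 = 0 ∧ (e 1 : E3) 1 = 1 ∧ (e 1 : E3) 2 = 0 := by simp [e]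

theorem e_two : (e 2 : E3) 0 = 0 ∧ (e 2 : E3) 1 = 0 ∧ (e 2 : E3) 2 = 1 := by simp [e]

theorem norm_e (i : Fin 3) : ‖e i‖ = 1 := by simp [e]

theorem S_apply (v : E3) : S v 0 = v 1 ∧ S v 1 = - v 0 ∧ S v 2 = 0 := by
  simp [S, ofMatrix_apply]

theorem S_eq_wedge (v : E3) : S v = - wedge (e 2) v := by
  obtain ⟨h0, h1, h2⟩ := S_apply v
  obtain ⟨g0, g1, g2⟩ := e_two
  apply E3_ext <;>
  simp only [PiLp.neg_apply, wedge_apply_zero, wedge_apply_one, wedge_apply_two, h0, h1, h2, g0,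
    g1, g2] <;> ring

theorem S_e_zero : S (e 0) = - e 1 := by
  obtain ⟨h0, h1, h2⟩ := S_apply (e 0)
  obtain ⟨g0, g1, g2⟩ := e_zero
  obtain ⟨k0, k1, k2⟩ := e_one
  apply E3_ext <;> simp only [PiLp.neg_apply, h0, h1, h2, g0, g1, k0, k1, k2, neg_zero]

theorem S_e_one : S (e 1) = e 0 := by
  obtain ⟨h0, h1, h2⟩ := S_apply (e 1)
  obtain ⟨g0, g1, g2⟩ := e_zero
  obtain ⟨k0, k1, k2⟩ := e_one
  apply E3_ext <;> simp only [h0, h1, h2, g0, g1, g2, k0, k1, neg_zero]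

/-- A rotation of `ℝ³`, described as an operator that preserves the inner product and the cross
product. -/
structure IsRot (A : M3) : Prop where
  wedge : ∀ u v, A (wedge u v) = wedge (A u) (A v)
  inner : ∀ u v, inner ℝ (A u) (A v) = (inner ℝ u v : ℝ)

theorem isRot_ofMatrix {A : Matrix (Fin 3) (Fin 3) ℝ}
    (hA : A ∈ Matrix.specialOrthogonalGroup (Fin 3) ℝ) : IsRot (ofMatrix A) := by
  obtain ⟨hO, hdet⟩ := Matrix.mem_specialOrthogonalGroup_iff.1 hA
  have hAt : A.transpose * A = 1 := (Matrix.mem_orthogonalGroup_iff' (Fin 3) ℝ).1 hO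
  have hadj : A.adjugate = A.transpose := by
    have h1 : A * A.adjugate = 1 := by rw [Matrix.mul_adjugate, hdet, one_smul]
    calc A.adjugate = (A.transpose * A) * A.adjugate := by rw [hAt, one_mul]
      _ = A.transpose := by rw [mul_assoc, h1, mul_one]
  have c : ∀ i j, A.adjugate i j = A j i := fun i j => by rw [hadj]; rfl
  rw [Matrix.adjugate_fin_three] at c
  have o : ∀ i j, A 0 i * A 0 j + A 1 i * A 1 j + A 2 i * A 2 j = if i = j then 1 else 0 := by
    intro i j
    have := congrFun (congrFun hAt i) j
    rw [Matrix.mul_apply, Fin.sum_univ_three, Matrix.one_apply] at this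
    exact this
  have c00 := c 0 0
  have c01 := c 0 1
  have c02 := c 0 2
  have c10 := c 1 0
  have c11 := c 1 1
  have c12 := c 1 2
  have c20 := c 2 0
  have c21 := c 2 1
  have c22 := c 2 2
  simp at c00 c01 c02 c10 c11 c12 c20 c21 c22
  refine ⟨fun u v => ?_, fun u v => ?_⟩
  · apply E3_ext <;>
    simp only [wedge_apply_zero, wedge_apply_one, wedge_apply_two, ofMatrix_apply]
    · rw [← c00, ← c10, ← c20]; ring
    · rw [← c01, ← c11, ← c21]; ring
    · rw [← c02, ← c12, ← c22]; ring
  · have o00 := o 0 0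
    have o01 := o 0 1
    have o02 := o 0 2
    have o11 := o 1 1
    have o12 := o 1 2
    have o22 := o 2 2
    simp at o00 o01 o02 o11 o12 o22
    simp only [inner_E3, ofMatrix_apply]
    linear_combination (u 0 * v 0) * o00 + (u 1 * v 1) * o11 + (u 2 * v 2) * o22 +
      (u 0 * v 1 + u 1 * v 0) * o01 + (u 0 * v 2 + u 2 * v 0) * o02 +
      (u 1 * v 2 + u 2 * v 1) * o12

/-- The adjoint, as a continuous linear map on operators of `ℝ³`. -/
def adjL : M3 →L[ℝ] M3 :=
  LinearMap.toContinuousLinearMap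
    { toFun := fun A => ContinuousLinearMap.adjoint A
      map_add' := fun A B => map_add _ A B
      map_smul' := fun c A => by simp }

theorem adjL_apply (A : M3) : adjL A = ContinuousLinearMap.adjoint A := rfl

namespace IsRot

theorem norm_map {A : M3} (hA : IsRot A) (v : E3) : ‖A v‖ = ‖v‖ := by
  rw [@norm_eq_sqrt_real_inner _ _ _ (A v), hA.inner, ← norm_eq_sqrt_real_inner]

theorem adj_apply_apply {A : M3} (hA : IsRot A) (v : E3) : adjL A (A v) = v := by
  refine ext_inner_right ℝ fun w => ?_
  rw [adjL_apply, ContinuousLinearMap.adjoint_inner_left, hA.inner]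

theorem surjective {A : M3} (hA : IsRot A) : Function.Surjective A := by
  have hinj : Function.Injective (A : E3 →ₗ[ℝ] E3) := fun u v h => by
    have h' : A u = A v := h
    rw [← hA.adj_apply_apply u, h', hA.adj_apply_apply]
  exact LinearMap.injective_iff_surjective.1 hinj

theorem apply_adj_apply {A : M3} (hA : IsRot A) (v : E3) : A (adjL A v) = v := by
  obtain ⟨w, rfl⟩ := hA.surjective v
  rw [hA.adj_apply_apply]

end IsRot

theorem S_wedge (u v : E3) : S (wedge u v) = wedge (S u) v + wedge u (S v) := by
  obtain ⟨h0, h1, h2⟩ := S_apply (wedge u v)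
  obtain ⟨g0, g1, g2⟩ := S_apply u
  obtain ⟨k0, k1, k2⟩ := S_apply v
  apply E3_ext <;>
  simp only [PiLp.add_apply, h0, h1, h2, wedge_apply_zero, wedge_apply_one, wedge_apply_two, g0,
    g1, g2, k0, k1, k2] <;> ring

theorem inner_S (u v : E3) : inner ℝ (S u) v + inner ℝ u (S v) = 0 := by
  obtain ⟨g0, g1, g2⟩ := S_apply u
  obtain ⟨k0, k1, k2⟩ := S_apply v
  rw [inner_E3, inner_E3, g0, g1, g2, k0, k1, k2]
  ring

theorem hasDerivAt_exp_smul_apply {V : Type*} [NormedAddCommGroup V] [NormedSpace ℝ V]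
    [CompleteSpace V] (A : V →L[ℝ] V) (v : V) (θ : ℝ) :
    HasDerivAt (fun s : ℝ => NormedSpace.exp (s • A) v) (A (NormedSpace.exp (θ • A) v)) θ := by
  have h := (hasDerivAt_exp_smul_const' (𝕂 := ℝ) A θ).clm_apply (hasDerivAt_const θ v)
  simpa using h

theorem exp_neg_smul_apply {V : Type*} [NormedAddCommGroup V] [NormedSpace ℝ V]
    [CompleteSpace V] (A : V →L[ℝ] V) (v : V) (θ : ℝ) :
    NormedSpace.exp ((-θ) • A) (NormedSpace.exp (θ • A) v) = v := by
  have h : NormedSpace.exp ((-θ) • A) * NormedSpace.exp (θ • A) = 1 := by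
    let : NormedAlgebra ℚ (V →L[ℝ] V) := NormedAlgebra.restrictScalars ℚ ℝ (V →L[ℝ] V)
    rw [← NormedSpace.exp_add_of_commute
      (((Commute.refl A).smul_left (-θ)).smul_right θ), ← add_smul, neg_add_cancel, zero_smul,
      NormedSpace.exp_zero]
  exact congrArg (fun B : V →L[ℝ] V => B v) h

theorem exp_zero_smul_S : NormedSpace.exp ((0 : ℝ) • S) = 1 := by
  have h : (0 : ℝ) • S = 0 := zero_smul ℝ S
  exact (congrArg NormedSpace.exp h).trans NormedSpace.exp_zero

theorem isRot_exp_S (θ : ℝ) : IsRot (NormedSpace.exp (θ • S)) := by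
  refine ⟨fun u v => ?_, fun u v => ?_⟩
  · have h : ∀ x, HasDerivAt (fun s : ℝ => NormedSpace.exp ((-s) • S)
        (wedge (NormedSpace.exp (s • S) u) (NormedSpace.exp (s • S) v))) 0 x := by
      intro x
      have h1 := (wedgeL.hasFDerivAt.comp_hasDerivAt x (hasDerivAt_exp_smul_apply S u x)).clm_apply
        (hasDerivAt_exp_smul_apply S v x)
      have h2 := ((hasDerivAt_exp_smul_const (𝕂 := ℝ) S (-x)).scomp x (hasDerivAt_neg x))
      have h3 := h2.clm_apply h1
      refine h3.congr_deriv ?_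
      set u' := NormedSpace.exp (x • S) u
      set v' := NormedSpace.exp (x • S) v
      change ((-1 : ℝ) • (NormedSpace.exp ((-x) • S) * S)) (wedge u' v') +
        NormedSpace.exp ((-x) • S) (wedge (S u') v' + wedge u' (S v')) = 0
      rw [← S_wedge, smul_apply, neg_one_smul]
      exact neg_add_cancel _
    have hc : NormedSpace.exp ((-θ) • S)
        (wedge (NormedSpace.exp (θ • S) u) (NormedSpace.exp (θ • S) v)) = wedge u v := by
      have := is_const_of_deriv_eq_zero (fun x => (h x).differentiableAt)
        (fun x => (h x).deriv) θ 0
      rw [exp_zero_smul_S, neg_zero, exp_zero_smul_S] at this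
      exact this
    have h4 := exp_neg_smul_apply S (wedge (NormedSpace.exp (θ • S) u)
      (NormedSpace.exp (θ • S) v)) (-θ)
    rw [neg_neg, hc] at h4
    exact h4
  · have h : ∀ x, HasDerivAt (fun s : ℝ => (inner ℝ (NormedSpace.exp (s • S) u)
        (NormedSpace.exp (s • S) v) : ℝ)) 0 x := by
      intro x
      refine ((hasDerivAt_exp_smul_apply S u x).inner ℝ
        (hasDerivAt_exp_smul_apply S v x)).congr_deriv ?_
      rw [add_comm]
      exact inner_S _ _
    have hc := is_const_of_deriv_eq_zero (fun x => (h x).differentiableAt)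
      (fun x => (h x).deriv) θ 0
    rw [exp_zero_smul_S] at hc
    exact hc

/-- The rotation of angle `π` around a unit vector. -/
theorem halfTurn_mem_specialOrthogonalGroup {x y z : ℝ} (h : x ^ 2 + y ^ 2 + z ^ 2 = 1) :
    !![2 * x * x - 1, 2 * x * y, 2 * x * z; 2 * y * x, 2 * y * y - 1, 2 * y * z;
      2 * z * x, 2 * z * y, 2 * z * z - 1] ∈ Matrix.specialOrthogonalGroup (Fin 3) ℝ := by
  refine Matrix.mem_specialOrthogonalGroup_iff.2
    ⟨(Matrix.mem_orthogonalGroup_iff (Fin 3) ℝ).2 ?_, ?_⟩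
  · ext i j
    fin_cases i <;> fin_cases j <;>
      simp [Matrix.mul_apply, Fin.sum_univ_three]
    · linear_combination 4 * x * x * h
    · linear_combination 4 * x * y * h
    · linear_combination 4 * x * z * h
    · linear_combination 4 * x * y * h
    · linear_combination 4 * y * y * h
    · linear_combination 4 * y * z * h
    · linear_combination 4 * x * z * h
    · linear_combination 4 * y * z * h
    · linear_combination 4 * z * z * h
  · rw [Matrix.det_fin_three]
    simp
    linear_combination 2 * h

theorem diagonal_mem_specialOrthogonalGroup {s : ℝ} (h : s ^ 2 = 1) :
    Matrix.diagonal ![1, s, s] ∈ Matrix.specialOrthogonalGroup (Fin 3) ℝ := by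
  refine Matrix.mem_specialOrthogonalGroup_iff.2
    ⟨(Matrix.mem_orthogonalGroup_iff (Fin 3) ℝ).2 ?_, ?_⟩
  · rw [Matrix.diagonal_transpose, Matrix.diagonal_mul_diagonal,
      ← Matrix.diagonal_one]
    congr 1
    ext i
    fin_cases i <;> simp [← pow_two, h]
  · rw [Matrix.det_diagonal, Fin.prod_univ_three]
    simp [← pow_two, h]

theorem ofMatrix_mul (A B : Matrix (Fin 3) (Fin 3) ℝ) :
    ofMatrix (A * B) = ofMatrix A * ofMatrix B := map_mul _ _ _

end Rotations

/-! ### The square wave `ε` and the zigzag `σ` -/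

section Zigzag

variable {T : ℝ}

theorem eps_eq_of_mem (hT : 0 < T) {k : ℤ} {t : ℝ} (h1 : k * T ≤ t) (h2 : t < (k + 1) * T) :
    eps T t = (-1) ^ k := by
  have : ⌊t / T⌋ = k := by
    rw [Int.floor_eq_iff, le_div_iff₀ hT, div_lt_iff₀ hT]
    exact ⟨h1, h2⟩
  rw [eps, this]

theorem eps_eq_or (t : ℝ) : eps T t = 1 ∨ eps T t = -1 := by
  rcases Int.even_or_odd ⌊t / T⌋ with h | h
  · exact Or.inl h.neg_one_zpow
  · exact Or.inr h.neg_one_zpow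

theorem eps_mul_self (t : ℝ) : eps T t * eps T t = 1 := by
  rcases eps_eq_or (T := T) t with h | h <;> rw [h] <;> norm_num

theorem eps_zero : eps T 0 = 1 := by simp [eps]

theorem eps_right (hT : 0 < T) (k : ℤ) : ∀ᶠ s in 𝓝[>] (k * T), eps T s = (-1) ^ k := by
  have h : k * T < (k + 1) * T := by nlinarith
  filter_upwards [Ioo_mem_nhdsGT h] with s hs
  exact eps_eq_of_mem hT hs.1.le hs.2

theorem eps_left (hT : 0 < T) (k : ℤ) : ∀ᶠ s in 𝓝[<] (k * T), eps T s = - (-1) ^ k := by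
  have h : ((k - 1 : ℤ) : ℝ) * T < k * T := by push_cast; nlinarith
  filter_upwards [Ioo_mem_nhdsLT h] with s hs
  rw [eps_eq_of_mem hT hs.1.le (by push_cast; rw [sub_add_cancel]; exact hs.2),
    zpow_sub_one₀ (by norm_num)]
  norm_num

theorem eps_eventually_eq (hT : 0 < T) {t : ℝ} (ht : 0 < t) (hk : ∀ k : ℕ, t ≠ k * T) :
    ∀ᶠ s in 𝓝 t, eps T s = eps T t := by
  have h0 : 0 ≤ ⌊t / T⌋ := Int.floor_nonneg.2 (by positivity)
  obtain ⟨n, hn⟩ := Int.eq_ofNat_of_zero_le h0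
  have h1 := Int.floor_le (t / T)
  have h2 := Int.lt_floor_add_one (t / T)
  rw [le_div_iff₀ hT] at h1
  rw [div_lt_iff₀ hT] at h2
  have h3 : (⌊t / T⌋ : ℝ) * T < t := lt_of_le_of_ne h1 (by
    rw [hn]
    exact_mod_cast (hk n).symm)
  filter_upwards [Ioo_mem_nhds h3 h2] with s hs
  rw [eps_eq_of_mem hT hs.1.le hs.2, eps_eq_of_mem hT h1 h2]

theorem eps_add_self (hT : 0 < T) (t : ℝ) : eps T (t + T) = - eps T t := by
  rw [eps, add_div, div_self hT.ne', Int.floor_add_one, zpow_add_one₀ (by norm_num), eps]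
  ring

theorem measurable_eps : Measurable (eps T) := by
  have h : Measurable fun n : ℤ => ((-1 : ℝ)) ^ n := measurable_from_top
  exact h.comp (Int.measurable_floor.comp (measurable_id.div_const T))

theorem intervalIntegrable_eps (s t : ℝ) : IntervalIntegrable (eps T) volume s t := by
  refine (intervalIntegrable_const (c := (1 : ℝ))).mono_fun measurable_eps.aestronglyMeasurable ?_
  exact Eventually.of_forall fun x => by rcases eps_eq_or (T := T) x with h | h <;> simp [h]

theorem sigma_zero : sigma T 0 = 0 := intervalIntegral.integral_same

theorem sigma_sub (s t : ℝ) : sigma T t - sigma T s = ∫ x in s..t, eps T x :=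
  intervalIntegral.integral_interval_sub_left (intervalIntegrable_eps _ _)
    (intervalIntegrable_eps _ _)

theorem abs_sigma_sub_le (s t : ℝ) : |sigma T t - sigma T s| ≤ |t - s| := by
  rw [sigma_sub]
  have := intervalIntegral.norm_integral_le_of_norm_le_const (a := s) (b := t) (f := eps T) (C := 1)
    (fun x _ => by rcases eps_eq_or (T := T) x with h | h <;> simp [h])
  rwa [one_mul] at this

theorem hasDerivAt_sigma (hT : 0 < T) {t : ℝ} (ht : 0 < t) (hk : ∀ k : ℕ, t ≠ k * T) :
    HasDerivAt (sigma T) (eps T t) t := by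
  refine intervalIntegral.integral_hasDerivAt_right (intervalIntegrable_eps _ _)
    measurable_eps.aestronglyMeasurable.stronglyMeasurableAtFilter ?_
  exact continuousAt_const.congr ((eps_eventually_eq hT ht hk).mono fun s hs => hs.symm)

theorem sigma_eq_self (hT : 0 < T) {t : ℝ} (h0 : 0 ≤ t) (h1 : t ≤ T) : sigma T t = t := by
  have : ∫ x in (0 : ℝ)..t, eps T x = ∫ x in (0 : ℝ)..t, (1 : ℝ) := by
    refine intervalIntegral.integral_congr_ae ?_
    filter_upwards [Measure.ae_ne volume T] with x hx hxI
    rw [Set.uIoc_of_le h0] at hxI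
    have := eps_eq_of_mem (k := 0) hT (t := x) (by simpa using hxI.1.le)
      (by simpa using lt_of_le_of_ne (hxI.2.trans h1) hx)
    simpa using this
  rw [sigma, this]
  simp

theorem sigma_periodic (hT : 0 < T) : Function.Periodic (sigma T) (2 * T) := by
  intro t
  have h1 : ∫ x in t..t + 2 * T, eps T x = 0 := by
    rw [← intervalIntegral.integral_add_adjacent_intervals (intervalIntegrable_eps t (t + T))
      (intervalIntegrable_eps (t + T) (t + 2 * T))]
    have h2 : ∫ x in t..t + T, eps T (x + T) = ∫ x in t + T..t + T + T, eps T x :=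
      intervalIntegral.integral_comp_add_right (eps T) T
    rw [show t + 2 * T = t + T + T by ring, ← h2]
    simp_rw [eps_add_self hT]
    rw [intervalIntegral.integral_neg, add_neg_cancel]
  rw [← sigma_sub] at h1
  exact sub_eq_zero.1 h1

theorem sigma_nat_mul_add (hT : 0 < T) (k : ℕ) (s : ℝ) :
    sigma T (k * (2 * T) + s) = sigma T s := by
  rw [add_comm]
  exact (sigma_periodic hT).nat_mul k s

theorem abs_sigma_le (hT : 0 < T) (t : ℝ) : |sigma T t| ≤ 2 * T := by
  obtain ⟨s, hs, h⟩ := (sigma_periodic hT).exists_mem_Ico₀ (by linarith) t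
  rw [h]
  have h1 := abs_sigma_sub_le (T := T) 0 s
  rw [sigma_zero, sub_zero, sub_zero, abs_of_nonneg hs.1] at h1
  exact h1.trans hs.2.le

theorem continuous_sigma : Continuous (sigma T) := by
  refine continuous_iff_continuousAt.2 fun t => ?_
  rw [ContinuousAt, tendsto_iff_norm_sub_tendsto_zero]
  refine squeeze_zero (fun s => norm_nonneg _) (fun s => abs_sigma_sub_le t s) ?_
  have : Continuous fun s : ℝ => |s - t| := by fun_prop
  simpa using this.tendsto t

theorem ofMatrix_diagonal_apply (c : ℝ) (v : E3) :
    ofMatrix (Matrix.diagonal ![1, c, c]) v = v 0 • e 0 + (c * v 1) • e 1 + (c * v 2) • e 2 := by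
  obtain ⟨g0, g1, g2⟩ := e_zero
  obtain ⟨k0, k1, k2⟩ := e_one
  obtain ⟨l0, l1, l2⟩ := e_two
  apply E3_ext <;> rw [ofMatrix_apply] <;>
  simp [g0, g1, g2, k0, k1, k2, l0, l1, l2]

theorem diagonal_apply_diagonal_apply {c d : ℝ} (v : E3) :
    ofMatrix (Matrix.diagonal ![1, c, c]) (ofMatrix (Matrix.diagonal ![1, d, d]) v) =
      ofMatrix (Matrix.diagonal ![1, c * d, c * d]) v := by
  apply E3_ext <;> simp [ofMatrix_apply, mul_assoc]

theorem diagonal_one_apply (v : E3) : ofMatrix (Matrix.diagonal ![1, (1 : ℝ), 1]) v = v := by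
  apply E3_ext <;> simp [ofMatrix_apply]

theorem rotE1_pi_eq : rotE1 Real.pi = ofMatrix (Matrix.diagonal ![1, (-1 : ℝ), -1]) := by
  refine ContinuousLinearMap.ext fun v => ?_
  apply E3_ext <;> simp [rotE1, ofMatrix_apply]

end Zigzag

/-! ### Frames -/

section Frames

variable {a b : ℝ} [hab : Fact (a < b)]

theorem norm_rep_of_sphereValued {f : H1 a b E3} (hf : SphereValued f) :
    ∀ x ∈ Set.Icc a b, ‖rep f x‖ = 1 :=
  eqOn_of_ae_eq hab.out (continuousOn_rep f).norm continuousOn_const (by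
    filter_upwards [hf, profile_ae_eq f] with x h1 h2
    rw [← h2, h1])

theorem isRot_rep_of_isFrame {Mf : H1 a b E3} {R : H1 a b M3} (hR : IsFrame Mf R) :
    ∀ x ∈ Set.Icc a b, IsRot (rep R x) := by
  have hrot : ∀ᵐ x ∂(intervalMeasure a b), IsRot (rep R x) := by
    filter_upwards [hR.1, profile_ae_eq R] with x ⟨A, hA, hx⟩ h2
    rw [← h2, hx]
    exact isRot_ofMatrix hA
  have hc : ∀ v, ContinuousOn (fun x => rep R x v) (Set.Icc a b) := fun v =>
    (continuousOn_rep R).clm_apply continuousOn_const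
  intro x hx
  refine ⟨fun u v => ?_, fun u v => ?_⟩
  · refine eqOn_of_ae_eq hab.out (hc (wedge u v))
      (v := fun x => wedgeL (rep R x u) (rep R x v)) ?_ ?_ x hx
    · exact (wedgeL.continuous.comp_continuousOn (hc u)).clm_apply (hc v)
    · filter_upwards [hrot] with y hy
      exact hy.wedge u v
  · refine eqOn_of_ae_eq hab.out (u := fun x => (inner ℝ (rep R x u) (rep R x v) : ℝ))
      (v := fun _ => inner ℝ u v) ((hc u).inner (hc v)) continuousOn_const ?_ x hx
    filter_upwards [hrot] with y hy
    exact hy.inner u v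

theorem rep_apply_of_isFrame {Mf : H1 a b E3} {R : H1 a b M3} (hR : IsFrame Mf R) :
    ∀ x ∈ Set.Icc a b, rep R x (rep Mf x) = - e 2 :=
  eqOn_of_ae_eq hab.out ((continuousOn_rep R).clm_apply (continuousOn_rep Mf))
    continuousOn_const (by
      filter_upwards [hR.2, profile_ae_eq R, profile_ae_eq Mf] with x h1 h2 h3
      rw [← h2, ← h3, h1])

theorem inner_rep_ne_zero {Mf : H1 a b E3} (h : AvoidsEquator Mf) :
    ∀ x ∈ Set.Icc a b, (inner ℝ (rep Mf x) (e 2) : ℝ) ≠ 0 :=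
  h (rep Mf) (continuousOn_rep Mf) (profile_ae_eq Mf)

theorem exists_sign {f : ℝ → ℝ} (hf : ContinuousOn f (Set.Icc a b))
    (h : ∀ x ∈ Set.Icc a b, f x ≠ 0) :
    ∃ s : ℝ, s ^ 2 = 1 ∧ ∀ x ∈ Set.Icc a b, s * f x < 0 := by
  have ha : a ∈ Set.Icc a b := Set.left_mem_Icc.2 hab.out.le
  have hsame : ∀ x ∈ Set.Icc a b, 0 < f a * f x := by
    intro x hx
    by_contra hc
    rw [not_lt] at hc
    have hsub : Set.Icc a x ⊆ Set.Icc a b := Set.Icc_subset_Icc_right hx.2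
    have hne := h a ha
    rcases lt_or_gt_of_ne hne with hlt | hgt
    · obtain ⟨y, hy, hy0⟩ := intermediate_value_Icc hx.1 (hf.mono hsub)
        (show (0 : ℝ) ∈ Set.Icc (f a) (f x) from ⟨hlt.le, by nlinarith⟩)
      exact h y (hsub hy) hy0
    · obtain ⟨y, hy, hy0⟩ := intermediate_value_Icc' hx.1 (hf.mono hsub)
        (show (0 : ℝ) ∈ Set.Icc (f x) (f a) from ⟨by nlinarith, hgt.le⟩)
      exact h y (hsub hy) hy0
  rcases lt_or_gt_of_ne (h a ha) with hlt | hgt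
  · refine ⟨1, by norm_num, fun x hx => ?_⟩
    have := hsame x hx
    nlinarith
  · refine ⟨-1, by norm_num, fun x hx => ?_⟩
    have := hsame x hx
    nlinarith

/-- The half-turn around a nonzero vector `w` is `v ↦ 2 ⟨w, v⟩ w / |w|² - v`. -/
theorem exists_mem_specialOrthogonalGroup_halfTurn {w : E3} (hw : w ≠ 0) :
    ∃ A ∈ Matrix.specialOrthogonalGroup (Fin 3) ℝ, ∀ v,
      ofMatrix A v = (2 * (inner ℝ w w)⁻¹ * inner ℝ w v) • w - v := by
  have hc : 0 < (inner ℝ w w : ℝ) := real_inner_self_pos.2 hw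
  have hcw : (inner ℝ w w : ℝ) = _ := inner_E3 w w
  set c := (inner ℝ w w : ℝ) with hcdef
  have hq : √c * √c = c := Real.mul_self_sqrt hc.le
  have hunit : (w 0 / √c) ^ 2 + (w 1 / √c) ^ 2 + (w 2 / √c) ^ 2 = 1 := by
    rw [div_pow, div_pow, div_pow, pow_two √c, hq, ← add_div, ← add_div, div_eq_one_iff_eq hc.ne']
    linarith
  refine ⟨_, halfTurn_mem_specialOrthogonalGroup hunit, fun v => ?_⟩
  have hdiv : ∀ i j, 2 * (w i / √c) * (w j / √c) = 2 * c⁻¹ * (w i * w j) := fun i j => by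
    rw [mul_assoc, div_mul_div_comm, hq, div_eq_inv_mul, mul_assoc]
  have hv := inner_E3 w v
  apply E3_ext <;>
  simp only [ofMatrix_apply, PiLp.sub_apply, PiLp.smul_apply, smul_eq_mul, hv,
    Matrix.of_apply, Matrix.cons_val_zero, Matrix.cons_val_one, Matrix.cons_val, hdiv] <;>
  ring

theorem exists_halfTurn (w : H1 a b E3) (hw : ∀ x ∈ Set.Icc a b, rep w x ≠ 0) :
    ∃ R : H1 a b M3, ∀ x ∈ Set.Icc a b, ∀ v, rep R x v =
      (2 * (inner ℝ (rep w x) (rep w x))⁻¹ * inner ℝ (rep w x) v) • rep w x - v := by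
  have hww : ∀ x ∈ Set.Icc a b, rep (bilin innerL w w) x = inner ℝ (rep w x) (rep w x) :=
    fun x hx => rep_bilin _ _ _ hx
  obtain ⟨g, hg⟩ := exists_inv (bilin innerL w w) (fun x hx => by
    rw [hww x hx]; exact (real_inner_self_pos.2 (hw x hx)).ne')
  obtain ⟨u, hu⟩ : ∃ u : H1 a b E3, ∀ x ∈ Set.Icc a b,
      rep u x = (2 * (inner ℝ (rep w x) (rep w x))⁻¹) • rep w x := by
    refine ⟨(2 : ℝ) • bilin (ContinuousLinearMap.lsmul ℝ ℝ) g w, fun x hx => ?_⟩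
    rw [rep_smul _ _ x hx, rep_bilin _ _ _ hx, hg x hx, hww x hx, mul_smul]
    rfl
  obtain ⟨R₁, hR₁⟩ : ∃ R₁ : H1 a b M3, ∀ x ∈ Set.Icc a b,
      rep R₁ x = rankOneL (rep w x) (rep u x) := ⟨bilin rankOneL w u, fun x hx => rep_bilin _ _ _ hx⟩
  obtain ⟨I, hI⟩ : ∃ I : H1 a b M3, ∀ x ∈ Set.Icc a b, rep I x = 1 :=
    ⟨constH 1, fun x hx => rep_constH _ hx⟩
  refine ⟨R₁ - I, fun x hx v => ?_⟩
  have h3 : rep (R₁ - I) x = rankOneL (rep w x) (rep u x) - 1 := by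
    rw [← hR₁ x hx, ← hI x hx]
    exact rep_sub R₁ I hx
  have h4 : rep (R₁ - I) x v = (inner ℝ (rep w x) v : ℝ) • rep u x - v :=
    congrArg (fun A : M3 => A v) h3
  rw [h4, hu x hx, smul_smul, mul_comm]

/-- Composition on the left with a fixed operator. -/
def leftMulL (D : M3) : M3 →L[ℝ] M3 :=
  LinearMap.toContinuousLinearMap
    { toFun := fun A => D.comp A
      map_add' := fun A B => D.comp_add A B
      map_smul' := fun c A => D.comp_smul c A }

theorem leftMulL_apply (D A : M3) : leftMulL D A = D * A := rfl

/-- Frames exist. If `s = ±1` is the sign opposite to that of `⟨M_f, e₃⟩`, the half-turn around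
`M_f - s e₃` maps `M_f` to `- s e₃`, and `diag(1, s, s)` maps `- s e₃` to `- e₃`. -/
theorem exists_isFrame {Mf : H1 a b E3} (hMf : SphereValued Mf) (heq : AvoidsEquator Mf) :
    ∃ R : H1 a b M3, IsFrame Mf R := by
  obtain ⟨s, hs, hneg⟩ := exists_sign
    (f := fun x => (inner ℝ (rep Mf x) (e 2) : ℝ))
    ((continuousOn_rep Mf).inner continuousOn_const) (inner_rep_ne_zero heq)
  set w : H1 a b E3 := Mf - constH (s • e 2) with hw
  have hwx : ∀ x ∈ Set.Icc a b, rep w x = rep Mf x - s • e 2 := fun x hx => by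
    rw [hw, rep_sub _ _ hx, rep_constH _ hx]
  have hm : ∀ x ∈ Set.Icc a b, (inner ℝ (rep Mf x) (rep Mf x) : ℝ) = 1 := fun x hx => by
    rw [real_inner_self_eq_norm_sq, norm_rep_of_sphereValued hMf x hx]; norm_num
  have he : (inner ℝ (e 2) (e 2) : ℝ) = 1 := by
    rw [real_inner_self_eq_norm_sq, norm_e]; norm_num
  have hww : ∀ x ∈ Set.Icc a b, (inner ℝ (rep w x) (rep w x) : ℝ) =
      2 - 2 * (s * inner ℝ (rep Mf x) (e 2)) := by
    intro x hx
    rw [hwx x hx, inner_sub_left, inner_sub_right, inner_sub_right, real_inner_smul_left,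
      real_inner_smul_right, real_inner_smul_left, real_inner_smul_right, hm x hx, he,
      real_inner_comm]
    linear_combination hs
  have hwm : ∀ x ∈ Set.Icc a b, (inner ℝ (rep w x) (rep Mf x) : ℝ) =
      1 - s * inner ℝ (rep Mf x) (e 2) := by
    intro x hx
    rw [hwx x hx, inner_sub_left, real_inner_smul_left, hm x hx, real_inner_comm]
  have hw0 : ∀ x ∈ Set.Icc a b, rep w x ≠ 0 := fun x hx h0 => by
    have h1 := hww x hx
    rw [h0, inner_zero_left] at h1
    have := hneg x hx
    linarith
  obtain ⟨R₀, hR₀⟩ := exists_halfTurn w hw0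
  set D : M3 := ofMatrix (Matrix.diagonal ![1, s, s]) with hD
  have hRx : ∀ x ∈ Set.Icc a b, rep (compL (leftMulL D) R₀) x = D * rep R₀ x := fun x hx => by
    rw [rep_compL _ _ hx, leftMulL_apply]
  refine ⟨compL (leftMulL D) R₀, ?_, ?_⟩
  · filter_upwards [profile_ae_eq (compL (leftMulL D) R₀), ae_restrict_mem measurableSet_Ioo]
      with x h2 hx
    have hx' := Set.Ioo_subset_Icc_self hx
    obtain ⟨A, hA, hAv⟩ := exists_mem_specialOrthogonalGroup_halfTurn (hw0 x hx')
    refine ⟨_, mul_mem (diagonal_mem_specialOrthogonalGroup hs) hA, ?_⟩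
    rw [h2, hRx x hx', ofMatrix_mul]
    congr 1
    refine ContinuousLinearMap.ext fun v => ?_
    rw [hR₀ x hx' v, hAv]
  · filter_upwards [profile_ae_eq (compL (leftMulL D) R₀), profile_ae_eq Mf,
      ae_restrict_mem measurableSet_Ioo] with x h2 h4 hx
    have hx' := Set.Ioo_subset_Icc_self hx
    have h5 : rep R₀ x (rep Mf x) = - (s • e 2) := by
      have hc := hneg x hx'
      rw [hR₀ x hx', hww x hx', hwm x hx']
      have : 2 * (2 - 2 * (s * inner ℝ (rep Mf x) (e 2)))⁻¹ *
          (1 - s * inner ℝ (rep Mf x) (e 2)) = 1 := by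
        have : (1 - s * inner ℝ (rep Mf x) (e 2)) ≠ 0 := by linarith
        rw [show 2 - 2 * (s * inner ℝ (rep Mf x) (e 2)) =
          2 * (1 - s * inner ℝ (rep Mf x) (e 2)) by ring]
        field_simp
      rw [this, one_smul, hwx x hx']
      abel
    obtain ⟨l0, l1, l2⟩ := e_two
    rw [h2, h4, hRx x hx']
    change D (rep R₀ x (rep Mf x)) = _
    rw [h5, map_neg, map_smul, hD, ofMatrix_diagonal_apply, l0, l1, l2]
    simp only [zero_smul, mul_zero, zero_add, mul_one, smul_smul]
    rw [← pow_two, hs, one_smul]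

end Frames

/-! ### Abstract ensembles of spins -/

theorem exp_hasSum_apply {V : Type*} [NormedAddCommGroup V] [NormedSpace ℝ V] [CompleteSpace V]
    (A : V →L[ℝ] V) (v : V) :
    HasSum (fun n : ℕ => ((n.factorial : ℝ))⁻¹ • (A ^ n) v) (NormedSpace.exp A v) := by
  have h := NormedSpace.exp_series_hasSum_exp' (𝕂 := ℝ) A
  exact h.mapL (ContinuousLinearMap.apply ℝ V v)

theorem exp_intertwine {V V' : Type*} [NormedAddCommGroup V] [NormedSpace ℝ V] [CompleteSpace V]
    [NormedAddCommGroup V'] [NormedSpace ℝ V'] [CompleteSpace V'] (L : V →L[ℝ] V')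
    (A : V →L[ℝ] V) (B : V' →L[ℝ] V') (h : ∀ v, L (A v) = B (L v)) (v : V) :
    L (NormedSpace.exp A v) = NormedSpace.exp B (L v) := by
  have hpow : ∀ (n : ℕ) (v : V), L ((A ^ n) v) = (B ^ n) (L v) := by
    intro n
    induction n with
    | zero => intro v; rfl
    | succ n ih =>
      intro v
      rw [pow_succ, pow_succ]
      change L ((A ^ n) (A v)) = (B ^ n) (B (L v))
      rw [ih, h]
  have h1 := (exp_hasSum_apply A v).mapL L
  have h2 := exp_hasSum_apply B (L v)
  refine h1.unique ?_
  convert h2 using 2 with n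
  rw [map_smul, hpow]

/-- The one-parameter group `exp(s A)` generated by a bounded operator. -/
def expOp {V : Type*} [NormedAddCommGroup V] [NormedSpace ℝ V] (A : V →L[ℝ] V) (s : ℝ) :
    V →L[ℝ] V := NormedSpace.exp (s • A)

theorem map_expOp {V V' : Type*} [NormedAddCommGroup V] [NormedSpace ℝ V] [CompleteSpace V]
    [NormedAddCommGroup V'] [NormedSpace ℝ V'] [CompleteSpace V'] (L : V →L[ℝ] V')
    (A : V →L[ℝ] V) (B : V' →L[ℝ] V') {r : ℝ} (h : ∀ v, L (A v) = r • B (L v)) (s : ℝ) (v : V) :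
    L (expOp A s v) = expOp B (s * r) (L v) := by
  refine exp_intertwine L (s • A) ((s * r) • B) (fun v => ?_) v
  rw [smul_apply, smul_apply, map_smul, h, smul_smul]

/-- The algebra behind the transformation of the Bloch equation, over an arbitrary Hilbert
space of states: a bilinear cross product `cross`, the free generator `gen` (standing for
`M ↦ ω S M`), an invertible operator `rot` (standing for `R(ω)`), the rotation `flip` of angle
`π`, the control directions `axis` and the target state `target`. -/
structure SpinModel (V : Type*) [NormedAddCommGroup V] [InnerProductSpace ℝ V] where
  cross : V →L[ℝ] V →L[ℝ] V
  gen : V →L[ℝ] V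
  rot : V →L[ℝ] V
  rotInv : V →L[ℝ] V
  flip : V →L[ℝ] V
  axis : Fin 2 → V
  target : V
  rotInv_rot : ∀ v, rotInv (rot v) = v
  rot_rotInv : ∀ v, rot (rotInv v) = v
  rot_cross : ∀ u v, rot (cross u v) = cross (rot u) (rot v)
  exp_cross : ∀ s u v, expOp gen s (cross u v) = cross (expOp gen s u) (expOp gen s v)
  flip_flip : ∀ v, flip (flip v) = v
  flip_cross : ∀ u v, flip (cross u v) = cross (flip u) (flip v)
  flip_gen : ∀ v, flip (gen v) = - gen (flip v)
  flip_axis_zero : flip (axis 0) = axis 0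
  flip_axis_one : flip (axis 1) = - axis 1

namespace SpinModel

variable {V : Type*} [NormedAddCommGroup V] [InnerProductSpace ℝ V] [CompleteSpace V]
  (𝔐 : SpinModel V)

/-- The free evolution in the rotating frame, `exp(s ω S)`. -/
def free (s : ℝ) : V →L[ℝ] V := expOp 𝔐.gen s

theorem free_zero (v : V) : 𝔐.free 0 v = v := by
  rw [free, expOp, zero_smul, NormedSpace.exp_zero]
  rfl

theorem free_neg_free (s : ℝ) (v : V) : 𝔐.free (-s) (𝔐.free s v) = v :=
  exp_neg_smul_apply 𝔐.gen v s

theorem free_free_neg (s : ℝ) (v : V) : 𝔐.free s (𝔐.free (-s) v) = v := by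
  have := 𝔐.free_neg_free (-s) v
  rwa [neg_neg] at this

theorem hasDerivAt_free (s : ℝ) : HasDerivAt 𝔐.free (𝔐.free s * 𝔐.gen) s :=
  hasDerivAt_exp_smul_const (𝕂 := ℝ) 𝔐.gen s

theorem hasDerivAt_free' (s : ℝ) : HasDerivAt 𝔐.free (𝔐.gen * 𝔐.free s) s :=
  hasDerivAt_exp_smul_const' (𝕂 := ℝ) 𝔐.gen s

theorem continuous_free : Continuous 𝔐.free :=
  continuous_iff_continuousAt.2 fun s => (𝔐.hasDerivAt_free s).continuousAt

theorem exists_free_bound (c : ℝ) : ∃ C, 0 ≤ C ∧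
    ∀ s ∈ Set.Icc (-c) c, ‖𝔐.free s‖ ≤ C ∧
      ∀ t ∈ Set.Icc (-c) c, ‖𝔐.free s - 𝔐.free t‖ ≤ C * |s - t| := by
  obtain ⟨C, hC⟩ := (isCompact_Icc (a := -c) (b := c)).exists_bound_of_continuousOn
    𝔐.continuous_free.continuousOn
  obtain ⟨C', hC'⟩ := (isCompact_Icc (a := -c) (b := c)).exists_bound_of_continuousOn
    (f := fun s => 𝔐.free s * 𝔐.gen) (𝔐.continuous_free.mul continuous_const).continuousOn
  refine ⟨max 0 (max C C'), le_max_left _ _, fun s hs =>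
    ⟨(hC s hs).trans ((le_max_left _ _).trans (le_max_right _ _)), fun t ht => ?_⟩⟩
  exact (convex_Icc (-c) c).norm_image_sub_le_of_norm_hasDerivWithin_le
    (fun x _ => (𝔐.hasDerivAt_free x).hasDerivWithinAt)
    (fun x hx => (hC' x hx).trans ((le_max_right _ _).trans (le_max_right _ _))) ht hs

/-- The vector field `F(t, ω) e_i`. -/
def frameField (T : ℝ) (i : Fin 2) (t : ℝ) : V := 𝔐.rot (𝔐.free (sigma T t) (𝔐.axis i))

/-- The operators `N ↦ (F(t, ·) e_i) ∧ N`. -/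
def controlOp (T : ℝ) (i : Fin 2) (t : ℝ) : V →L[ℝ] V := 𝔐.cross (𝔐.frameField T i t)

theorem exists_controlOp_bound {T : ℝ} (hT : 0 < T) : ∃ K,
    (∀ i t, ‖𝔐.controlOp T i t‖ ≤ K) ∧
      ∀ i s t, ‖𝔐.controlOp T i s - 𝔐.controlOp T i t‖ ≤ K * |s - t| := by
  obtain ⟨C, hC0, hC⟩ := 𝔐.exists_free_bound (2 * T)
  have hσ : ∀ t, sigma T t ∈ Set.Icc (-(2 * T)) (2 * T) := fun t => abs_le.1 (abs_sigma_le hT t)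
  set w := ‖𝔐.cross‖ with hw
  set c := ∑ i : Fin 2, ‖𝔐.axis i‖ with hc
  have hci : ∀ i : Fin 2, ‖𝔐.axis i‖ ≤ c := fun i =>
    Finset.single_le_sum (f := fun i : Fin 2 => ‖𝔐.axis i‖)
      (fun j _ => norm_nonneg _) (Finset.mem_univ i)
  have hw0 : 0 ≤ w := ContinuousLinearMap.opNorm_nonneg _
  have hc0 : 0 ≤ c := (norm_nonneg _).trans (hci 0)
  have hm0 : 0 ≤ ‖𝔐.rot‖ := ContinuousLinearMap.opNorm_nonneg _
  refine ⟨w * (‖𝔐.rot‖ * (C * c)), fun i t => ?_, fun i s t => ?_⟩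
  · refine (𝔐.cross.le_opNorm _).trans ?_
    gcongr
    refine (𝔐.rot.le_opNorm _).trans ?_
    gcongr
    refine ((𝔐.free _).le_opNorm _).trans ?_
    have h1 := (hC _ (hσ t)).1
    have h2 := hci i
    gcongr
  · have e1 : 𝔐.controlOp T i s - 𝔐.controlOp T i t = 𝔐.cross (𝔐.rot
        ((𝔐.free (sigma T s) - 𝔐.free (sigma T t)) (𝔐.axis i))) := by
      rw [controlOp, controlOp, ← map_sub, frameField, frameField, ← map_sub]
      rfl
    rw [e1]
    have h1 : ‖𝔐.free (sigma T s) - 𝔐.free (sigma T t)‖ ≤ C * |s - t| :=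
      ((hC _ (hσ s)).2 _ (hσ t)).trans (mul_le_mul_of_nonneg_left (abs_sigma_sub_le t s) hC0)
    have h2 := hci i
    calc _ ≤ w * (‖𝔐.rot‖ * ((C * |s - t|) * c)) := by
          refine (𝔐.cross.le_opNorm _).trans ?_
          gcongr
          refine (𝔐.rot.le_opNorm _).trans ?_
          gcongr
          refine (ContinuousLinearMap.le_opNorm _ _).trans ?_
          gcongr
      _ = _ := by ring

theorem continuous_controlOp (T : ℝ) (i : Fin 2) : Continuous (𝔐.controlOp T i) := by
  unfold controlOp frameField
  exact 𝔐.cross.continuous.comp (𝔐.rot.continuous.comp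
    ((𝔐.continuous_free.comp continuous_sigma).clm_apply continuous_const))

theorem controlOp_periodic {T : ℝ} (hT : 0 < T) (i : Fin 2) (k : ℕ) (s : ℝ) :
    𝔐.controlOp T i (k * (2 * T) + s) = 𝔐.controlOp T i s := by
  unfold controlOp frameField
  rw [sigma_nat_mul_add hT]

/-- The operator `diag(1, ε, ε)`, for a sign `ε`. -/
def signOp (ε : ℝ) : V →L[ℝ] V :=
  ((1 + ε) / 2) • ContinuousLinearMap.id ℝ V + ((1 - ε) / 2) • 𝔐.flip

theorem signOp_one (v : V) : 𝔐.signOp 1 v = v := by simp [signOp]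

theorem signOp_neg_one (v : V) : 𝔐.signOp (-1) v = 𝔐.flip v := by simp [signOp]

variable {ε : ℝ}

theorem signOp_signOp (h : ε = 1 ∨ ε = -1) (v : V) : 𝔐.signOp ε (𝔐.signOp ε v) = v := by
  rcases h with rfl | rfl
  · rw [signOp_one, signOp_one]
  · rw [signOp_neg_one, signOp_neg_one, 𝔐.flip_flip]

theorem signOp_neg (h : ε = 1 ∨ ε = -1) (v : V) : 𝔐.signOp (-ε) v = 𝔐.flip (𝔐.signOp ε v) := by
  rcases h with rfl | rfl
  · rw [signOp_neg_one, signOp_one]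
  · rw [neg_neg, signOp_neg_one, signOp_one, 𝔐.flip_flip]

theorem signOp_cross (h : ε = 1 ∨ ε = -1) (u v : V) :
    𝔐.signOp ε (𝔐.cross u v) = 𝔐.cross (𝔐.signOp ε u) (𝔐.signOp ε v) := by
  rcases h with rfl | rfl
  · simp only [signOp_one]
  · simp only [signOp_neg_one, 𝔐.flip_cross]

theorem signOp_gen (h : ε = 1 ∨ ε = -1) (v : V) :
    𝔐.signOp ε (𝔐.gen v) = ε • 𝔐.gen (𝔐.signOp ε v) := by
  rcases h with rfl | rfl
  · simp only [signOp_one, one_smul]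
  · simp only [signOp_neg_one, 𝔐.flip_gen, neg_smul, one_smul]

theorem signOp_axis_zero (h : ε = 1 ∨ ε = -1) : 𝔐.signOp ε (𝔐.axis 0) = 𝔐.axis 0 := by
  rcases h with rfl | rfl
  · rw [signOp_one]
  · rw [signOp_neg_one, 𝔐.flip_axis_zero]

theorem signOp_axis_one (h : ε = 1 ∨ ε = -1) : 𝔐.signOp ε (𝔐.axis 1) = ε • 𝔐.axis 1 := by
  rcases h with rfl | rfl
  · rw [signOp_one, one_smul]
  · rw [signOp_neg_one, 𝔐.flip_axis_one, neg_smul, one_smul]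

theorem rotInv_cross (u v : V) :
    𝔐.rotInv (𝔐.cross u v) = 𝔐.cross (𝔐.rotInv u) (𝔐.rotInv v) := by
  rw [← 𝔐.rotInv_rot (𝔐.cross (𝔐.rotInv u) (𝔐.rotInv v)), 𝔐.rot_cross, 𝔐.rot_rotInv,
    𝔐.rot_rotInv]

theorem free_cross (s : ℝ) (u v : V) :
    𝔐.free s (𝔐.cross u v) = 𝔐.cross (𝔐.free s u) (𝔐.free s v) := 𝔐.exp_cross s u v

/-- The transformation `M ↦ N = R exp(σ(t) ω S) P(t) M`. -/
def toRot (T t : ℝ) : V →L[ℝ] V := 𝔐.rot * (𝔐.free (sigma T t) * 𝔐.signOp (eps T t))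

/-- The inverse transformation `N ↦ M`. -/
def ofRot (T t : ℝ) : V →L[ℝ] V := 𝔐.signOp (eps T t) * (𝔐.free (-sigma T t) * 𝔐.rotInv)

theorem toRot_apply (T t : ℝ) (v : V) :
    𝔐.toRot T t v = 𝔐.rot (𝔐.free (sigma T t) (𝔐.signOp (eps T t) v)) := rfl

theorem ofRot_apply (T t : ℝ) (v : V) :
    𝔐.ofRot T t v = 𝔐.signOp (eps T t) (𝔐.free (-sigma T t) (𝔐.rotInv v)) := rfl

theorem ofRot_toRot (T t : ℝ) (v : V) : 𝔐.ofRot T t (𝔐.toRot T t v) = v := by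
  rw [toRot_apply, ofRot_apply, 𝔐.rotInv_rot, free_neg_free, signOp_signOp _ (eps_eq_or t)]

theorem toRot_ofRot (T t : ℝ) (v : V) : 𝔐.toRot T t (𝔐.ofRot T t v) = v := by
  rw [toRot_apply, ofRot_apply, signOp_signOp _ (eps_eq_or t), free_free_neg, 𝔐.rot_rotInv]

/-- The Bloch vector field `(v₁ e₁ + v₂ e₂ + ω e₃) ∧ M`. -/
def blochField (v₁ v₂ : ℝ) (M : V) : V :=
  𝔐.cross (v₁ • 𝔐.axis 0 + v₂ • 𝔐.axis 1) M - 𝔐.gen M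

variable {T t : ℝ}

/-- The transformation removes the drift: the free precession is absorbed by `exp(σ(t) ω S)`,
since `diag(1, ε, ε)` commutes with `ω S` up to the sign `ε = σ'`. -/
theorem hasDerivAt_toRot (hT : 0 < T) (ht : 0 < t) (hk : ∀ k : ℕ, t ≠ k * T) {M : ℝ → V}
    {v₁ v₂ : ℝ} (h : HasDerivAt M (𝔐.blochField v₁ v₂ (M t)) t) :
    HasDerivAt (fun s => 𝔐.toRot T s (M s))
      (v₁ • 𝔐.controlOp T 0 t (𝔐.toRot T t (M t)) +
        (eps T t * v₂) • 𝔐.controlOp T 1 t (𝔐.toRot T t (M t))) t := by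
  have hε := eps_eq_or (T := T) t
  have h1 : HasDerivAt (fun s => 𝔐.free (sigma T s))
      (eps T t • (𝔐.free (sigma T t) * 𝔐.gen)) t :=
    (𝔐.hasDerivAt_free (sigma T t)).scomp t (hasDerivAt_sigma hT ht hk)
  have h2 := (𝔐.rot.hasFDerivAt.comp_hasDerivAt t (h1.clm_apply
    ((𝔐.signOp (eps T t)).hasFDerivAt.comp_hasDerivAt t h)))
  have he : (fun s => 𝔐.toRot T s (M s)) =ᶠ[𝓝 t] fun s =>
      𝔐.rot (𝔐.free (sigma T s) (𝔐.signOp (eps T t) (M s))) := by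
    filter_upwards [eps_eventually_eq hT ht hk] with s hs
    rw [toRot_apply, hs]
  have h3 := h2.congr_of_eventuallyEq he
  convert h3 using 1
  have e1 : (eps T t • (𝔐.free (sigma T t) * 𝔐.gen)) (𝔐.signOp (eps T t) (M t)) =
      𝔐.free (sigma T t) (eps T t • 𝔐.gen (𝔐.signOp (eps T t) (M t))) := by
    rw [map_smul]; rfl
  have e2 : 𝔐.signOp (eps T t) (𝔐.blochField v₁ v₂ (M t)) =
      𝔐.cross (v₁ • 𝔐.axis 0 + (eps T t * v₂) • 𝔐.axis 1) (𝔐.signOp (eps T t) (M t)) -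
        eps T t • 𝔐.gen (𝔐.signOp (eps T t) (M t)) := by
    rw [blochField, map_sub, signOp_cross _ hε, signOp_gen _ hε, map_add, map_smul, map_smul,
      signOp_axis_zero _ hε, signOp_axis_one _ hε, smul_smul, mul_comm]
  simp only [Function.comp_apply]
  rw [e1, e2, ← map_add, add_sub_cancel, free_cross, 𝔐.rot_cross]
  simp only [map_add, map_smul, add_apply, smul_apply, controlOp, frameField, toRot_apply]

theorem hasDerivAt_ofRot (hT : 0 < T) (ht : 0 < t) (hk : ∀ k : ℕ, t ≠ k * T) {N : ℝ → V}
    {v₁ v₂ : ℝ} (h : HasDerivAt N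
      (v₁ • 𝔐.controlOp T 0 t (N t) + (eps T t * v₂) • 𝔐.controlOp T 1 t (N t)) t) :
    HasDerivAt (fun s => 𝔐.ofRot T s (N s)) (𝔐.blochField v₁ v₂ (𝔐.ofRot T t (N t))) t := by
  have hε := eps_eq_or (T := T) t
  have h1 : HasDerivAt (fun s => 𝔐.free (-sigma T s))
      ((-eps T t) • (𝔐.gen * 𝔐.free (-sigma T t))) t :=
    HasDerivAt.scomp (h := fun s => -sigma T s) t (𝔐.hasDerivAt_free' (-sigma T t))
      (hasDerivAt_sigma hT ht hk).neg
  have h2 := (𝔐.signOp (eps T t)).hasFDerivAt.comp_hasDerivAt t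
    (h1.clm_apply (𝔐.rotInv.hasFDerivAt.comp_hasDerivAt t h))
  have he : (fun s => 𝔐.ofRot T s (N s)) =ᶠ[𝓝 t] fun s =>
      𝔐.signOp (eps T t) (𝔐.free (-sigma T s) (𝔐.rotInv (N s))) := by
    filter_upwards [eps_eventually_eq hT ht hk] with s hs
    rw [ofRot_apply, hs]
  have h3 := h2.congr_of_eventuallyEq he
  convert h3 using 1
  simp only [Function.comp_apply]
  have e1 : ((-eps T t) • (𝔐.gen * 𝔐.free (-sigma T t))) (𝔐.rotInv (N t)) =
      (-eps T t) • 𝔐.gen (𝔐.free (-sigma T t) (𝔐.rotInv (N t))) := rfl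
  have e2 : ∀ i, 𝔐.free (-sigma T t) (𝔐.rotInv (𝔐.controlOp T i t (N t))) =
      𝔐.cross (𝔐.axis i) (𝔐.free (-sigma T t) (𝔐.rotInv (N t))) := fun i => by
    rw [controlOp, frameField, rotInv_cross, 𝔐.rotInv_rot, free_cross, free_neg_free]
  rw [e1, map_add, map_smul, signOp_gen _ hε, map_add, map_smul, map_smul, map_add, map_smul,
    map_smul, e2, e2, map_add, map_smul, map_smul, signOp_cross _ hε, signOp_cross _ hε,
    signOp_axis_zero _ hε, signOp_axis_one _ hε, ← ofRot_apply, blochField, map_add, map_smul,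
    map_smul, map_smul, add_apply, smul_apply, smul_apply, smul_apply, smul_smul, smul_smul,
    neg_mul, eps_mul_self, neg_one_smul, mul_right_comm, eps_mul_self, one_mul]
  abel

end SpinModel

/-! ### Impulsive solutions and the damped equation -/

theorem eventually_ne_nat_mul {T : ℝ} (hT : 0 < T) (t : ℝ) :
    ∀ᶠ s in 𝓝[≠] t, ∀ k : ℕ, s ≠ k * T := by
  have h1 : ((⌈t / T⌉ - 1 : ℤ) : ℝ) * T < t := by
    have := Int.ceil_lt_add_one (t / T)
    rw [← lt_div_iff₀ hT]
    push_cast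
    linarith
  have h2 : t < ((⌊t / T⌋ + 1 : ℤ) : ℝ) * T := by
    have := Int.lt_floor_add_one (t / T)
    rw [← div_lt_iff₀ hT]
    push_cast
    linarith
  filter_upwards [self_mem_nhdsWithin, nhdsWithin_le_nhds (Ioo_mem_nhds h1 h2)] with s hs hs'
  rintro k rfl
  have h3 : ⌈t / T⌉ - 1 < (k : ℤ) := by
    have := lt_of_mul_lt_mul_right hs'.1 hT.le
    exact_mod_cast this
  have h4 : (k : ℤ) < ⌊t / T⌋ + 1 := by
    have := lt_of_mul_lt_mul_right hs'.2 hT.le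
    exact_mod_cast this
  have h5 : t / T ≤ k := (Int.le_ceil _).trans (by exact_mod_cast (by omega : ⌈t / T⌉ ≤ (k : ℤ)))
  have h6 : (k : ℝ) ≤ t / T :=
    le_trans (by exact_mod_cast (by omega : (k : ℤ) ≤ ⌊t / T⌋)) (Int.floor_le _)
  exact hs (by rw [Set.mem_singleton_iff, le_antisymm h6 h5, div_mul_cancel₀ _ hT.ne'])

theorem tendsto_clm_apply {V V' α : Type*} [NormedAddCommGroup V] [NormedSpace ℝ V]
    [NormedAddCommGroup V'] [NormedSpace ℝ V'] {l : Filter α} {A : α → V →L[ℝ] V'}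
    {A₀ : V →L[ℝ] V'} {v : α → V} {v₀ : V} (hA : Tendsto A l (𝓝 A₀)) (hv : Tendsto v l (𝓝 v₀)) :
    Tendsto (fun s => A s (v s)) l (𝓝 (A₀ v₀)) :=
  (isBoundedBilinearMap_apply.continuous.tendsto (A₀, v₀)).comp (hA.prodMk_nhds hv)

/-- A continuous function with derivative `g` near a point, except perhaps at this point, where
`g` is continuous, has derivative `g` there too. -/
theorem hasDerivAt_of_eventually_hasDerivAt {V : Type*} [NormedAddCommGroup V] [NormedSpace ℝ V]
    {f g : ℝ → V} {x : ℝ} (hd : ∀ᶠ y in 𝓝[≠] x, HasDerivAt f (g y) y) (hf : ContinuousAt f x)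
    (hg : ContinuousAt g x) : HasDerivAt f (g x) x := by
  have hr : ∀ᶠ y in 𝓝[>] x, HasDerivAt f (g y) y :=
    nhdsWithin_mono _ (fun y hy => ne_of_gt hy) hd
  have hl : ∀ᶠ y in 𝓝[<] x, HasDerivAt f (g y) y :=
    nhdsWithin_mono _ (fun y hy => ne_of_lt hy) hd
  have A : HasDerivWithinAt f (g x) (Set.Ici x) x :=
    hasDerivWithinAt_Ici_of_tendsto_deriv (s := {y | HasDerivAt f (g y) y})
      (fun y hy => HasDerivAt.differentiableAt hy |>.differentiableWithinAt)
      hf.continuousWithinAt hr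
      ((hg.mono_left nhdsWithin_le_nhds).congr' (hr.mono fun y hy => hy.deriv.symm))
  have B : HasDerivWithinAt f (g x) (Set.Iic x) x :=
    hasDerivWithinAt_Iic_of_tendsto_deriv (s := {y | HasDerivAt f (g y) y})
      (fun y hy => HasDerivAt.differentiableAt hy |>.differentiableWithinAt)
      hf.continuousWithinAt hl
      ((hg.mono_left nhdsWithin_le_nhds).congr' (hl.mono fun y hy => hy.deriv.symm))
  simpa using B.union A

namespace SpinModel

variable {V : Type*} [NormedAddCommGroup V] [InnerProductSpace ℝ V] [CompleteSpace V]
  {𝔐 : SpinModel V} {T : ℝ}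

theorem signOp_flip {ε : ℝ} (h : ε = 1 ∨ ε = -1) (v : V) :
    𝔐.signOp ε (𝔐.flip v) = 𝔐.signOp (-ε) v := by
  rcases h with rfl | rfl
  · rw [signOp_neg_one, signOp_one]
  · rw [neg_neg, signOp_neg_one, signOp_one, 𝔐.flip_flip]

/-- Solutions of the closed-loop Bloch equation, for the state in the laboratory frame: the
abstract counterpart of `IsClosedLoopSolution`. -/
structure IsSolution (𝔐 : SpinModel V) (T : ℝ) (M₀ : V) (M : ℝ → V) : Prop where
  initial : M 0 = M₀
  initial_right : Tendsto M (𝓝[>] 0) (𝓝 M₀)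
  flow : ∀ t : ℝ, 0 < t → (∀ k : ℕ, t ≠ k * T) →
    HasDerivAt M (𝔐.blochField (- output 𝔐.target (𝔐.controlOp T) 0 t (𝔐.toRot T t (M t)))
      (eps T t * - output 𝔐.target (𝔐.controlOp T) 1 t (𝔐.toRot T t (M t))) (M t)) t
  jump : ∀ k : ℕ, 1 ≤ k → ∃ Mminus Mplus : V, Tendsto M (𝓝[<] (k * T)) (𝓝 Mminus) ∧
    Tendsto M (𝓝[>] (k * T)) (𝓝 Mplus) ∧ Mplus = 𝔐.flip Mminus

theorem dampedField_eq (t : ℝ) (N : V) : dampedField 𝔐.target (𝔐.controlOp T) t N =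
    (- output 𝔐.target (𝔐.controlOp T) 0 t N) • 𝔐.controlOp T 0 t N +
      (eps T t * (eps T t * - output 𝔐.target (𝔐.controlOp T) 1 t N)) • 𝔐.controlOp T 1 t N := by
  rw [← mul_assoc, eps_mul_self, one_mul, dampedField, Fin.sum_univ_two, neg_add, neg_smul,
    neg_smul]

theorem tendsto_toRot {l : Filter ℝ} {τ ε : ℝ} (hl : l ≤ 𝓝 τ) (hε : ∀ᶠ s in l, eps T s = ε)
    {M : ℝ → V} {m : V} (hM : Tendsto M l (𝓝 m)) : Tendsto (fun s => 𝔐.toRot T s (M s)) l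
      (𝓝 (𝔐.rot (𝔐.free (sigma T τ) (𝔐.signOp ε m)))) := by
  have h1 : Tendsto (fun s => 𝔐.free (sigma T s)) l (𝓝 (𝔐.free (sigma T τ))) :=
    ((𝔐.continuous_free.comp continuous_sigma).tendsto τ).mono_left hl
  have h2 := (𝔐.rot.continuous.tendsto _).comp
    (tendsto_clm_apply h1 (((𝔐.signOp ε).continuous.tendsto m).comp hM))
  refine h2.congr' ?_
  filter_upwards [hε] with s hs
  rw [toRot_apply, hs]
  rfl

theorem tendsto_ofRot {l : Filter ℝ} {τ ε : ℝ} (hl : l ≤ 𝓝 τ) (hε : ∀ᶠ s in l, eps T s = ε)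
    {N : ℝ → V} {n : V} (hN : Tendsto N l (𝓝 n)) : Tendsto (fun s => 𝔐.ofRot T s (N s)) l
      (𝓝 (𝔐.signOp ε (𝔐.free (-sigma T τ) (𝔐.rotInv n)))) := by
  have h1 : Tendsto (fun s => 𝔐.free (-sigma T s)) l (𝓝 (𝔐.free (-sigma T τ))) :=
    ((𝔐.continuous_free.comp continuous_sigma.neg).tendsto τ).mono_left hl
  have h2 := ((𝔐.signOp ε).continuous.tendsto _).comp
    (tendsto_clm_apply h1 ((𝔐.rotInv.continuous.tendsto n).comp hN))
  refine h2.congr' ?_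
  filter_upwards [hε] with s hs
  rw [ofRot_apply, hs]
  rfl

theorem neg_one_zpow_eq_or (k : ℤ) : ((-1 : ℝ)) ^ k = 1 ∨ ((-1 : ℝ)) ^ k = -1 := by
  rcases Int.even_or_odd k with h | h
  · exact Or.inl h.neg_one_zpow
  · exact Or.inr h.neg_one_zpow

theorem ofRot_zero (v : V) : 𝔐.ofRot T 0 (𝔐.rot v) = v := by
  rw [ofRot_apply, 𝔐.rotInv_rot, sigma_zero, neg_zero, free_zero, eps_zero, signOp_one]

/-- Transforming a solution of the damped equation back gives an impulsive solution: the jumps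
compensate those of `ε`. -/
theorem isSolution_ofRot (hT : 0 < T) {M₀ : V} {N : ℝ → V} (h0 : N 0 = 𝔐.rot M₀)
    (hN : ∀ τ, IsSolutionOn (dampedField 𝔐.target (𝔐.controlOp T)) τ N) :
    𝔐.IsSolution T M₀ fun t => 𝔐.ofRot T t (N t) := by
  have hzero : (fun t => 𝔐.ofRot T t (N t)) 0 = M₀ := by
    change 𝔐.ofRot T 0 (N 0) = M₀
    rw [h0, ofRot_zero]
  refine ⟨hzero, ?_, fun t ht hk => ?_, fun k hk => ?_⟩
  · have h1 : Tendsto N (𝓝[>] 0) (𝓝 (N 0)) :=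
      ((hN 1).continuousOn.continuousWithinAt (Set.left_mem_Icc.2 zero_le_one)).mono_left
        ((nhdsWithin_mono _ Set.Ioc_subset_Icc_self).trans'
          (nhdsWithin_Ioc_eq_nhdsGT zero_lt_one).ge)
    have h2 := eps_right hT 0
    rw [Int.cast_zero, zero_mul, zpow_zero] at h2
    have h3 := tendsto_ofRot (𝔐 := 𝔐) nhdsWithin_le_nhds h2 h1
    rwa [h0, 𝔐.rotInv_rot, sigma_zero, neg_zero, free_zero, signOp_one] at h3
  · refine 𝔐.hasDerivAt_ofRot hT ht hk ?_
    rw [toRot_ofRot, ← dampedField_eq]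
    exact hasDerivAt_of_global hN ht
  · have hkT : 0 < (k : ℝ) * T := mul_pos (by exact_mod_cast hk) hT
    have hc : ContinuousAt N (k * T) := (hasDerivAt_of_global hN hkT).continuousAt
    have hl := eps_left hT k
    have hr := eps_right hT k
    rw [Int.cast_natCast] at hl hr
    refine ⟨_, _, tendsto_ofRot nhdsWithin_le_nhds hl (hc.mono_left nhdsWithin_le_nhds),
      tendsto_ofRot nhdsWithin_le_nhds hr (hc.mono_left nhdsWithin_le_nhds), ?_⟩
    rw [signOp_neg _ (neg_one_zpow_eq_or k), 𝔐.flip_flip]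

theorem exists_isSolution (hT : 0 < T) (M₀ : V) : ∃ M, 𝔐.IsSolution T M₀ M := by
  obtain ⟨K, hK, -⟩ := 𝔐.exists_controlOp_bound hT
  obtain ⟨N, h0, hN⟩ := exists_global_solution (p := 𝔐.target) hK (𝔐.continuous_controlOp T)
    (𝔐.rot M₀)
  exact ⟨_, isSolution_ofRot hT h0 hN⟩

theorem continuousAt_dampedField {N : ℝ → V} {t : ℝ} (h : ContinuousAt N t) :
    ContinuousAt (fun s => dampedField 𝔐.target (𝔐.controlOp T) s (N s)) t := by
  unfold dampedField output
  have : ∀ i, ContinuousAt (fun s => 𝔐.controlOp T i s (N s)) t :=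
    fun i => (𝔐.continuous_controlOp T i).continuousAt.clm_apply h
  exact (tendsto_finsetSum _ fun i _ =>
    ((h.sub continuousAt_const).inner (𝕜 := ℝ) (this i)).smul (this i)).neg

theorem IsSolution.exists_tendsto_toRot (hT : 0 < T) {M₀ : V} {M : ℝ → V}
    (h : 𝔐.IsSolution T M₀ M) {t : ℝ} (ht : 0 ≤ t) : ∃ n,
      Tendsto (fun s => 𝔐.toRot T s (M s)) (𝓝[Set.Ioi 0 \ {t}] t) (𝓝 n) ∧
      (t = 0 → n = 𝔐.rot M₀) ∧ (0 < t → (∀ k : ℕ, t ≠ k * T) → n = 𝔐.toRot T t (M t)) := by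
  rcases ht.eq_or_lt with rfl | ht
  · refine ⟨𝔐.rot M₀, ?_, fun _ => rfl, fun h => (lt_irrefl _ h).elim⟩
    have h2 := eps_right hT 0
    rw [Int.cast_zero, zero_mul, zpow_zero] at h2
    have h3 := tendsto_toRot (𝔐 := 𝔐) nhdsWithin_le_nhds h2 h.initial_right
    rw [sigma_zero, free_zero, signOp_one] at h3
    exact h3.mono_left (nhdsWithin_mono _ Set.sdiff_subset)
  · have hset : 𝓝[Set.Ioi 0 \ {t}] t ≤ 𝓝[≠] t := nhdsWithin_mono _ fun x hx => hx.2
    by_cases hk : ∀ k : ℕ, t ≠ k * T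
    · refine ⟨_, ?_, fun h => (ht.ne' h).elim, fun _ _ => rfl⟩
      exact (𝔐.hasDerivAt_toRot hT ht hk (h.flow t ht hk)).continuousAt.mono_left
        nhdsWithin_le_nhds
    · push Not at hk
      obtain ⟨k, rfl⟩ := hk
      have hk1 : 1 ≤ k := by
        rcases Nat.eq_zero_or_pos k with rfl | h
        · simp at ht
        · exact h
      obtain ⟨m, m', hm, hm', rfl⟩ := h.jump k hk1
      have hl := eps_left hT k
      have hr := eps_right hT k
      rw [Int.cast_natCast] at hl hr
      have h1 := tendsto_toRot (𝔐 := 𝔐) nhdsWithin_le_nhds hl hm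
      have h2 := tendsto_toRot (𝔐 := 𝔐) nhdsWithin_le_nhds hr hm'
      rw [signOp_flip (neg_one_zpow_eq_or k)] at h2
      refine ⟨𝔐.rot (𝔐.free (sigma T (k * T)) (𝔐.signOp (-(-1) ^ (k : ℤ)) m)), ?_,
        fun h => (ht.ne' h).elim, fun _ h => (h k rfl).elim⟩
      refine Tendsto.mono_left ?_ hset
      rw [← Set.Iio_union_Ioi, nhdsWithin_union]
      exact h1.sup h2

/-- The transformed state extends to a solution of the damped equation, without jumps. -/
theorem IsSolution.exists_damped (hT : 0 < T) {M₀ : V} {M : ℝ → V} (h : 𝔐.IsSolution T M₀ M) :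
    ∃ N : ℝ → V, N 0 = 𝔐.rot M₀ ∧
      (∀ τ, IsSolutionOn (dampedField 𝔐.target (𝔐.controlOp T)) τ N) ∧
      ∀ t, 0 ≤ t → (∀ k : ℕ, 1 ≤ k → t ≠ k * T) → M t = 𝔐.ofRot T t (N t) := by
  choose! N hN hN0 hNr using fun t (ht : 0 ≤ t) => h.exists_tendsto_toRot hT ht
  have hreg : ∀ t, 0 ≤ t → ∀ᶠ s in 𝓝[Set.Ioi 0 \ {t}] t, 0 < s ∧ ∀ k : ℕ, s ≠ k * T := by
    intro t ht
    have hset : 𝓝[Set.Ioi 0 \ {t}] t ≤ 𝓝[≠] t := nhdsWithin_mono _ fun x hx => hx.2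
    filter_upwards [self_mem_nhdsWithin, hset (eventually_ne_nat_mul hT t)] with s h1 h2
    exact ⟨h1.1, h2⟩
  have hregAt : ∀ t, 0 < t → ∀ᶠ s in 𝓝[≠] t, 0 < s ∧ ∀ k : ℕ, s ≠ k * T := by
    intro t ht
    filter_upwards [nhdsWithin_le_nhds (Ioi_mem_nhds ht), eventually_ne_nat_mul hT t]
      with s h1 h2
    exact ⟨h1, h2⟩
  have hcont : ∀ t, 0 ≤ t → ContinuousWithinAt N (Set.Ioi 0) t := by
    intro t ht
    rw [← continuousWithinAt_sdiff_self]
    refine (hN t ht).congr' ?_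
    filter_upwards [hreg t ht] with s hs
    exact (hNr s hs.1.le hs.1 hs.2).symm
  have hcontAt : ∀ t, 0 < t → ContinuousAt N t := fun t ht =>
    (hcont t ht.le).continuousAt (Ioi_mem_nhds ht)
  have hderivReg : ∀ t, 0 < t → (∀ k : ℕ, t ≠ k * T) →
      HasDerivAt N (dampedField 𝔐.target (𝔐.controlOp T) t (N t)) t := by
    intro t ht hk
    have h1 := 𝔐.hasDerivAt_toRot hT ht hk (h.flow t ht hk)
    rw [← dampedField_eq, ← hNr t ht.le ht hk] at h1
    refine h1.congr_of_eventuallyEq ?_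
    have h3 := hregAt t ht
    rw [eventually_nhdsWithin_iff] at h3
    filter_upwards [h3] with s hs
    by_cases hst : s = t
    · subst hst
      exact hNr s ht.le ht hk
    · exact hNr s (hs hst).1.le (hs hst).1 (hs hst).2
  have hderiv : ∀ t, 0 < t → HasDerivAt N (dampedField 𝔐.target (𝔐.controlOp T) t (N t)) t :=
    fun t ht => hasDerivAt_of_eventually_hasDerivAt
      (g := fun t => dampedField 𝔐.target (𝔐.controlOp T) t (N t))
      ((hregAt t ht).mono fun s hs => hderivReg s hs.1 hs.2) (hcontAt t ht)
      (continuousAt_dampedField (hcontAt t ht))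
  refine ⟨N, hN0 0 le_rfl rfl, fun τ => ⟨fun t ht => ?_, fun t ht => hderiv t ht.1⟩,
    fun t ht hk => ?_⟩
  · rcases ht.1.eq_or_lt with rfl | h0
    · exact (continuousWithinAt_Ioi_iff_Ici.1 (hcont 0 le_rfl)).mono Set.Icc_subset_Ici_self
    · exact (hcontAt t h0).continuousWithinAt
  · rcases ht.eq_or_lt with rfl | h0
    · rw [hN0 0 le_rfl rfl, ofRot_zero, h.initial]
    · rw [hNr t ht h0 fun k => ?_, ofRot_toRot]
      rcases Nat.eq_zero_or_pos k with rfl | hk0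
      · simpa using h0.ne'
      · exact hk k hk0

theorem tendsto_right_of_damped (hT : 0 < T) {M N : ℝ → V}
    (hN : ∀ τ, IsSolutionOn (dampedField 𝔐.target (𝔐.controlOp T)) τ N)
    (hM : ∀ t, 0 ≤ t → (∀ k : ℕ, 1 ≤ k → t ≠ k * T) → M t = 𝔐.ofRot T t (N t)) (k : ℕ) :
    Tendsto M (𝓝[>] (2 * k * T)) (𝓝 (𝔐.rotInv (N (k * (2 * T))))) := by
  have e : 2 * (k : ℝ) * T = k * (2 * T) := by ring
  have hk0 : 0 ≤ (k : ℝ) * (2 * T) := by positivity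
  have h1 : Tendsto N (𝓝[>] (k * (2 * T))) (𝓝 (N (k * (2 * T)))) := by
    have h := (hN (k * (2 * T) + 1)).continuousOn.continuousWithinAt ⟨hk0, by linarith⟩
    refine h.mono_left ?_
    rw [← nhdsWithin_Ioc_eq_nhdsGT (show (k : ℝ) * (2 * T) < k * (2 * T) + 1 by linarith)]
    exact nhdsWithin_mono _ fun x hx => ⟨hk0.trans hx.1.le, hx.2⟩
  have hr : ∀ᶠ s in 𝓝[>] ((k : ℝ) * (2 * T)), eps T s = 1 := by
    have h := eps_right hT (2 * k)
    rw [(even_two_mul (k : ℤ)).neg_one_zpow] at h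
    push_cast at h
    rwa [e] at h
  have hσ : sigma T (k * (2 * T)) = 0 := by
    have := sigma_nat_mul_add hT k 0
    rwa [add_zero, sigma_zero] at this
  have h2 := tendsto_ofRot (𝔐 := 𝔐) nhdsWithin_le_nhds hr h1
  rw [hσ, neg_zero, free_zero, signOp_one] at h2
  rw [e]
  refine h2.congr' ?_
  filter_upwards [self_mem_nhdsWithin, nhdsWithin_mono _ (fun x hx => ne_of_gt hx)
    (eventually_ne_nat_mul hT (k * (2 * T)))] with s hs hs'
  exact (hM s (hk0.trans (le_of_lt hs)) fun j _ => hs' j).symm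

/-- Solutions are unique away from the impulses. -/
theorem IsSolution.unique (hT : 0 < T) {M₀ : V} {M M' : ℝ → V} (h : 𝔐.IsSolution T M₀ M)
    (h' : 𝔐.IsSolution T M₀ M') {t : ℝ} (ht : 0 ≤ t) (hk : ∀ k : ℕ, 1 ≤ k → t ≠ k * T) :
    M t = M' t := by
  obtain ⟨K, hK, -⟩ := 𝔐.exists_controlOp_bound hT
  obtain ⟨N, h0, hN, hM⟩ := h.exists_damped hT
  obtain ⟨N', h0', hN', hM'⟩ := h'.exists_damped hT
  rw [hM t ht hk, hM' t ht hk,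
    (hN t).unique hK (hN' t) (h0.trans h0'.symm) t ⟨ht, le_rfl⟩]

end SpinModel

/-! ### The spin model on `H¹((a, b), ℝ³)` -/

theorem isAC2_exp {𝔸 : Type*} [NormedRing 𝔸] [NormedAlgebra ℝ 𝔸] [CompleteSpace 𝔸] (a b c : ℝ)
    (s : 𝔸) : IsAC2 a b (fun x => NormedSpace.exp ((c * x) • s))
      (fun x => c • (s * NormedSpace.exp ((c * x) • s))) := by
  have hd : ∀ x, HasDerivAt (fun x : ℝ => NormedSpace.exp ((c * x) • s))
      (c • (s * NormedSpace.exp ((c * x) • s))) x := fun x => by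
    have h1 : HasDerivAt (fun x : ℝ => c * x) c x := by
      simpa using (hasDerivAt_id x).const_mul c
    exact (hasDerivAt_exp_smul_const' (𝕂 := ℝ) s (c * x)).scomp x h1
  refine IsAC2.of_hasDerivAt hd ?_
  have hc : Continuous fun x : ℝ => NormedSpace.exp ((c * x) • s) :=
    continuous_iff_continuousAt.2 fun x => (hd x).continuousAt
  exact (continuous_const.mul hc).const_smul c

section Operators

variable {a b : ℝ} [hab : Fact (a < b)]

/-- The Hilbert space `H¹((a, b), ℝ³)` of states. It is a type synonym of `H1 a b E3`, whose
algebraic structure is inherited from its Hilbert space structure, rather than from that of a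
subspace of `L² × L²`. -/
def State (a b : ℝ) : Type := H1 a b E3

instance : NormedAddCommGroup (State a b) := inferInstanceAs (NormedAddCommGroup (H1 a b E3))

instance : InnerProductSpace ℝ (State a b) := inferInstanceAs (InnerProductSpace ℝ (H1 a b E3))

instance : CompleteSpace (State a b) := inferInstanceAs (CompleteSpace (H1 a b E3))

theorem State.ext {f g : State a b} (h : ∀ x ∈ Set.Icc a b, rep f x = rep g x) : f = g :=
  H1_ext h

theorem State.rep_sub (f g : State a b) {x : ℝ} (hx : x ∈ Set.Icc a b) :
    rep (f - g : State a b) x = rep f x - rep g x := BlochEnsemble.rep_sub f g hx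

theorem State.rep_neg (f : State a b) {x : ℝ} (hx : x ∈ Set.Icc a b) :
    rep (-f : State a b) x = - rep f x := BlochEnsemble.rep_neg f hx

theorem State.rep_add (f g : State a b) {x : ℝ} (hx : x ∈ Set.Icc a b) :
    rep (f + g : State a b) x = rep f x + rep g x := BlochEnsemble.rep_add f g x hx

theorem State.rep_smul (c : ℝ) (f : State a b) {x : ℝ} (hx : x ∈ Set.Icc a b) :
    rep (c • f : State a b) x = c • rep f x := BlochEnsemble.rep_smul c f x hx

/-- Evaluation at a point. -/
def evalS (x : Set.Icc a b) : State a b →L[ℝ] E3 := (evalL x : H1 a b E3 →L[ℝ] E3)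

/-- The pointwise action of a constant matrix. -/
def constOp (L : M3) : State a b →L[ℝ] State a b := (compL L : H1 a b E3 →L[ℝ] H1 a b E3)

theorem rep_constOp (L : M3) (f : State a b) {x : ℝ} (hx : x ∈ Set.Icc a b) :
    rep (constOp L f) x = L (rep f x) := rep_compL _ _ hx

/-- Pointwise application of a matrix-valued function of class `H¹`. -/
def mulOp (R : H1 a b M3) : State a b →L[ℝ] State a b :=
  (bilin applyL R : H1 a b E3 →L[ℝ] H1 a b E3)

theorem rep_mulOp (R : H1 a b M3) (f : State a b) {x : ℝ} (hx : x ∈ Set.Icc a b) :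
    rep (mulOp R f) x = rep R x (rep f x) := rep_bilin applyL R f hx

/-- The pointwise cross product. -/
def wedgeH : State a b →L[ℝ] State a b →L[ℝ] State a b :=
  (bilin wedgeL : H1 a b E3 →L[ℝ] H1 a b E3 →L[ℝ] H1 a b E3)

theorem rep_wedgeH (f g : State a b) {x : ℝ} (hx : x ∈ Set.Icc a b) :
    rep (wedgeH f g) x = wedge (rep f x) (rep g x) := rep_bilin wedgeL f g hx

theorem der_wedgeH (f g : State a b) : der (wedgeH f g) =ᵐ[intervalMeasure a b]
    fun x => wedge (der f x) (rep g x) + wedge (rep f x) (der g x) := der_bilin wedgeL f g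

/-- Multiplication of a state by a scalar function. -/
def smulH : H1 a b ℝ →L[ℝ] State a b →L[ℝ] State a b :=
  (bilin (ContinuousLinearMap.lsmul ℝ ℝ) : H1 a b ℝ →L[ℝ] H1 a b E3 →L[ℝ] H1 a b E3)

theorem rep_smulH (φ : H1 a b ℝ) (f : State a b) {x : ℝ} (hx : x ∈ Set.Icc a b) :
    rep (smulH φ f) x = rep φ x • rep f x := rep_bilin (ContinuousLinearMap.lsmul ℝ ℝ) φ f hx

/-- Constant states. -/
def constS (v : E3) : State a b := (constH v : H1 a b E3)

theorem rep_constS (v : E3) {x : ℝ} (hx : x ∈ Set.Icc a b) :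
    rep (constS v : State a b) x = v := rep_constH v hx

/-- The operator `f ↦ ω S f(ω)`, the generator of the free rotation. -/
def rotGen : State a b →L[ℝ] State a b := (smulH (coordPow 1)).comp (constOp S)

theorem rep_rotGen (f : State a b) {x : ℝ} (hx : x ∈ Set.Icc a b) :
    rep (rotGen f) x = x • S (rep f x) := by
  have h : rep (rotGen f) x = rep (coordPow 1 : H1 a b ℝ) x • rep (constOp S f) x :=
    rep_smulH _ _ hx
  rw [h, rep_coordPow _ hx, rep_constOp _ _ hx, pow_one]

theorem rep_expOp (s : ℝ) (f : State a b) {x : ℝ} (hx : x ∈ Set.Icc a b) :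
    rep (expOp rotGen s f) x = NormedSpace.exp ((s * x) • S) (rep f x) :=
  map_expOp (evalS ⟨x, hx⟩) rotGen S (fun v => rep_rotGen v hx) s f

/-- The constant state `-e₃`. -/
def south : State a b := constS (- e 2)

theorem rep_south {x : ℝ} (hx : x ∈ Set.Icc a b) : rep (south : State a b) x = - e 2 :=
  rep_constS _ hx

/-- The rotation of angle `π` around `ℝ e₁`. -/
def flipL : M3 := ofMatrix (Matrix.diagonal ![1, (-1 : ℝ), -1])

theorem flipL_flipL (v : E3) : flipL (flipL v) = v := by
  rw [flipL, diagonal_apply_diagonal_apply, neg_one_mul, neg_neg, diagonal_one_apply]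

theorem flipL_apply (v : E3) : flipL v 0 = v 0 ∧ flipL v 1 = - v 1 ∧ flipL v 2 = - v 2 := by
  obtain ⟨a0, a1, a2⟩ := e_zero
  obtain ⟨b0, b1, b2⟩ := e_one
  obtain ⟨c0, c1, c2⟩ := e_two
  rw [flipL, ofMatrix_diagonal_apply]
  simp [a0, a1, a2, b0, b1, b2, c0, c1, c2]

theorem flipL_wedge (u v : E3) : flipL (wedge u v) = wedge (flipL u) (flipL v) := by
  obtain ⟨h0, h1, h2⟩ := flipL_apply (wedge u v)
  obtain ⟨u0, u1, u2⟩ := flipL_apply u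
  obtain ⟨v0, v1, v2⟩ := flipL_apply v
  apply E3_ext
  · rw [h0, wedge_apply_zero, wedge_apply_zero, u1, u2, v1, v2]; ring
  · rw [h1, wedge_apply_one, wedge_apply_one, u0, u2, v0, v2]; ring
  · rw [h2, wedge_apply_two, wedge_apply_two, u0, u1, v0, v1]; ring

theorem flipL_S (v : E3) : flipL (S v) = - S (flipL v) := by
  obtain ⟨h0, h1, h2⟩ := flipL_apply (S v)
  obtain ⟨s0, s1, s2⟩ := S_apply v
  obtain ⟨v0, v1, v2⟩ := flipL_apply v
  obtain ⟨t0, t1, t2⟩ := S_apply (flipL v)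
  apply E3_ext
  · rw [h0, PiLp.neg_apply, t0, s0, v1, neg_neg]
  · rw [h1, PiLp.neg_apply, t1, s1, v0]
  · rw [h2, PiLp.neg_apply, t2, s2]

theorem flipL_e_zero : flipL (e 0) = e 0 := by
  obtain ⟨h0, h1, h2⟩ := flipL_apply (e 0)
  obtain ⟨e0, e1, e2⟩ := e_zero
  apply E3_ext
  · rw [h0]
  · rw [h1, e1, neg_zero]
  · rw [h2, e2, neg_zero]

theorem flipL_e_one : flipL (e 1) = - e 1 := by
  obtain ⟨h0, h1, h2⟩ := flipL_apply (e 1)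
  obtain ⟨e0, e1, e2⟩ := e_one
  apply E3_ext
  · rw [h0, PiLp.neg_apply, e0, neg_zero]
  · rw [h1, PiLp.neg_apply]
  · rw [h2, PiLp.neg_apply]

/-- The spin model on `H¹((a, b), ℝ³)` attached to a frame `R` with values in `SO₃(ℝ)`. -/
def frameModel (R : H1 a b M3) (hR : ∀ x ∈ Set.Icc a b, IsRot (rep R x)) :
    SpinModel (State a b) where
  cross := wedgeH
  gen := rotGen
  rot := mulOp R
  rotInv := mulOp (compL adjL R)
  flip := constOp flipL
  axis i := constS (e i.castSucc)
  target := south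
  rotInv_rot v := State.ext fun x hx => by
    rw [rep_mulOp _ _ hx, rep_mulOp _ _ hx, rep_compL _ _ hx, (hR x hx).adj_apply_apply]
  rot_rotInv v := State.ext fun x hx => by
    rw [rep_mulOp _ _ hx, rep_mulOp _ _ hx, rep_compL _ _ hx, (hR x hx).apply_adj_apply]
  rot_cross u v := State.ext fun x hx => by
    rw [rep_mulOp _ _ hx, rep_wedgeH _ _ hx, rep_wedgeH _ _ hx, rep_mulOp _ _ hx,
      rep_mulOp _ _ hx, (hR x hx).wedge]
  exp_cross s u v := State.ext fun x hx => by
    rw [rep_expOp _ _ hx, rep_wedgeH _ _ hx, rep_wedgeH _ _ hx, rep_expOp _ _ hx,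
      rep_expOp _ _ hx, (isRot_exp_S _).wedge]
  flip_flip v := State.ext fun x hx => by
    rw [rep_constOp _ _ hx, rep_constOp _ _ hx, flipL_flipL]
  flip_cross u v := State.ext fun x hx => by
    rw [rep_constOp _ _ hx, rep_wedgeH _ _ hx, rep_wedgeH _ _ hx, rep_constOp _ _ hx,
      rep_constOp _ _ hx, flipL_wedge]
  flip_gen v := State.ext fun x hx => by
    rw [rep_constOp _ _ hx, rep_rotGen _ hx, State.rep_neg _ hx, rep_rotGen _ hx, rep_constOp _ _ hx,
      map_smul, flipL_S, smul_neg]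
  flip_axis_zero := State.ext fun x hx => by
    rw [rep_constOp _ _ hx, rep_constS _ hx]
    exact flipL_e_zero
  flip_axis_one := State.ext fun x hx => by
    rw [rep_constOp _ _ hx, State.rep_neg _ hx, rep_constS _ hx]
    exact flipL_e_one

end Operators

/-! ### The feedback law as an output of the spin model -/

section Feedback

variable {a b : ℝ} [hab : Fact (a < b)]

/-- The derivative of `N ↦ ‖N + e₃‖² / 2` in the direction `f ∧ N`: the terms
`⟨N, f ∧ N⟩` and `⟨N', f ∧ N'⟩` vanish. -/
theorem inner_sub_south_wedge (f N : State a b) : inner ℝ (N - south) (wedgeH f N) =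
    ∫ x, (inner ℝ (der N x) (wedge (der f x) (rep N x)) +
      inner ℝ (e 2) (wedge (rep f x) (rep N x))) ∂(intervalMeasure a b) := by
  refine (inner_H1_eq (N - south : State a b) (wedgeH f N)).trans ?_
  have h2 : der (N - south : State a b) =ᵐ[intervalMeasure a b]
      fun x => der N x - der (south : State a b) x := der_sub (E := E3) N south
  have h3 : der (south : State a b) =ᵐ[intervalMeasure a b] fun _ => 0 := der_constH (- e 2)
  refine integral_congr_ae ?_
  filter_upwards [der_wedgeH f N, h2, h3, ae_restrict_mem measurableSet_Ioo] with x h1 h2 h3 hx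
  have hx' := Set.Ioo_subset_Icc_self hx
  rw [h1, h2, h3, rep_wedgeH _ _ hx', State.rep_sub _ _ hx', rep_south hx', sub_zero,
    sub_neg_eq_add, inner_add_left, inner_add_right, inner_wedge_self_right,
    inner_wedge_self_right, zero_add, add_zero, add_comm]

theorem exists_frame_H1 (T : ℝ) (R : H1 a b M3) (t : ℝ) : ∃ Φ : H1 a b M3,
    ∀ x ∈ Set.Icc a b, rep Φ x = rep R x * NormedSpace.exp ((sigma T t * x) • S) := by
  have h := isAC2_exp a b (sigma T t) S
  refine ⟨bilin (ContinuousLinearMap.compL ℝ E3 E3 E3) R h.toH1, fun x hx => ?_⟩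
  refine (rep_bilin (ContinuousLinearMap.compL ℝ E3 E3 E3) R h.toH1 hx).trans ?_
  exact congrArg (fun A : M3 => ContinuousLinearMap.compL ℝ E3 E3 E3 (rep R x) A)
    (h.rep_toH1 x hx)

variable {R : H1 a b M3} {hR : ∀ x ∈ Set.Icc a b, IsRot (rep R x)}

theorem rep_frameField (T : ℝ) (i : Fin 2) (t : ℝ) {x : ℝ} (hx : x ∈ Set.Icc a b) :
    rep ((frameModel R hR).frameField T i t) x =
      rep R x (NormedSpace.exp ((sigma T t * x) • S) (e i.castSucc)) := by
  refine (rep_mulOp R (expOp rotGen (sigma T t) (constS (e i.castSucc))) hx).trans ?_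
  rw [rep_expOp _ _ hx, rep_constS _ hx]

/-- The functional `H_i` is the derivative of the Lyapunov function along `F e_i ∧ N`. -/
theorem H_eq (T : ℝ) (i : Fin 2) (t : ℝ) (N : State a b) {n : ℝ → E3}
    (hn : n =ᵐ[intervalMeasure a b] rep N) :
    H T R i.castSucc t n = output south ((frameModel R hR).controlOp T) i t N := by
  obtain ⟨Φ, hΦ⟩ := exists_frame_H1 T R t
  have hF : F T R t =ᵐ[intervalMeasure a b] profile Φ := by
    filter_upwards [profile_ae_eq Φ, profile_ae_eq R, ae_of_forall_Icc hΦ] with x h1 h2 h3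
    rw [h1, h3, F, h2]
  have h1 : weakDeriv a b (F T R t) =ᵐ[intervalMeasure a b] der Φ :=
    weakDeriv_ae_eq (memLp_der Φ) ((hasWeakDeriv_profile Φ).congr_left hF)
  have h2 : weakDeriv a b n =ᵐ[intervalMeasure a b] der N :=
    weakDeriv_ae_eq (memLp_der (E := E3) N)
      ((hasWeakDeriv_profile (E := E3) N).congr_left (hn.trans (profile_ae_eq N).symm))
  obtain ⟨f, hf⟩ : ∃ f, f = (frameModel R hR).frameField T i t := ⟨_, rfl⟩
  have h3 : ∀ x ∈ Set.Icc a b, rep f x = rep Φ x (e i.castSucc) := fun x hx => by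
    rw [hf, rep_frameField T i t hx, hΦ x hx]
    rfl
  have h4 : der f =ᵐ[intervalMeasure a b] fun x => der Φ x (e i.castSucc) := by
    have h5 : f = (compL (ContinuousLinearMap.apply ℝ E3 (e i.castSucc)) Φ : H1 a b E3) :=
      State.ext fun x hx => (h3 x hx).trans
        (rep_compL (ContinuousLinearMap.apply ℝ E3 (e i.castSucc)) Φ hx).symm
    rw [h5]
    exact der_compL _ _
  have h6 : output south ((frameModel R hR).controlOp T) i t N =
      inner ℝ (N - south) (wedgeH f N) := by rw [hf]; rfl
  rw [h6, inner_sub_south_wedge, H]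
  refine integral_congr_ae ?_
  filter_upwards [h1, h2, h4, hF, hn, profile_ae_eq Φ, ae_of_forall_Icc h3]
    with x k1 k2 k4 k5 k6 k7 k8
  rw [k1, k2, k4, k6, k8, k5, k7]

theorem signOp_eq_P (T t : ℝ) (v : State a b) :
    (frameModel R hR).signOp (eps T t) v = constOp (P T t) v := by
  rcases eps_eq_or (T := T) t with h | h
  · refine State.ext fun x hx => ?_
    rw [h, SpinModel.signOp_one, rep_constOp _ _ hx, P, h, diagonal_one_apply]
  · refine State.ext fun x hx => ?_
    rw [h, SpinModel.signOp_neg_one, rep_constOp _ _ hx, P, h]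
    exact rep_constOp _ _ hx

theorem transformed_ae_eq (T : ℝ) (t : ℝ) (M : State a b) :
    transformed T R t M =ᵐ[intervalMeasure a b] rep ((frameModel R hR).toRot T t M) := by
  have h : ∀ x ∈ Set.Icc a b, rep ((frameModel R hR).toRot T t M) x =
      rep R x (NormedSpace.exp ((sigma T t * x) • S) (P T t (rep M x))) := fun x hx => by
    rw [SpinModel.toRot_apply, signOp_eq_P]
    refine (rep_mulOp R (expOp rotGen (sigma T t) _) hx).trans ?_
    rw [rep_expOp _ _ hx, rep_constOp _ _ hx]
  filter_upwards [profile_ae_eq R, profile_ae_eq (E := E3) M, ae_of_forall_Icc h] with x h1 h2 h3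
  rw [h3, ← h1, ← h2]
  rfl

theorem feedback_eq (T : ℝ) (i : Fin 2) (t : ℝ) (M : State a b) :
    feedback T R i.castSucc t M =
      - output south ((frameModel R hR).controlOp T) i t ((frameModel R hR).toRot T t M) :=
  congrArg Neg.neg (H_eq T i t _ (transformed_ae_eq T t M))

theorem rep_blochField (v₁ v₂ : ℝ) (M : State a b) {x : ℝ} (hx : x ∈ Set.Icc a b) :
    rep ((frameModel R hR).blochField v₁ v₂ M) x =
      wedge (v₁ • e 0 + v₂ • e 1 + x • e 2) (rep M x) := by
  have h : (frameModel R hR).blochField v₁ v₂ M =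
      wedgeH (v₁ • constS (e 0) + v₂ • constS (e 1)) M - rotGen M := rfl
  rw [h, State.rep_sub _ _ hx, rep_wedgeH _ _ hx, State.rep_add _ _ hx, State.rep_smul _ _ hx,
    State.rep_smul _ _ hx, rep_constS _ hx, rep_constS _ hx, rep_rotGen _ hx, S_eq_wedge, smul_neg,
    sub_neg_eq_add, ← wedgeL_apply, ← wedgeL_apply, ← wedgeL_apply, map_add wedgeL _ (x • e 2),
    map_smul wedgeL x, add_apply, smul_apply]

theorem isClosedLoopSolution_iff (T : ℝ) (M₀ : State a b) (M : ℝ → State a b) :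
    IsClosedLoopSolution T R M₀ M ↔ (frameModel R hR).IsSolution T M₀ M := by
  have hfield : ∀ (t : ℝ) (D : State a b),
      (∀ᵐ x ∂(intervalMeasure a b), profile D x = wedge (feedback T R 0 t (M t) • e 0 +
        (eps T t * feedback T R 1 t (M t)) • e 1 + x • e 2) (profile (M t) x)) ↔
      D = (frameModel R hR).blochField
        (- output south ((frameModel R hR).controlOp T) 0 t ((frameModel R hR).toRot T t (M t)))
        (eps T t * - output south ((frameModel R hR).controlOp T) 1 t
          ((frameModel R hR).toRot T t (M t))) (M t) := by
    intro t D
    rw [← feedback_eq, ← feedback_eq]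
    have hD := profile_ae_eq (E := E3) D
    have hM := profile_ae_eq (E := E3) (M t)
    constructor
    · intro h
      refine H1_ext_profile (E := E3) ?_
      refine EventuallyEq.trans ?_ (profile_ae_eq (E := E3) _).symm
      filter_upwards [h, hM, ae_restrict_mem measurableSet_Ioo] with x h1 h2 hx
      rw [h1, h2, rep_blochField _ _ _ (Set.Ioo_subset_Icc_self hx)]
      rfl
    · rintro rfl
      filter_upwards [hD, hM, ae_restrict_mem measurableSet_Ioo] with x h1 h2 hx
      rw [h1, h2, rep_blochField _ _ _ (Set.Ioo_subset_Icc_self hx)]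
      rfl
  have hjump : ∀ m m' : State a b,
      (∀ᵐ x ∂(intervalMeasure a b), profile m' x = rotE1 Real.pi (profile m x)) ↔
      m' = (frameModel R hR).flip m := by
    intro m m'
    have hm := profile_ae_eq (E := E3) m
    have hm' := profile_ae_eq (E := E3) m'
    rw [rotE1_pi_eq]
    constructor
    · intro h
      refine H1_ext_profile (E := E3) ?_
      refine EventuallyEq.trans ?_ (profile_ae_eq (E := E3) _).symm
      filter_upwards [h, hm, ae_restrict_mem measurableSet_Ioo] with x h1 h2 hx
      rw [h1, h2]
      exact (rep_constOp flipL m (Set.Ioo_subset_Icc_self hx)).symm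
    · rintro rfl
      filter_upwards [hm', hm, ae_restrict_mem measurableSet_Ioo] with x h1 h2 hx
      rw [h1, h2]
      exact rep_constOp flipL m (Set.Ioo_subset_Icc_self hx)
  constructor
  · intro h
    refine ⟨h.initial, h.initial_right, fun t ht hk => ?_, fun k hk => ?_⟩
    · obtain ⟨D, hD, hDe⟩ := h.flow t ht hk
      rw [(hfield t D).1 hDe] at hD
      exact hD
    · obtain ⟨m, m', hm, hm', he⟩ := h.jump k hk
      exact ⟨m, m', hm, hm', (hjump m m').1 he⟩
  · intro h
    refine ⟨h.initial, h.initial_right, fun t ht hk => ?_, fun k hk => ?_⟩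
    · exact ⟨_, h.flow t ht hk, (hfield t _).2 rfl⟩
    · obtain ⟨m, m', hm, hm', he⟩ := h.jump k hk
      exact ⟨m, m', hm, hm', (hjump m m').2 he⟩

end Feedback

/-! ### Weak convergence -/

section Weak

variable {V α : Type*} [NormedAddCommGroup V] [InnerProductSpace ℝ V] [CompleteSpace V]

/-- Bounded families in a Hilbert space have weak limits along ultrafilters. -/
theorem exists_weak_limit (𝒰 : Ultrafilter α) {u : α → V} {r : ℝ} (hu : ∀ n, ‖u n‖ ≤ r) :
    ∃ v : V, ∀ w, Tendsto (fun n => inner ℝ w (u n)) 𝒰 (𝓝 (inner ℝ w v)) := by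
  have hc := WeakDual.isCompact_closedBall (𝕜 := ℝ) (E := V) 0 r
  have hmem : ∀ n, StrongDual.toWeakDual (InnerProductSpace.toDual ℝ V (u n)) ∈
      WeakDual.toStrongDual ⁻¹' Metric.closedBall (0 : StrongDual ℝ V) r := fun n => by
    rw [Set.mem_preimage, mem_closedBall_zero_iff]
    exact ((InnerProductSpace.toDual ℝ V).norm_map (u n)).trans_le (hu n)
  obtain ⟨φ, -, hφ⟩ := hc.ultrafilter_le_nhds
    (𝒰.map fun n => StrongDual.toWeakDual (InnerProductSpace.toDual ℝ V (u n)))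
    (le_principal_iff.2 (Ultrafilter.mem_map.2 (Filter.univ_mem' hmem)))
  refine ⟨(InnerProductSpace.toDual ℝ V).symm (WeakDual.toStrongDual φ), fun w => ?_⟩
  have h1 := ((WeakDual.eval_continuous w).tendsto φ).comp hφ
  have h2 : inner ℝ w ((InnerProductSpace.toDual ℝ V).symm (WeakDual.toStrongDual φ)) = φ w := by
    rw [real_inner_comm, InnerProductSpace.toDual_symm_apply]
    rfl
  rw [h2]
  refine Tendsto.congr (fun n => ?_) (tendsto_map'_iff.1 h1)
  exact real_inner_comm _ _

variable {l : Filter α} {u : α → V} {v : V}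

theorem tendsto_clm_of_weak (h : ∀ w, Tendsto (fun n => inner ℝ w (u n)) l (𝓝 (inner ℝ w v)))
    (φ : V →L[ℝ] ℝ) : Tendsto (fun n => φ (u n)) l (𝓝 (φ v)) := by
  have h1 := h ((InnerProductSpace.toDual ℝ V).symm φ)
  simpa only [InnerProductSpace.toDual_symm_apply] using h1

theorem E3_eq_sum (v : E3) : v = v 0 • e 0 + v 1 • e 1 + v 2 • e 2 := by
  obtain ⟨a0, a1, a2⟩ := e_zero
  obtain ⟨b0, b1, b2⟩ := e_one
  obtain ⟨c0, c1, c2⟩ := e_two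
  apply E3_ext <;> simp [a0, a1, a2, b0, b1, b2, c0, c1, c2]

theorem tendsto_clm_E3_of_weak
    (h : ∀ w, Tendsto (fun n => inner ℝ w (u n)) l (𝓝 (inner ℝ w v))) (φ : V →L[ℝ] E3) :
    Tendsto (fun n => φ (u n)) l (𝓝 (φ v)) := by
  have hi : ∀ i, Tendsto (fun n => (φ (u n)) i) l (𝓝 ((φ v) i)) := fun i =>
    tendsto_clm_of_weak h ((EuclideanSpace.proj i).comp φ)
  rw [E3_eq_sum (φ v)]
  refine Tendsto.congr (fun n => (E3_eq_sum (φ (u n))).symm) ?_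
  exact (((hi 0).smul_const _).add ((hi 1).smul_const _)).add ((hi 2).smul_const _)

end Weak

section WeakState

variable {a b : ℝ} [hab : Fact (a < b)] {α : Type*} {l : Filter α}

/-- Bounded families in `H¹` are equicontinuous, so that pointwise convergence is uniform. -/
theorem eventually_norm_rep_le {d : α → State a b} {r : ℝ} (hr : ∀ n, ‖d n‖ ≤ r)
    (h : ∀ x ∈ Set.Icc a b, Tendsto (fun n => rep (d n) x) l (𝓝 0)) {ε : ℝ} (hε : 0 < ε) :
    ∀ᶠ n in l, ∀ x ∈ Set.Icc a b, ‖rep (d n) x‖ ≤ ε := by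
  have hδ : 0 < (ε / (2 * (|r| + 1))) ^ 2 := by positivity
  obtain ⟨t, hts, htf, hcov⟩ := (isCompact_Icc (a := a) (b := b)).finite_cover_balls hδ
  have h1 : ∀ᶠ n in l, ∀ y ∈ t, ‖rep (d n) y‖ < ε / 2 := by
    rw [htf.eventually_all]
    intro y hy
    have := (h y (hts hy)).norm
    rw [norm_zero] at this
    exact this.eventually_lt_const (by positivity)
  filter_upwards [h1] with n hn x hx
  obtain ⟨y, hy, hxy⟩ := Set.mem_iUnion₂.1 (hcov hx)
  have h2 : ‖rep (d n) x - rep (d n) y‖ ≤ √|x - y| * ‖d n‖ :=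
    norm_rep_sub_le (E := E3) (d n) hx (hts hy)
  have h3 : √|x - y| ≤ ε / (2 * (|r| + 1)) := by
    rw [Real.sqrt_le_left (by positivity)]
    exact (Metric.mem_ball.1 hxy).le
  have h4 : ‖d n‖ ≤ |r| + 1 := (hr n).trans ((le_abs_self r).trans (by linarith))
  have h5 : √|x - y| * ‖d n‖ ≤ ε / 2 :=
    calc _ ≤ ε / (2 * (|r| + 1)) * (|r| + 1) := by gcongr
      _ = ε / 2 := by field_simp
  have h6 : ‖rep (d n) x‖ ≤ ‖rep (d n) x - rep (d n) y‖ + ‖rep (d n) y‖ := norm_le_norm_sub_add _ _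
  have h7 := hn y hy
  linarith

theorem tendsto_rep_sub_of_weak {u : α → State a b} {v : State a b}
    (h : ∀ w, Tendsto (fun n => inner ℝ w (u n)) l (𝓝 (inner ℝ w v))) :
    ∀ x ∈ Set.Icc a b, Tendsto (fun n => rep (u n - v : State a b) x) l (𝓝 0) := by
  intro x hx
  have h1 := (tendsto_clm_E3_of_weak h (evalS ⟨x, hx⟩)).sub_const (evalS ⟨x, hx⟩ v)
  rw [sub_self] at h1
  refine h1.congr fun n => ?_
  rw [← map_sub]
  rfl

theorem norm_wedge_le (u v : E3) : ‖wedge u v‖ ≤ ‖u‖ * ‖v‖ := by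
  have h : ‖wedge u v‖ ^ 2 + (inner ℝ u v) ^ 2 = (‖u‖ * ‖v‖) ^ 2 := by
    rw [mul_pow, ← real_inner_self_eq_norm_sq, ← real_inner_self_eq_norm_sq,
      ← real_inner_self_eq_norm_sq, inner_E3, inner_E3, inner_E3, inner_E3, wedge_apply_zero,
      wedge_apply_one, wedge_apply_two]
    ring
  refine abs_le_of_sq_le_sq' ?_ (by positivity) |>.2
  nlinarith [sq_nonneg (inner ℝ u v : ℝ)]

theorem integrable_inner_add_inner_der (f : State a b) : Integrable
    (fun x => (inner ℝ (rep f x) (rep f x) + inner ℝ (der f x) (der f x) : ℝ))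
    (intervalMeasure a b) := by
  have h1 : MemLp (rep f) 2 (intervalMeasure a b) :=
    (memLp_congr_ae (profile_ae_eq (E := E3) f)).1 (memLp_profile (E := E3) f)
  have h2 := memLp_der (E := E3) f
  refine (h1.integrable_norm_pow (by norm_num) |>.add
    (h2.integrable_norm_pow (by norm_num))).congr (Eventually.of_forall fun x => ?_)
  simp

/-- The quadratic form `⟨d, f ∧ d⟩` only involves `⟨d', f' ∧ d⟩`, so that it is small when `d` is
bounded in `H¹` and uniformly small. -/
theorem abs_inner_wedgeH_self_le (f d : State a b) {ε : ℝ} (hε : 0 ≤ ε)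
    (h : ∀ x ∈ Set.Icc a b, ‖rep d x‖ ≤ ε) :
    |inner ℝ d (wedgeH f d)| ≤ ε * (‖d‖ ^ 2 + ‖f‖ ^ 2) := by
  have hsq : ∀ g : State a b, ‖g‖ ^ 2 =
      ∫ x, (inner ℝ (rep g x) (rep g x) + inner ℝ (der g x) (der g x) : ℝ)
        ∂(intervalMeasure a b) := fun g => by
    rw [← real_inner_self_eq_norm_sq]
    exact inner_H1_eq g g
  have h1 : inner ℝ d (wedgeH f d) = ∫ x, (inner ℝ (rep d x) (rep (wedgeH f d) x) +
      inner ℝ (der d x) (der (wedgeH f d) x) : ℝ) ∂(intervalMeasure a b) :=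
    inner_H1_eq d (wedgeH f d)
  rw [h1, hsq, hsq, ← integral_add (integrable_inner_add_inner_der d)
    (integrable_inner_add_inner_der f), ← integral_const_mul, ← Real.norm_eq_abs]
  refine norm_integral_le_of_norm_le (((integrable_inner_add_inner_der d).add
    (integrable_inner_add_inner_der f)).const_mul ε) ?_
  filter_upwards [der_wedgeH f d, ae_restrict_mem measurableSet_Ioo] with x h2 hx
  have hx' := Set.Ioo_subset_Icc_self hx
  rw [h2, rep_wedgeH _ _ hx', inner_wedge_self_right, inner_add_right, inner_wedge_self_right,
    add_zero, zero_add, real_inner_self_eq_norm_sq, real_inner_self_eq_norm_sq,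
    real_inner_self_eq_norm_sq, real_inner_self_eq_norm_sq]
  have h3 : ‖inner ℝ (der d x) (wedge (der f x) (rep d x))‖ ≤
      ‖der d x‖ * (‖der f x‖ * ‖rep d x‖) :=
    (norm_inner_le_norm _ _).trans (mul_le_mul_of_nonneg_left (norm_wedge_le _ _) (norm_nonneg _))
  have h4 : ‖der d x‖ * (‖der f x‖ * ‖rep d x‖) ≤ ‖der d x‖ * (‖der f x‖ * ε) := by
    gcongr
    exact h x hx'
  have h5 : ‖der d x‖ * ‖der f x‖ ≤
      ‖rep d x‖ ^ 2 + ‖der d x‖ ^ 2 + (‖rep f x‖ ^ 2 + ‖der f x‖ ^ 2) := by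
    nlinarith [sq_nonneg (‖der d x‖ - ‖der f x‖), sq_nonneg ‖rep d x‖, sq_nonneg ‖rep f x‖,
      sq_nonneg ‖der d x‖, sq_nonneg ‖der f x‖]
  have h6 := mul_le_mul_of_nonneg_left h5 hε
  linarith

/-- The functionals `N ↦ ⟨N + e₃, f ∧ N⟩`, although quadratic, are continuous along bounded
weakly convergent families. -/
theorem tendsto_inner_sub_wedgeH (f p : State a b) {u : α → State a b} {v : State a b} {r : ℝ}
    (hr : ∀ n, ‖u n‖ ≤ r)
    (h : ∀ w, Tendsto (fun n => inner ℝ w (u n)) l (𝓝 (inner ℝ w v))) :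
    Tendsto (fun n => inner ℝ (u n - p) (wedgeH f (u n))) l
      (𝓝 (inner ℝ (v - p) (wedgeH f v))) := by
  have hd : ∀ n, ‖u n - v‖ ≤ r + ‖v‖ := fun n =>
    (norm_sub_le _ _).trans (add_le_add (hr n) le_rfl)
  have hquad : Tendsto (fun n => inner ℝ (u n - v) (wedgeH f (u n - v))) l (𝓝 0) := by
    rw [Metric.tendsto_nhds]
    intro ε hε
    have hc : 0 < (r + ‖v‖) ^ 2 + ‖f‖ ^ 2 + 1 := by positivity
    filter_upwards [eventually_norm_rep_le hd (tendsto_rep_sub_of_weak h)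
      (show 0 < ε / ((r + ‖v‖) ^ 2 + ‖f‖ ^ 2 + 1) by positivity)] with n hn
    rw [Real.dist_eq, sub_zero]
    refine (abs_inner_wedgeH_self_le f _ (by positivity) hn).trans_lt ?_
    rw [div_mul_eq_mul_div, div_lt_iff₀ hc]
    have h1 : ‖u n - v‖ ^ 2 ≤ (r + ‖v‖) ^ 2 := pow_le_pow_left₀ (norm_nonneg _) (hd n) 2
    refine mul_lt_mul_of_pos_left ?_ hε
    linarith
  have h1 : Tendsto (fun n => inner ℝ (wedgeH f v) (u n)) l (𝓝 (inner ℝ (wedgeH f v) v)) := h _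
  have h2 : Tendsto (fun n => inner ℝ (v - p) (wedgeH f (u n))) l
      (𝓝 (inner ℝ (v - p) (wedgeH f v))) :=
    tendsto_clm_of_weak h ((innerSL ℝ (v - p)).comp (wedgeH f))
  have h3 := (h2.add (h1.sub_const (inner ℝ (wedgeH f v) v))).add hquad
  rw [sub_self, add_zero, add_zero] at h3
  refine h3.congr fun n => ?_
  rw [map_sub, inner_sub_right, real_inner_comm (u n) (wedgeH f v),
    real_inner_comm v (wedgeH f v)]
  simp only [inner_sub_left]
  ring

end WeakState

/-! ### The invariant set -/

/-- A functional vanishing along an orbit of a one-parameter group during some time vanishes on the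
cyclic subspace spanned by this orbit. -/
theorem apply_pow_eq_zero_of_expOp {V : Type*} [NormedAddCommGroup V] [NormedSpace ℝ V]
    [CompleteSpace V] (A : V →L[ℝ] V) (ℓ : V →L[ℝ] ℝ) (v : V) {τ : ℝ} (hτ : 0 < τ)
    (h : ∀ s ∈ Set.Ioo 0 τ, ℓ (expOp A s v) = 0) (m : ℕ) : ℓ ((A ^ m) v) = 0 := by
  have hd : ∀ (w : V) (s : ℝ), HasDerivAt (fun s => ℓ (expOp A s w)) (ℓ (expOp A s (A w))) s := by
    intro w s
    have h1 := (hasDerivAt_exp_smul_const (𝕂 := ℝ) A s).clm_apply (hasDerivAt_const s w)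
    rw [map_zero, add_zero] at h1
    exact ℓ.hasFDerivAt.comp_hasDerivAt s h1
  have hm : ∀ m : ℕ, ∀ s ∈ Set.Ioo 0 τ, ℓ (expOp A s ((A ^ m) v)) = 0 := by
    intro m
    induction m with
    | zero => exact h
    | succ m ih =>
      intro s hs
      have h1 : (fun s => ℓ (expOp A s ((A ^ m) v))) =ᶠ[𝓝 s] fun _ => 0 := by
        filter_upwards [Ioo_mem_nhds hs.1 hs.2] with y hy
        exact ih y hy
      have h2 := (hd ((A ^ m) v) s).unique ((hasDerivAt_const s (0 : ℝ)).congr_of_eventuallyEq h1)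
      rw [pow_succ']
      exact h2
  have h1 : Tendsto (fun s => ℓ (expOp A s ((A ^ m) v))) (𝓝[>] 0) (𝓝 (ℓ (expOp A 0 ((A ^ m) v)))) :=
    (hd _ 0).continuousAt.tendsto.mono_left nhdsWithin_le_nhds
  have h2 : Tendsto (fun s => ℓ (expOp A s ((A ^ m) v))) (𝓝[>] 0) (𝓝 0) := by
    refine tendsto_const_nhds.congr' ?_
    filter_upwards [Ioo_mem_nhdsGT hτ] with s hs
    exact (hm m s hs).symm
  have h3 := tendsto_nhds_unique h1 h2
  rwa [expOp, zero_smul, NormedSpace.exp_zero] at h3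

section Invariant

variable {a b : ℝ} [hab : Fact (a < b)]

theorem rotGen_pow_constS (m : ℕ) (v : E3) :
    ∀ x ∈ Set.Icc a b, rep ((rotGen ^ m) (constS v : State a b)) x = x ^ m • (S ^ m) v := by
  induction m with
  | zero =>
    intro x hx
    rw [pow_zero, pow_zero, pow_zero, one_smul]
    exact rep_constS v hx
  | succ m ih =>
    intro x hx
    have h1 : (rotGen ^ (m + 1)) (constS v : State a b) = rotGen ((rotGen ^ m) (constS v)) := by
      rw [pow_succ']
      rfl
    have h2 : (S ^ (m + 1)) v = S ((S ^ m) v) := by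
      rw [pow_succ']
      rfl
    rw [h1, rep_rotGen _ hx, ih x hx, h2, map_smul, smul_smul, pow_succ']

/-- `S` acts on the plane spanned by `e₁` and `e₂` as a rotation. -/
theorem exists_S_pow_eq (m : ℕ) (p q : ℝ) :
    ∃ p' q' : ℝ, (S ^ m) (p' • e 0 + q' • e 1) = p • e 0 + q • e 1 := by
  induction m with
  | zero => exact ⟨p, q, rfl⟩
  | succ m ih =>
    obtain ⟨p', q', h⟩ := ih
    refine ⟨-q', p', ?_⟩
    have h1 : S ((-q') • e 0 + p' • e 1) = p' • e 0 + q' • e 1 := by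
      rw [map_add, map_smul, map_smul, S_e_zero, S_e_one, smul_neg, neg_smul, neg_neg, add_comm]
    rw [pow_succ]
    exact (congrArg (S ^ m) h1).trans h

/-- A functional on states vanishing along the free motions of `e₁` and `e₂` vanishes on all
transverse fields `φ₁ e₁ + φ₂ e₂`, because polynomials are dense in `H¹`. -/
theorem apply_smulH_eq_zero (ℓ : State a b →L[ℝ] ℝ) {τ : ℝ} (hτ : 0 < τ)
    (h : ∀ i : Fin 2, ∀ s ∈ Set.Ioo 0 τ, ℓ (expOp rotGen s (constS (e i.castSucc))) = 0)
    (φ : H1 a b ℝ) (p q : ℝ) : ℓ (smulH φ (constS (p • e 0 + q • e 1))) = 0 := by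
  have h1 : (ℓ.comp (smulH.flip (constS (p • e 0 + q • e 1))) : H1 a b ℝ →L[ℝ] ℝ) = 0 := by
    refine eq_zero_of_coordPow _ fun m => ?_
    obtain ⟨p', q', hpq⟩ := exists_S_pow_eq m p q
    have h2 : smulH (coordPow m) (constS (p • e 0 + q • e 1) : State a b) =
        p' • (rotGen ^ m) (constS (e 0)) + q' • (rotGen ^ m) (constS (e 1)) := by
      refine State.ext fun x hx => ?_
      rw [rep_smulH _ _ hx, rep_coordPow _ hx, rep_constS _ hx, State.rep_add _ _ hx,
        State.rep_smul _ _ hx, State.rep_smul _ _ hx, rotGen_pow_constS _ _ x hx,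
        rotGen_pow_constS _ _ x hx, ← hpq, map_add, map_smul, map_smul, smul_add,
        smul_comm p', smul_comm q']
    change ℓ (smulH (coordPow m) (constS (p • e 0 + q • e 1))) = 0
    rw [h2, map_add, map_smul, map_smul]
    have e0 := apply_pow_eq_zero_of_expOp rotGen ℓ (constS (e 0)) hτ (h 0) m
    have e1 := apply_pow_eq_zero_of_expOp rotGen ℓ (constS (e 1)) hτ (h 1) m
    rw [e0, e1, smul_zero, smul_zero, add_zero]
  exact congrArg (fun L : H1 a b ℝ →L[ℝ] ℝ => L φ) h1

/-- A state with values in the sphere is pointwise orthogonal to its derivative. -/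
theorem inner_der_rep_eq_zero {n : State a b} (hn : ∀ x ∈ Set.Icc a b, ‖rep n x‖ = 1) :
    ∀ᵐ x ∂(intervalMeasure a b), (inner ℝ (der n x) (rep n x) : ℝ) = 0 := by
  have h1 := der_bilin innerL (n : H1 a b E3) n
  have h2 : der (bilin innerL (n : H1 a b E3) n) =ᵐ[intervalMeasure a b] fun _ => (0 : ℝ) :=
    der_ae_eq_of_rep_eq (IsAC2.const (1 : ℝ)) fun x hx => by
      refine (rep_bilin innerL (n : H1 a b E3) n hx).trans ?_
      rw [innerL_apply, real_inner_self_eq_norm_sq, hn x hx, one_pow]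
  filter_upwards [h1, h2] with x k1 k2
  have h4 : (inner ℝ (der n x) (rep n x) + inner ℝ (rep n x) (der n x) : ℝ) = 0 :=
    k1.symm.trans k2
  rw [real_inner_comm (der n x) (rep n x)] at h4
  linarith

/-- The identity closing the argument: for `Φ = n ∧ e₃`, the derivative
`⟨n + e₃, Φ ∧ n⟩ = ∫ (1 - ζ²) - ζ |n'|²`, with `ζ = ⟨e₃, n⟩`, is positive for `n ≠ -e₃` in the
southern hemisphere. -/
theorem eq_south_of_inner_eq_zero {n : State a b} (hn : ∀ x ∈ Set.Icc a b, ‖rep n x‖ = 1)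
    (hs : ∀ x ∈ Set.Icc a b, (inner ℝ (e 2) (rep n x) : ℝ) < 0)
    (h : inner ℝ (n - south) (wedgeH (wedgeH n (constS (e 2))) n) = 0) : n = south := by
  obtain ⟨Φ, hΦ⟩ : ∃ Φ : State a b, Φ = wedgeH n (constS (e 2)) := ⟨_, rfl⟩
  have hder : der Φ =ᵐ[intervalMeasure a b] fun x => wedge (der n x) (e 2) := by
    have h2 : der (constS (e 2) : State a b) =ᵐ[intervalMeasure a b] fun _ => 0 :=
      der_constH (e 2)
    rw [hΦ]
    filter_upwards [der_wedgeH n (constS (e 2)), h2, ae_restrict_mem measurableSet_Ioo]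
      with x k1 k2 hx
    rw [k1, k2, rep_constS _ (Set.Ioo_subset_Icc_self hx), ← wedgeL_apply (rep n x), map_zero,
      add_zero]
  rw [← hΦ, inner_sub_south_wedge] at h
  have hval : (fun x => (inner ℝ (der n x) (wedge (der Φ x) (rep n x)) +
      inner ℝ (e 2) (wedge (rep Φ x) (rep n x)) : ℝ)) =ᵐ[intervalMeasure a b]
      fun x => (1 - (inner ℝ (e 2) (rep n x)) ^ 2) -
        inner ℝ (e 2) (rep n x) * ‖der n x‖ ^ 2 := by
    filter_upwards [hder, inner_der_rep_eq_zero hn, ae_restrict_mem measurableSet_Ioo]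
      with x k1 k2 hx
    have hx' := Set.Ioo_subset_Icc_self hx
    rw [k1, hΦ, rep_wedgeH _ _ hx', rep_constS _ hx', wedge_wedge, wedge_wedge, inner_sub_right,
      inner_sub_right, inner_smul_right, inner_smul_right, inner_smul_right, inner_smul_right,
      k2, real_inner_self_eq_norm_sq, real_inner_self_eq_norm_sq, real_inner_self_eq_norm_sq,
      hn x hx', norm_e]
    ring
  have hle : ∀ x ∈ Set.Icc a b, (inner ℝ (e 2) (rep n x) : ℝ) ^ 2 ≤ 1 := fun x hx => by
    have h1 := abs_real_inner_le_norm (e 2) (rep n x)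
    rw [norm_e, hn x hx, one_mul] at h1
    rw [sq_le_one_iff_abs_le_one]
    exact h1
  have hint : Integrable (fun x => (1 - (inner ℝ (e 2) (rep n x)) ^ 2) -
        inner ℝ (e 2) (rep n x) * ‖der n x‖ ^ 2 : ℝ → ℝ) (intervalMeasure a b) := by
    have hcont : ContinuousOn (fun x => (inner ℝ (e 2) (rep n x) : ℝ)) (Set.Icc a b) :=
      continuousOn_const.inner (continuousOn_rep (E := E3) n)
    have h1 : Integrable (fun x => (1 - (inner ℝ (e 2) (rep n x)) ^ 2 : ℝ))
        (intervalMeasure a b) :=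
      ((continuousOn_const.sub (hcont.pow 2)).integrableOn_Icc).mono_set Set.Ioo_subset_Icc_self
    have h2 : Integrable (fun x => ‖der n x‖ ^ 2) (intervalMeasure a b) :=
      (memLp_der (E := E3) n).integrable_norm_pow (by norm_num)
    refine h1.sub (h2.bdd_mul (c := 1) ((hcont.mono Set.Ioo_subset_Icc_self).aestronglyMeasurable
      measurableSet_Ioo) ?_)
    filter_upwards [ae_restrict_mem measurableSet_Ioo] with x hx
    rw [Real.norm_eq_abs, ← sq_le_one_iff_abs_le_one]
    exact hle x (Set.Ioo_subset_Icc_self hx)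
  rw [integral_congr_ae hval, integral_eq_zero_iff_of_nonneg_ae ?_ hint] at h
  · refine H1_ext_profile (E := E3) ?_
    filter_upwards [h, profile_ae_eq (E := E3) n, profile_ae_eq (E := E3) (south : State a b),
      ae_restrict_mem measurableSet_Ioo] with x k1 k2 k3 hx
    have hx' := Set.Ioo_subset_Icc_self hx
    rw [k2, k3, rep_south hx']
    have h1 := hle x hx'
    have h2 := hs x hx'
    have h3 : 0 ≤ - inner ℝ (e 2) (rep n x) * ‖der n x‖ ^ 2 := by
      have := neg_pos.2 h2
      positivity
    have h4 : (inner ℝ (e 2) (rep n x) : ℝ) ^ 2 = 1 := by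
      have k4 : (1 - (inner ℝ (e 2) (rep n x)) ^ 2) -
        inner ℝ (e 2) (rep n x) * ‖der n x‖ ^ 2 = 0 := k1
      linarith
    have h5 : (inner ℝ (e 2) (rep n x) : ℝ) = -1 := by nlinarith
    have h6 : ‖rep n x + e 2‖ ^ 2 = 0 := by
      rw [norm_add_sq_real, real_inner_comm, h5, hn x hx', norm_e]
      norm_num
    exact eq_neg_of_add_eq_zero_left (norm_eq_zero.1 (pow_eq_zero_iff two_ne_zero |>.1 h6))
  · filter_upwards [ae_restrict_mem measurableSet_Ioo] with x hx
    have hx' := Set.Ioo_subset_Icc_self hx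
    have h1 := hle x hx'
    have h3 : 0 ≤ - inner ℝ (e 2) (rep n x) * ‖der n x‖ ^ 2 := by
      have := neg_pos.2 (hs x hx')
      positivity
    change (0 : ℝ) ≤ _
    linarith

variable {R : H1 a b M3} {hR : ∀ x ∈ Set.Icc a b, IsRot (rep R x)}

/-- States close to `-e₃` at which all outputs vanish during some time: only `-e₃` itself.
The field `n ∧ e₃` is a combination of `n`, along which nothing changes, and of transverse
fields in the moving frame. -/
theorem eq_south_of_output_eq_zero {T : ℝ} (hT : 0 < T) {n : State a b}
    (hn : ∀ x ∈ Set.Icc a b, ‖rep n x‖ = 1)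
    (hs : ∀ x ∈ Set.Icc a b, (inner ℝ (e 2) (rep n x) : ℝ) < 0)
    (hne : ∀ x ∈ Set.Icc a b, (inner ℝ (rep R x (e 2)) (rep n x) : ℝ) ≠ 0)
    (h : ∀ i, ∀ s ∈ Set.Ioo 0 T, output south ((frameModel R hR).controlOp T) i s n = 0) :
    n = south := by
  refine eq_south_of_inner_eq_zero hn hs ?_
  obtain ⟨ℓ, hℓ⟩ : ∃ ℓ : State a b →L[ℝ] ℝ,
      ∀ v, ℓ v = inner ℝ (n - south) (wedgeH (mulOp R v) n) :=
    ⟨(innerSL ℝ (n - south)).comp ((wedgeH.flip n).comp (mulOp R)), fun v => rfl⟩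
  have hℓ0 := apply_smulH_eq_zero ℓ hT (fun i s hs => by
    have h1 := h i s hs
    rw [output, SpinModel.controlOp, SpinModel.frameField,
      sigma_eq_self hT hs.1.le hs.2.le] at h1
    rw [hℓ]
    exact h1)
  -- the coordinates of `n ∧ e₃` and of `n` in the frame `R`
  obtain ⟨w, hw⟩ : ∃ w : State a b, ∀ x ∈ Set.Icc a b, rep w x = adjL (rep R x) (wedge (rep n x) (e 2)) :=
    ⟨mulOp (compL adjL R) (wedgeH n (constS (e 2))), fun x hx => by
      rw [rep_mulOp _ _ hx, rep_compL _ _ hx, rep_wedgeH _ _ hx, rep_constS _ hx]⟩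
  obtain ⟨n', hn'⟩ : ∃ n' : State a b, ∀ x ∈ Set.Icc a b, rep n' x = adjL (rep R x) (rep n x) :=
    ⟨mulOp (compL adjL R) n, fun x hx => by rw [rep_mulOp _ _ hx, rep_compL _ _ hx]⟩
  have hcoord : ∀ (f : State a b) (i : Fin 3), ∃ φ : H1 a b ℝ, ∀ x ∈ Set.Icc a b,
      rep φ x = rep f x i := fun f i =>
    ⟨compL (EuclideanSpace.proj i) (f : H1 a b E3), fun x hx => rep_compL (EuclideanSpace.proj i) (f : H1 a b E3) hx⟩
  obtain ⟨w2, hw2⟩ := hcoord w 2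
  obtain ⟨n2, hn2⟩ := hcoord n' 2
  have hn2ne : ∀ x ∈ Set.Icc a b, rep n2 x ≠ 0 := by
    intro x hx
    have h1 : rep n' x 2 = inner ℝ (e 2) (rep n' x) := by
      obtain ⟨c0, c1, c2⟩ := e_two
      rw [inner_E3, c0, c1, c2]
      ring
    rw [hn2 x hx, h1, ← (hR x hx).inner, hn' x hx, (hR x hx).apply_adj_apply]
    exact hne x hx
  obtain ⟨inv, hinv⟩ := exists_inv n2 hn2ne
  obtain ⟨φ, hφ⟩ : ∃ φ : H1 a b ℝ, ∀ x ∈ Set.Icc a b, rep φ x = rep w2 x * rep inv x :=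
    ⟨bilin (ContinuousLinearMap.mul ℝ ℝ) w2 inv, fun x hx =>
      rep_bilin (ContinuousLinearMap.mul ℝ ℝ) w2 inv hx⟩
  obtain ⟨v, hv⟩ : ∃ v : State a b, v = w - smulH φ n' := ⟨_, rfl⟩
  have hvrep : ∀ x ∈ Set.Icc a b, rep v x = rep w x - rep φ x • rep n' x := fun x hx => by
    rw [hv, State.rep_sub _ _ hx, rep_smulH _ _ hx]
  have hv2 : ∀ x ∈ Set.Icc a b, rep v x 2 = 0 := by
    intro x hx
    rw [hvrep x hx, PiLp.sub_apply, PiLp.smul_apply, hφ x hx, hinv x hx, ← hw2 x hx, ← hn2 x hx,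
      smul_eq_mul, inv_mul_cancel_right₀ (hn2ne x hx), sub_self]
  obtain ⟨v0, hv0⟩ := hcoord v 0
  obtain ⟨v1, hv1⟩ := hcoord v 1
  have hdec : v = smulH v0 (constS ((1 : ℝ) • e 0 + (0 : ℝ) • e 1)) +
      smulH v1 (constS ((0 : ℝ) • e 0 + (1 : ℝ) • e 1)) := by
    refine State.ext fun x hx => ?_
    rw [State.rep_add _ _ hx, rep_smulH _ _ hx, rep_smulH _ _ hx, rep_constS _ hx,
      rep_constS _ hx, hv0 x hx, hv1 x hx, one_smul, zero_smul, one_smul, zero_smul, add_zero,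
      zero_add]
    have h1 := E3_eq_sum (rep v x)
    rwa [hv2 x hx, zero_smul, add_zero] at h1
  have hℓv : ℓ v = 0 := by rw [hdec, map_add, hℓ0, hℓ0, add_zero]
  rw [hℓ] at hℓv
  have hfin : wedgeH (mulOp R v) n = wedgeH (wedgeH n (constS (e 2))) n := by
    refine State.ext fun x hx => ?_
    rw [rep_wedgeH _ _ hx, rep_wedgeH _ _ hx, rep_mulOp _ _ hx, rep_wedgeH _ _ hx,
      rep_constS _ hx, hvrep x hx, map_sub, map_smul, hw x hx, hn' x hx,
      (hR x hx).apply_adj_apply, (hR x hx).apply_adj_apply, ← wedgeL_apply (_ - _), map_sub,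
      map_smul, sub_apply, smul_apply, wedgeL_apply, wedgeL_apply, wedge_self, smul_zero, sub_zero]
  rw [← hfin]
  exact hℓv

end Invariant

/-! ### Convergence -/

theorem tendsto_toWeakSpace {V α : Type*} [NormedAddCommGroup V] [InnerProductSpace ℝ V]
    [CompleteSpace V] {l : Filter α} {u : α → V} {v : V}
    (h : ∀ w, Tendsto (fun k => inner ℝ w (u k)) l (𝓝 (inner ℝ w v))) :
    Tendsto (fun k => toWeakSpace ℝ V (u k)) l (𝓝 (toWeakSpace ℝ V v)) := by
  refine (WeakBilin.tendsto_iff_forall_eval_tendsto (topDualPairing ℝ V).flip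
    (fun x y hxy => ?_)).2 fun φ => ?_
  · exact ext_inner_left ℝ fun w => DFunLike.congr_fun hxy (innerSL ℝ w)
  · exact tendsto_clm_of_weak h φ

section Convergence

variable {a b : ℝ} [hab : Fact (a < b)] {R : H1 a b M3} {hR : ∀ x ∈ Set.Icc a b, IsRot (rep R x)}
  {T : ℝ} {N : ℝ → State a b}

/-- Each spin keeps its length, the field being pointwise orthogonal to the state. -/
theorem norm_rep_eq_of_damped
    (hN : ∀ τ, IsSolutionOn (dampedField south ((frameModel R hR).controlOp T)) τ N) {x : ℝ}
    (hx : x ∈ Set.Icc a b) {t : ℝ} (ht : 0 ≤ t) : ‖rep (N t) x‖ = ‖rep (N 0) x‖ := by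
  rcases ht.eq_or_lt with rfl | ht
  · rfl
  have hd : ∀ s ∈ Set.Ioo 0 t, HasDerivAt (fun s => ‖evalS ⟨x, hx⟩ (N s)‖ ^ 2) 0 s := by
    intro s hs
    have h1 := ((evalS ⟨x, hx⟩).hasFDerivAt.comp_hasDerivAt s
      (hasDerivAt_of_global hN hs.1)).norm_sq
    have h2 : (inner ℝ (evalS ⟨x, hx⟩ (N s)) (evalS ⟨x, hx⟩
        (dampedField south ((frameModel R hR).controlOp T) s (N s))) : ℝ) = 0 := by
      rw [dampedField, map_neg, map_sum, inner_neg_right, inner_sum, Finset.sum_eq_zero, neg_zero]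
      intro i _
      rw [map_smul, inner_smul_right]
      refine mul_eq_zero_of_right _ ?_
      have h3 : evalS ⟨x, hx⟩ ((frameModel R hR).controlOp T i s (N s)) =
          wedge (rep ((frameModel R hR).frameField T i s) x) (rep (N s) x) := rep_wedgeH _ _ hx
      rw [h3]
      exact inner_wedge_self_right _ _
    have h4 := h1.congr_deriv (g' := 0) (by
      rw [Function.comp_apply, h2, mul_zero])
    exact h4
  obtain ⟨s, hs, he⟩ := exists_hasDerivAt_eq_slope (fun s => ‖evalS ⟨x, hx⟩ (N s)‖ ^ 2)
    (fun _ => 0) ht (((evalS ⟨x, hx⟩).continuous.comp_continuousOn (hN t).continuousOn).norm.pow 2)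
    hd
  have h5 : ‖evalS ⟨x, hx⟩ (N t)‖ ^ 2 = ‖evalS ⟨x, hx⟩ (N 0)‖ ^ 2 := by
    rw [eq_comm, div_eq_zero_iff] at he
    rcases he with he | he
    · exact sub_eq_zero.1 he
    · linarith
  exact (pow_left_inj₀ (norm_nonneg _) (norm_nonneg _) two_ne_zero).1 h5

/-- LaSalle's principle: along the solutions starting close to `-e₃`, the states at the multiples
of the period converge weakly to `-e₃`. -/
theorem tendsto_weak_south (hT : 0 < T)
    (hN : ∀ τ, IsSolutionOn (dampedField south ((frameModel R hR).controlOp T)) τ N)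
    (hN0 : ∀ x ∈ Set.Icc a b, ‖rep (N 0) x‖ = 1) {η : ℝ} (hη : η < 1)
    (hclose : sobolevConst a b * ‖N 0 - south‖ ≤ η)
    (hne : ∀ x ∈ Set.Icc a b, η < |(inner ℝ (rep R x (e 2)) (e 2) : ℝ)|) (w : State a b) :
    Tendsto (fun k : ℕ => inner ℝ w (N (k * (2 * T)))) atTop (𝓝 (inner ℝ w south)) := by
  have hk : ∀ k : ℕ, 0 ≤ (k : ℝ) * (2 * T) := fun k => by positivity
  have hr : ∀ k : ℕ, ‖N (k * (2 * T))‖ ≤ ‖N 0 - south‖ + ‖(south : State a b)‖ := fun k =>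
    (norm_le_norm_sub_add _ south).trans
      (add_le_add (norm_sub_le_of_global hN le_rfl (hk k)) le_rfl)
  rw [tendsto_iff_ultrafilter]
  intro 𝒰 h𝒰
  obtain ⟨n, hn⟩ := exists_weak_limit 𝒰 hr
  have hpt : ∀ x ∈ Set.Icc a b, Tendsto (fun k : ℕ => rep (N (k * (2 * T))) x) 𝒰 (𝓝 (rep n x)) :=
    fun x hx => tendsto_clm_E3_of_weak hn (evalS ⟨x, hx⟩)
  have hn1 : ∀ x ∈ Set.Icc a b, ‖rep n x‖ = 1 := fun x hx =>
    tendsto_nhds_unique (hpt x hx).norm (tendsto_const_nhds.congr fun k =>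
      ((norm_rep_eq_of_damped hN hx (hk k)).trans (hN0 x hx)).symm)
  have hnη : ∀ x ∈ Set.Icc a b, ‖rep n x + e 2‖ ≤ η := fun x hx => by
    refine le_of_tendsto ((hpt x hx).add_const (e 2)).norm (Eventually.of_forall fun k => ?_)
    have h1 : ‖rep (N (k * (2 * T)) - south : State a b) x‖ ≤ _ :=
      norm_rep_le (E := E3) (N (k * (2 * T)) - south : State a b) hx
    rw [State.rep_sub _ _ hx, rep_south hx, sub_neg_eq_add] at h1
    refine h1.trans (le_trans ?_ hclose)
    exact mul_le_mul_of_nonneg_left (norm_sub_le_of_global hN le_rfl (hk k)) sobolevConst_pos.le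
  have hsouth : n = south := by
    obtain ⟨K, hK, hKl⟩ := (frameModel R hR).exists_controlOp_bound hT
    refine eq_south_of_output_eq_zero (R := R) (hR := hR) hT hn1 (fun x hx => ?_)
      (fun x hx h0 => ?_) fun i s hs => ?_
    · have h1 := abs_real_inner_le_norm (e 2) (rep n x + e 2)
      rw [inner_add_right, real_inner_self_eq_norm_sq, norm_e, one_pow, one_mul] at h1
      have h2 := (abs_le.1 (h1.trans (hnη x hx))).2
      linarith
    · have h1 := abs_real_inner_le_norm (rep R x (e 2)) (rep n x + e 2)
      rw [inner_add_right, h0, zero_add, (hR x hx).norm_map, norm_e, one_mul] at h1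
      exact absurd (h1.trans (hnη x hx)) (not_le.2 (hne x hx))
    · have h1 : Tendsto (fun k : ℕ => output south ((frameModel R hR).controlOp T) i s
          (N (k * (2 * T)))) 𝒰 (𝓝 0) :=
        (tendsto_output_period hK hKl hN (by positivity : 0 < 2 * T)
          ((frameModel R hR).controlOp_periodic hT) i hs.1.le).mono_left h𝒰
      have h2 := tendsto_inner_sub_wedgeH ((frameModel R hR).frameField T i s) south hr hn
      exact tendsto_nhds_unique h2 h1
  rw [← hsouth]
  exact hn w

theorem rotInv_south {Mf : State a b} (hMf : ∀ x ∈ Set.Icc a b, rep R x (rep Mf x) = - e 2) :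
    (frameModel R hR).rotInv south = Mf := by
  refine State.ext fun x hx => ?_
  refine (rep_mulOp (compL adjL R) south hx).trans ?_
  rw [rep_south hx, ← hMf x hx, rep_compL _ _ hx, (hR x hx).adj_apply_apply]

theorem norm_rot_sub_south_le {Mf : State a b}
    (hMf : ∀ x ∈ Set.Icc a b, rep R x (rep Mf x) = - e 2) (M : State a b) :
    ‖(frameModel R hR).rot M - south‖ ≤ 3 * sobolevConst a b * ‖applyL‖ * ‖R‖ * ‖M - Mf‖ := by
  have h1 : (south : State a b) = mulOp R Mf := State.ext fun x hx => by
    rw [rep_south hx, rep_mulOp _ _ hx, hMf x hx]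
  have h2 : (frameModel R hR).rot M - south = mulOp R (M - Mf) := by
    rw [h1, map_sub]
    rfl
  rw [h2]
  exact norm_bilin_le applyL R (M - Mf : State a b)

theorem tendsto_eLpNorm_top {u : ℕ → State a b} {v : State a b} {r : ℝ} (hr : ∀ k, ‖u k‖ ≤ r)
    (h : ∀ w, Tendsto (fun k => inner ℝ w (u k)) atTop (𝓝 (inner ℝ w v))) :
    Tendsto (fun k => eLpNorm (fun ω => profile (u k) ω - profile v ω) ∞ (intervalMeasure a b))
      atTop (𝓝 0) := by
  have hd : ∀ k, ‖u k - v‖ ≤ r + ‖v‖ := fun k =>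
    (norm_sub_le _ _).trans (add_le_add (hr k) le_rfl)
  rw [ENNReal.tendsto_nhds_zero]
  intro ε hε
  by_cases hε' : ε = ∞
  · exact Eventually.of_forall fun k => by rw [hε']; exact le_top
  filter_upwards [eventually_norm_rep_le hd (tendsto_rep_sub_of_weak h)
    (ENNReal.toReal_pos hε.ne' hε')] with k hk
  rw [eLpNorm_exponent_top]
  refine (eLpNormEssSup_le_of_ae_bound (C := ε.toReal) ?_).trans (ENNReal.ofReal_toReal hε').le
  filter_upwards [profile_ae_eq (E := E3) (u k), profile_ae_eq (E := E3) v,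
    ae_restrict_mem measurableSet_Ioo] with x h1 h2 hx
  have hx' := Set.Ioo_subset_Icc_self hx
  have h3 := hk x hx'
  rw [State.rep_sub _ _ hx'] at h3
  rw [h1, h2]
  exact h3

/-- The size of the neighbourhood of the target: it keeps the transformed states in the southern
hemisphere, and away from the planes orthogonal to `R(ω) e₃`. -/
theorem exists_radius {Mf : State a b} (hMf : ∀ x ∈ Set.Icc a b, (inner ℝ (rep Mf x) (e 2) : ℝ) ≠ 0) :
    ∃ η, 0 < η ∧ η < 1 ∧ ∀ x ∈ Set.Icc a b, η < |(inner ℝ (rep Mf x) (e 2) : ℝ)| := by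
  obtain ⟨x₀, hx₀, hmin⟩ := isCompact_Icc.exists_isMinOn (Set.nonempty_Icc.2 hab.out.le)
    ((continuousOn_rep (E := E3) Mf).inner (𝕜 := ℝ) (continuousOn_const (c := e 2))).abs
  have hpos := abs_pos.2 (hMf x₀ hx₀)
  refine ⟨min 1 |(inner ℝ (rep Mf x₀) (e 2) : ℝ)| / 2, by positivity, ?_, fun x hx => ?_⟩
  · have := min_le_left 1 |(inner ℝ (rep Mf x₀) (e 2) : ℝ)|
    linarith
  · have h1 := min_le_right 1 |(inner ℝ (rep Mf x₀) (e 2) : ℝ)|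
    have h2 : |(inner ℝ (rep Mf x₀) (e 2) : ℝ)| ≤ |(inner ℝ (rep Mf x) (e 2) : ℝ)| := hmin hx
    linarith

end Convergence

end

end BlochEnsemble

theorem mainTheorem2 (a b : ℝ) (hab : a < b) (T : ℝ) (hT : 0 < T)
    (Mf : H1 a b E3) (hMf : SphereValued Mf)
    (heq : AvoidsEquator Mf) :
    (∃ R : H1 a b M3, IsFrame Mf R) ∧
    ∀ C : ℝ, ∃ δ₂ : ℝ, 0 < δ₂ ∧
      ∀ R : H1 a b M3, IsFrame Mf R → ‖R‖ ≤ C * ‖Mf‖ →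
      ∀ M₀ : H1 a b E3, SphereValued M₀ → ‖M₀ - Mf‖ < δ₂ →
        -- existence of the closed-loop solution
        (∃ M : ℝ → H1 a b E3, IsClosedLoopSolution T R M₀ M) ∧
        -- uniqueness, away from the impulse times
        (∀ M M' : ℝ → H1 a b E3,
          IsClosedLoopSolution T R M₀ M → IsClosedLoopSolution T R M₀ M' →
            ∀ t : ℝ, 0 ≤ t → (∀ k : ℕ, 1 ≤ k → t ≠ k * T) → M t = M' t) ∧
        -- convergence of the right limits `M((2kT)⁺)`
        ∀ M : ℝ → H1 a b E3, IsClosedLoopSolution T R M₀ M →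
          ∃ Mplus : ℕ → H1 a b E3,
            (∀ k : ℕ, Tendsto M (𝓝[>] (2 * k * T)) (𝓝 (Mplus k))) ∧
            Tendsto (fun k => toWeakSpace ℝ (H1 a b E3) (Mplus k))
              atTop (𝓝 (toWeakSpace ℝ (H1 a b E3) Mf)) ∧
            Tendsto (fun k => eLpNorm (fun ω => profile (Mplus k) ω - profile Mf ω) ∞
              (intervalMeasure a b)) atTop (𝓝 0) := by
  have : Fact (a < b) := ⟨hab⟩
  refine ⟨exists_isFrame hMf heq, fun C => ?_⟩
  obtain ⟨η, hη0, hη1, hη⟩ := exists_radius (Mf := Mf) (inner_rep_ne_zero heq)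
  have hκ : 0 < sobolevConst a b * (3 * sobolevConst a b * ‖applyL‖ * (|C| * ‖Mf‖)) + 1 := by
    have h1 := sobolevConst_pos (a := a) (b := b)
    have h2 : 0 ≤ ‖applyL‖ := applyL.opNorm_nonneg
    have h3 : 0 ≤ ‖Mf‖ := norm_nonneg _
    positivity
  refine ⟨η / (sobolevConst a b * (3 * sobolevConst a b * ‖applyL‖ * (|C| * ‖Mf‖)) + 1),
    div_pos hη0 hκ, fun R hR hRC M₀ hM₀ hδ => ?_⟩
  have hrot := isRot_rep_of_isFrame hR
  have hRMf := rep_apply_of_isFrame hR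
  have hclose : sobolevConst a b *
      ‖(frameModel R hrot).rot (M₀ : State a b) - (frameModel R hrot).target‖ ≤ η := by
    have h1 := norm_rot_sub_south_le (hR := hrot) hRMf (M₀ : State a b)
    have h2 : ‖R‖ ≤ |C| * ‖Mf‖ := hRC.trans (mul_le_mul_of_nonneg_right (le_abs_self C)
      (norm_nonneg _))
    have h3 := sobolevConst_pos (a := a) (b := b)
    have h4 : 0 ≤ ‖applyL‖ := applyL.opNorm_nonneg
    have h5 : 0 ≤ ‖M₀ - Mf‖ := norm_nonneg _
    have h6 := (lt_div_iff₀ hκ).1 hδ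
    calc _ ≤ sobolevConst a b * (3 * sobolevConst a b * ‖applyL‖ * ‖R‖ * ‖M₀ - Mf‖) :=
          mul_le_mul_of_nonneg_left h1 h3.le
      _ ≤ sobolevConst a b *
          (3 * sobolevConst a b * ‖applyL‖ * (|C| * ‖Mf‖) * ‖M₀ - Mf‖) := by gcongr
      _ ≤ ‖M₀ - Mf‖ * (sobolevConst a b *
          (3 * sobolevConst a b * ‖applyL‖ * (|C| * ‖Mf‖)) + 1) := by linarith
      _ ≤ η := h6.le
  have hiff := fun M => isClosedLoopSolution_iff (hR := hrot) T M₀ M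
  refine ⟨?_, fun M M' hM hM' t ht hk => ?_, fun M hM => ?_⟩
  · obtain ⟨M, hM⟩ := (frameModel R hrot).exists_isSolution hT (M₀ : State a b)
    exact ⟨M, (hiff M).2 hM⟩
  · exact ((hiff M).1 hM).unique hT ((hiff M').1 hM') ht hk
  · obtain ⟨N, hN0, hN, hMN⟩ := ((hiff M).1 hM).exists_damped hT
    have hN1 : ∀ x ∈ Set.Icc a b, ‖rep (N 0) x‖ = 1 := fun x hx => by
      rw [hN0]
      refine (congrArg norm (rep_mulOp R M₀ hx)).trans ?_
      rw [(hrot x hx).norm_map, norm_rep_of_sphereValued hM₀ x hx]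
    have hweak := tendsto_weak_south hT hN hN1 hη1 (by rw [hN0]; exact hclose) fun x hx => by
      -- `⟨R e₃, e₃⟩ = - ⟨R e₃, R M_f⟩ = - ⟨e₃, M_f⟩`
      have h1 := (hrot x hx).inner (e 2) (rep Mf x)
      rw [hRMf x hx, inner_neg_right, real_inner_comm (rep Mf x)] at h1
      have h2 := hη x hx
      rwa [← h1, abs_neg] at h2
    have hbound : ∀ k : ℕ, ‖(frameModel R hrot).rotInv (N (k * (2 * T)))‖ ≤
        ‖(frameModel R hrot).rotInv‖ * (‖N 0 - south‖ + ‖(south : State a b)‖) := fun k => by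
      refine ((frameModel R hrot).rotInv.le_opNorm _).trans
        (mul_le_mul_of_nonneg_left ?_ (ContinuousLinearMap.opNorm_nonneg _))
      exact (norm_le_norm_sub_add _ south).trans
        (add_le_add (norm_sub_le_of_global hN le_rfl (by positivity)) le_rfl)
    have hlim : ∀ w : State a b,
        Tendsto (fun k : ℕ => inner ℝ w ((frameModel R hrot).rotInv (N (k * (2 * T))))) atTop
          (𝓝 (inner ℝ w (Mf : State a b))) := fun w => by
      have h1 := tendsto_clm_of_weak hweak ((innerSL ℝ w).comp (frameModel R hrot).rotInv)
      have h2 : (innerSL ℝ w).comp (frameModel R hrot).rotInv south =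
          inner ℝ w (Mf : State a b) := congrArg (inner ℝ w) (rotInv_south (hR := hrot) hRMf)
      rw [h2] at h1
      exact h1
    exact ⟨fun k => (frameModel R hrot).rotInv (N (k * (2 * T))),
      fun k => SpinModel.tendsto_right_of_damped hT hN hMN k,
      tendsto_toWeakSpace (V := H1 a b E3) hlim, tendsto_eLpNorm_top hbound hlim⟩
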